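/- Let $n\ge 2$, $R>0$, let $B_R\subset\mathbb{R}^n$ be the open ball of radius $R$ centred at the origin, with outer unit normal $\nu(x)=x/R$ and surface measure $dS$ on $\partial B_R$. Let $v,w\in C^2(\overline{B_R},\mathbb{R}^n)$ and consider the perturbations $$y(t,x)=x+t\,v(x)+\tfrac{t^2}{2}\,w(x)+r(t,x),\qquad x\in\overline{B_R},$$ where $r(t,\cdot)\in C^1(\overline{B_R},\mathbb{R}^n)$ for small $t$ and $\|r(t,\cdot)\|_{C^1(\overline{B_R})}=o(t^2)$ as $t\to0$. Assume that they preserve the volume to second order, that is, $$\int_{B_R}\operatorname{div}v\,dx=0\qquad\text{and}\qquad \int_{B_R}\big((\operatorname{div}v)^2-\partial_iv_j\,\partial_jv_i+\operatorname{div}w\big)\,dx=0$$ (summation over repeated indices). Put $N=v\cdot\nu$ and let $\nabla^\tau N=\nabla N-(\nabla N\cdot\nu)\nu$ be its tangential gradient on $\partial B_R$. Let $\mathcal S(t)=\oint_{\partial B_R}m(t)\,dS$ be the surface area of the perturbed surface $y(t,\partial B_R)$, where $m(t)(x)$ is the square root of the Gram determinant of $D_xy(t,x)$ restricted to the tangent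 space $x^{\perp}$ of $\partial B_R$ at $x$. Let $\ddot{\mathcal S}(0)$ denote its second variation, i.e. the number for which $\mathcal S(t)=\mathcal S(0)+t\,\dot{\mathcal S}(0)+\frac{t^2}{2}\ddot{\mathcal S}(0)+o(t^2)$ as $t\to0$. Then $\ddot{\mathcal S}(0)$ exists and $$\ddot{\mathcal S}(0)=\oint_{\partial B_R}|\nabla^\tau N|^2\,dS-\frac{n-1}{R^2}\oint_{\partial B_R}N^2\,dS .$$ If $r=0$, then $\mathcal S$ is twice continuously differentiable near $t=0$, and this number is its second derivative at $0$. Consequently, if there is no $a\in\mathbb{R}^n$ with $N(x)=a\cdot x$ for all $x\in\partial B_R$, then $\ddot{\mathcal S}(0)>0$. In particular, this holds for every such Hadamard perturbation, that is, one for which $v=N\nu$ and $w=(w\cdot\nu)\nu$ on $\partial B_R$. -/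

import Mathlib

open Metric MeasureTheory Asymptotics Topology
open scoped InnerProductSpace

noncomputable section

namespace BallVariation

/-- Euclidean space `ℝⁿ`. -/
abbrev Eucl (n : ℕ) : Type := EuclideanSpace ℝ (Fin n)

variable {n : ℕ}

/-- Surface measure `dS` on the sphere `∂B_R` centred at the origin (as a measure on `ℝⁿ` carried by
that sphere): the standard surface measure of the unit sphere, transported by `ω ↦ R ω` and
multiplied by `R ^ (n - 1)`. -/
def surfaceMeasure (n : ℕ) (R : ℝ) : Measure (Eucl n) :=
  ENNReal.ofReal (R ^ (n - 1)) •
    ((volume : Measure (Eucl n)).toSphere).map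
      (fun ω : sphere (0 : Eucl n) 1 => R • (ω : Eucl n))

/-- The outer unit normal `ν(x) = x / R` of `∂B_R`, extended linearly to `ℝⁿ`. -/
def normal (R : ℝ) (x : Eucl n) : Eucl n := R⁻¹ • x

/-- `N = v · ν`. -/
def normalComponent (R : ℝ) (v : Eucl n → Eucl n) (x : Eucl n) : ℝ := ⟪v x, normal R x⟫_ℝ

/-- The tangential gradient `∇^τ f = ∇f - (∇f · ν) ν` on `∂B_R` of a function `f` that is
differentiable on the closed ball. At points of the sphere it depends only on `f` restricted to
the sphere. -/
def tangentialGradient (R : ℝ) (f : Eucl n → ℝ) (x : Eucl n) : Eucl n :=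
  gradientWithin f (closedBall 0 R) x -
    ⟪gradientWithin f (closedBall 0 R) x, normal R x⟫_ℝ • normal R x

/-- The divergence `div v = ∂ᵢ vᵢ`. -/
def divergence (v : Eucl n → Eucl n) (x : Eucl n) : ℝ :=
  LinearMap.trace ℝ (Eucl n) (fderiv ℝ v x : Eucl n →ₗ[ℝ] Eucl n)

/-- `D_v : D_v = ∂ᵢ vⱼ ∂ⱼ vᵢ`, the trace of the square of the Jacobian matrix. -/
def jacobianSq (v : Eucl n → Eucl n) (x : Eucl n) : ℝ :=
  LinearMap.trace ℝ (Eucl n) ((fderiv ℝ v x ∘L fderiv ℝ v x : Eucl n →L[ℝ] Eucl n) :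
    Eucl n →ₗ[ℝ] Eucl n)

/-- The perturbation `y(t, x) = x + t v(x) + t²/2 w(x) + r(t, x)`. -/
def perturbation (v w : Eucl n → Eucl n) (r : ℝ → Eucl n → Eucl n) (t : ℝ) (x : Eucl n) : Eucl n :=
  x + t • v x + (t ^ 2 / 2) • w x + r t x

/-- The remainder `r(t, ·)` is `o(t²)` as `t → 0`, in the `C¹` norm on the closed ball. -/
structure IsRemainder (R : ℝ) (r : ℝ → Eucl n → Eucl n) : Prop where
  contDiffOn : ∀ᶠ t in 𝓝 0, ContDiffOn ℝ 1 (r t) (closedBall 0 R)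
  small : ∀ ε > 0, ∀ᶠ t in 𝓝 0, ∀ x ∈ closedBall (0 : Eucl n) R,
    ‖r t x‖ ≤ ε * t ^ 2 ∧ ‖fderivWithin ℝ (r t) (closedBall 0 R) x‖ ≤ ε * t ^ 2

/-- The perturbation with velocity `v` and acceleration `w` preserves the volume of `B_R` to the
second order: the coefficients of `t` and `t²/2` in the expansion of the volume vanish. -/
structure VolumePreserving (R : ℝ) (v w : Eucl n → Eucl n) : Prop where
  first : ∫ x in ball (0 : Eucl n) R, divergence v x = 0
  second : ∫ x in ball (0 : Eucl n) R, (divergence v x ^ 2 - jacobianSq v x + divergence w x) = 0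

/-- The perturbation is a Hadamard perturbation: on `∂B_R` it has the form
`y = x + t N ν + t²/2 (w · ν) ν + o(t²)`. -/
structure IsHadamard (R : ℝ) (v w : Eucl n → Eucl n) : Prop where
  velocity : ∀ x ∈ sphere (0 : Eucl n) R, v x = normalComponent R v x • normal R x
  acceleration : ∀ x ∈ sphere (0 : Eucl n) R, w x = normalComponent R w x • normal R x

/-- The surface element factor `m` of a map `y` at a point `x` of `∂B_R`, `dS_y = m dS`:
the square root of the Gram determinant of the restriction of `Dy(x)` to the tangent space `x^⊥`,
with respect to an orthonormal basis of it. -/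
def surfaceFactor (R : ℝ) (y : Eucl n → Eucl n) (x : Eucl n) : ℝ :=
  ((fderivWithin ℝ y (closedBall 0 R) x : Eucl n →ₗ[ℝ] Eucl n).domRestrict
    ((ℝ ∙ x)ᗮ : Submodule ℝ (Eucl n))).normDet

/-- The surface area `S(t) = ∮_{∂B_R} m(t) dS` of the image of `∂B_R` under `y(t, ·)`. -/
def surfaceArea (R : ℝ) (y : ℝ → Eucl n → Eucl n) (t : ℝ) : ℝ :=
  ∫ x, surfaceFactor R (y t) x ∂(surfaceMeasure n R)

/-- `s` is the second variation of `S` at `0`, i.e.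
`S(t) = S(0) + t S'(0) + t²/2 s + o(t²)` as `t → 0`. -/
def HasSecondVariation (S : ℝ → ℝ) (s : ℝ) : Prop :=
  DifferentiableAt ℝ S 0 ∧
    (fun t => S t - S 0 - t * deriv S 0 - t ^ 2 / 2 * s) =o[𝓝 0] (fun t => t ^ 2)

/-- `∮_{∂B_R} |∇^τ N|² dS - (n - 1) / R² ∮_{∂B_R} N² dS`. -/
def quadraticForm (R : ℝ) (N : Eucl n → ℝ) : ℝ :=
  (∫ x, ‖tangentialGradient R N x‖ ^ 2 ∂(surfaceMeasure n R)) -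
    ((n : ℝ) - 1) / R ^ 2 * ∫ x, N x ^ 2 ∂(surfaceMeasure n R)

end BallVariation

end

open BallVariation

namespace BallVariation

/-! Take first r = 0. Write A = Dv, B = Dw, M = 1 + tA + t²B/2, and let P be the projection onto the
tangent space. The surface factor is √det(1 + (M*M - 1)P), a determinant on the fixed space ℝⁿ, and
its second derivative at t = 0 is tr(AP)² - tr(APAP) + tr(BP) + |PA*ν|² (`accel_eq`). It remains to
integrate this over the sphere (`integral_accel`).

Since ∇^τ N = PA*ν + Pv/R, the last term is |∇^τ N|² up to multiples of s = ν · APv and |Pv|². The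
rest is removed by divergence theorems. Put J = N tr(AP) - ν · APv (`divTerm`). The field tr(AP)v -
APv has normal component J and tangential divergence tr(AP)² - tr(APAP) + J/R. The field w has
tangential divergence tr(BP). The field Nv has normal component N² and tangential divergence J + 2s
+ |Pv|²/R. Finally (div v)v - (Dv)v has divergence (div v)² - tr((Dv)²) in the ball and again the
normal component J, so the second volume condition reads ∮J + ∮w · ν = 0. A linear combination of
these identities is the formula. Both divergence theorems come from ∫ ∂ₐF = 0 for compactly
supported F, by polar coordinates.

A remainder r changes the area by o(t²) only, because the surface factor is Lipschitz in Dy near the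
identity (`surfaceArea_sub_isLittleO`).

For positivity, the first volume condition says ∮N = 0, and (n - 1)/R² is the first nonzero
eigenvalue of the sphere. The strict Poincaré inequality (`quadraticForm_pos`) is obtained without
an eigenbasis: on powers (a · x)^k the operator -Δ is multiplication by k(k + n - 2)/R² modulo lower
degree, these powers span a dense space by Stone-Weierstrass, and a symmetric operator that is
triangular for a filtration in this way has the expected spectral gap (`spectral_gap`). -/

theorem uniqueDiffOn_closedBall {n : ℕ} {R : ℝ} (hR : 0 < R) :
    UniqueDiffOn ℝ (closedBall (0 : Eucl n) R) := by
  refine uniqueDiffOn_convex (convex_closedBall 0 R) ?_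
  rw [interior_closedBall _ hR.ne']
  exact ⟨0, mem_ball_self hR⟩

/-! ### Surface integrals pulled back to the unit sphere -/

theorem measurableEmbedding_smul_sphere {n : ℕ} {R : ℝ} (hR : 0 < R) :
    MeasurableEmbedding (fun ω : sphere (0 : Eucl n) 1 => R • (ω : Eucl n)) := by
  have h : Topology.IsClosedEmbedding (fun ω : sphere (0 : Eucl n) 1 => R • (ω : Eucl n)) := by
    refine Continuous.isClosedEmbedding (by fun_prop) fun a b h => ?_
    exact Subtype.ext (smul_right_injective _ hR.ne' h)
  exact h.measurableEmbedding

theorem smul_mem_sphere {n : ℕ} {R : ℝ} (hR : 0 < R) (ω : sphere (0 : Eucl n) 1) :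
    R • (ω : Eucl n) ∈ sphere (0 : Eucl n) R := by
  simp [norm_smul, abs_of_pos hR]

theorem smul_mem_closedBall {n : ℕ} {r R : ℝ} (hr : 0 ≤ r) (hrR : r ≤ R)
    (ω : sphere (0 : Eucl n) 1) : r • (ω : Eucl n) ∈ closedBall (0 : Eucl n) R := by
  simpa [norm_smul, abs_of_nonneg hr] using hrR

theorem integral_surfaceMeasure {n : ℕ} {R : ℝ} (hR : 0 < R) (f : Eucl n → ℝ) :
    ∫ x, f x ∂(surfaceMeasure n R) =
      R ^ (n - 1) * ∫ ω : sphere (0 : Eucl n) 1, f (R • (ω : Eucl n))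
        ∂(volume : Measure (Eucl n)).toSphere := by
  rw [surfaceMeasure, integral_smul_measure, (measurableEmbedding_smul_sphere hR).integral_map,
    ENNReal.toReal_ofReal (by positivity), smul_eq_mul]

theorem ae_mem_sphere {n : ℕ} {R : ℝ} (hR : 0 < R) :
    ∀ᵐ x ∂(surfaceMeasure n R), x ∈ sphere (0 : Eucl n) R := by
  refine Measure.ae_smul_measure ?_ _
  rw [(measurableEmbedding_smul_sphere hR).ae_map_iff]
  exact Filter.Eventually.of_forall fun ω => smul_mem_sphere hR ω

theorem integral_surface_congr {n : ℕ} {R : ℝ} (hR : 0 < R) {f g : Eucl n → ℝ}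
    (h : ∀ x ∈ sphere (0 : Eucl n) R, f x = g x) :
    ∫ x, f x ∂(surfaceMeasure n R) = ∫ x, g x ∂(surfaceMeasure n R) :=
  integral_congr_ae ((ae_mem_sphere hR).mono h)

instance {n : ℕ} {R : ℝ} : IsFiniteMeasure (surfaceMeasure n R) := by
  unfold surfaceMeasure
  exact Measure.smul_finite _ ENNReal.ofReal_ne_top

theorem continuous_comp_smul_sphere {n : ℕ} {R : ℝ} (hR : 0 < R) {Y : Type*} [TopologicalSpace Y]
    {f : Eucl n → Y} (hf : ContinuousOn f (sphere 0 R)) :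
    Continuous fun ω : sphere (0 : Eucl n) 1 => f (R • (ω : Eucl n)) :=
  hf.comp_continuous (by fun_prop) (smul_mem_sphere hR)

theorem integrable_of_continuous_sphere {n : ℕ} {E : Type*} [NormedAddCommGroup E]
    {f : sphere (0 : Eucl n) 1 → E} (hf : Continuous f) :
    Integrable f (volume : Measure (Eucl n)).toSphere :=
  (hf.integrable_of_hasCompactSupport (HasCompactSupport.of_compactSpace f))

theorem integrable_surface {n : ℕ} {R : ℝ} (hR : 0 < R) {E : Type*} [NormedAddCommGroup E]
    {f : Eucl n → E} (hf : ContinuousOn f (sphere 0 R)) :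
    Integrable f (surfaceMeasure n R) := by
  refine Integrable.smul_measure ?_ ENNReal.ofReal_ne_top
  rw [(measurableEmbedding_smul_sphere hR).integrable_map_iff]
  exact integrable_of_continuous_sphere (continuous_comp_smul_sphere hR hf)

/-! ### Polar coordinates -/

theorem integral_volumeIoiPow (k : ℕ) (h : ℝ → ℝ) :
    ∫ r, h r.1 ∂(Measure.volumeIoiPow k) = ∫ r in Set.Ioi (0 : ℝ), r ^ k * h r := by
  simp only [Measure.volumeIoiPow, ENNReal.ofReal]
  rw [integral_withDensity_eq_integral_smul ((measurable_subtype_coe.pow_const _).real_toNNReal),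
    integral_subtype_comap measurableSet_Ioi fun a ↦ Real.toNNReal (a ^ k) • h a]
  refine setIntegral_congr_fun measurableSet_Ioi fun x hx ↦ ?_
  rw [NNReal.smul_def, Real.coe_toNNReal _ (pow_nonneg (le_of_lt hx) _), smul_eq_mul]

theorem integrable_volumeIoiPow (k : ℕ) {h : ℝ → ℝ} :
    Integrable (fun r : Set.Ioi (0 : ℝ) => h r.1) (Measure.volumeIoiPow k) ↔
      IntegrableOn (fun r => r ^ k * h r) (Set.Ioi (0 : ℝ)) := by
  rw [integrableOn_iff_comap_subtypeVal measurableSet_Ioi, Measure.volumeIoiPow,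
    integrable_withDensity_iff_integrable_smul' (by fun_prop) (by simp)]
  refine integrable_congr (.of_forall ?_)
  rintro ⟨x, hx⟩
  simp [ENNReal.toReal_ofReal (pow_nonneg (le_of_lt hx) k)]

theorem integral_polar {n : ℕ} (hn : n ≠ 0) (F : Eucl n → ℝ) :
    ∫ x, F x = ∫ p, F (p.2.1 • p.1.1)
      ∂((volume : Measure (Eucl n)).toSphere.prod (Measure.volumeIoiPow (n - 1))) := by
  have : Nontrivial (Eucl n) := by
    have : Nonempty (Fin n) := ⟨⟨0, Nat.pos_of_ne_zero hn⟩⟩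
    infer_instance
  have h := (volume : Measure (Eucl n)).measurePreserving_homeomorphUnitSphereProd
  rw [finrank_euclideanSpace_fin] at h
  rw [← h.integral_comp (Homeomorph.measurableEmbedding _)]
  have h2 : ∀ x : ({(0)}ᶜ : Set (Eucl n)), F ((homeomorphUnitSphereProd (Eucl n) x).2.1 •
      (homeomorphUnitSphereProd (Eucl n) x).1.1) = F x.1 := fun x => by
    rw [← homeomorphUnitSphereProd_symm_apply_coe, Homeomorph.symm_apply_apply]
  simp_rw [h2]
  rw [integral_subtype_comap (measurableSet_singleton _).compl F, restrict_compl_singleton]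

/-! ### The tangential divergence theorem on the sphere -/

/-- The orthogonal projection onto the tangent space of `∂B_R` at `x`, for `‖x‖ = R`. -/
noncomputable def tanProj {n : ℕ} (R : ℝ) (x : Eucl n) : Eucl n →L[ℝ] Eucl n :=
  1 - (R ^ 2)⁻¹ • InnerProductSpace.rankOne ℝ x x

theorem tanProj_apply {n : ℕ} (R : ℝ) (x a : Eucl n) :
    tanProj R x a = a - ((R ^ 2)⁻¹ * ⟪x, a⟫_ℝ) • x := by
  simp [tanProj, smul_smul]

theorem integral_fderiv_eq_zero_of_hasCompactSupport {n : ℕ} {F : Eucl n → ℝ}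
    (hF : ContDiff ℝ 1 F) (hc : HasCompactSupport F) (a : Eucl n) :
    ∫ x, fderiv ℝ F x a = 0 := by
  have h1 : Integrable fun x => fderiv ℝ F x a :=
    ((hF.continuous_fderiv one_ne_zero).clm_apply continuous_const).integrable_of_hasCompactSupport
      (hc.fderiv_apply (𝕜 := ℝ) a)
  have := integral_mul_fderiv_eq_neg_fderiv_mul_of_integrable (μ := volume)
    (f := fun _ : Eucl n => (1 : ℝ)) (g := F) (v := a) (by simp) (by simpa using h1)
    (by simpa using hF.continuous.integrable_of_hasCompactSupport hc)
    (fun x _ => differentiableAt_const _) (fun x _ => hF.differentiable one_ne_zero x)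
  simpa using this

theorem hasFDerivAt_norm_smul {n : ℕ} (ω : sphere (0 : Eucl n) 1) {r : ℝ} (hr : 0 < r) :
    HasFDerivAt (fun y : Eucl n => ‖y‖) (innerSL ℝ (ω : Eucl n)) (r • (ω : Eucl n)) := by
  have hω : ‖(ω : Eucl n)‖ = 1 := by simp
  have h1 := (hasStrictFDerivAt_norm_sq (r • (ω : Eucl n))).hasFDerivAt.sqrt
    (by simp [norm_smul, hω, hr.ne'])
  have h2 : (fun y : Eucl n => √(‖y‖ ^ 2)) = fun y => ‖y‖ :=
    funext fun y => Real.sqrt_sq (norm_nonneg y)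
  rw [h2] at h1
  refine h1.congr_fderiv ?_
  ext a
  simp [norm_smul, hω, abs_of_pos hr, Real.sqrt_sq hr.le]
  field_simp

/-- The `0`-homogeneous extension of the restriction of `f` to the sphere of radius `R`. -/
noncomputable def homogExt {n : ℕ} (R : ℝ) (f : Eucl n → ℝ) (x : Eucl n) : ℝ := f ((R / ‖x‖) • x)

theorem contDiffAt_homogExt {n : ℕ} {R : ℝ} (hR : 0 < R) {f : Eucl n → ℝ}
    (hf : ContDiffOn ℝ 1 f (closedBall 0 R)) {x : Eucl n} (hx : x ≠ 0) :
    ContDiffAt ℝ 1 (homogExt R f) x := by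
  have hg : ContDiffOn ℝ 1 (fun y : Eucl n => (R / ‖y‖) • y) {0}ᶜ := fun y hy =>
    ((contDiffAt_const.div (contDiffAt_norm ℝ hy) (norm_ne_zero_iff.2 hy)).smul
      contDiffAt_id).contDiffWithinAt
  have := hf.comp hg (fun y (hy : y ≠ 0) => by
    simp [norm_smul, abs_of_pos hR, norm_ne_zero_iff.2 hy])
  exact this.contDiffAt (isOpen_compl_singleton.mem_nhds hx)

/-- The radial retraction y ↦ (R/‖y‖)y sends a neighbourhood of x into the closed ball, so the chain
rule needs the derivative of `f` within the ball only, even though its values lie on the boundary.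
The derivative of the retraction is R/r times the tangential projection. -/
theorem fderiv_homogExt {n : ℕ} {R : ℝ} (hR : 0 < R) {f : Eucl n → ℝ}
    (hf : ContDiffOn ℝ 1 f (closedBall 0 R)) (ω : sphere (0 : Eucl n) 1) {r : ℝ} (hr : 0 < r)
    (a : Eucl n) : fderiv ℝ (homogExt R f) (r • (ω : Eucl n)) a =
      R / r * fderivWithin ℝ f (closedBall 0 R) (R • (ω : Eucl n))
        (tanProj R (R • (ω : Eucl n)) a) := by
  set x : Eucl n := r • (ω : Eucl n) with hxdef
  have hω : ‖(ω : Eucl n)‖ = 1 := by simp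
  have hnx : ‖x‖ = r := by rw [hxdef, norm_smul, hω, Real.norm_of_nonneg hr.le, mul_one]
  have hx : x ≠ 0 := by rw [← norm_ne_zero_iff, hnx]; exact hr.ne'
  have hnorm := hasFDerivAt_norm_smul ω hr
  have hg : HasFDerivAt (fun y : Eucl n => (R / ‖y‖) • y)
      ((R / ‖x‖) • ContinuousLinearMap.id ℝ (Eucl n) +
        (R • (-(‖x‖ ^ 2)⁻¹ • innerSL ℝ (ω : Eucl n))).smulRight x) x := by
    have h1 : HasFDerivAt (fun y : Eucl n => R / ‖y‖)
        (R • (-(‖x‖ ^ 2)⁻¹ • innerSL ℝ (ω : Eucl n))) x := by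
      simpa [div_eq_mul_inv] using
        ((hasDerivAt_inv (norm_ne_zero_iff.2 hx)).comp_hasFDerivAt x hnorm).const_mul R
    exact h1.smul (hasFDerivAt_id x)
  have hgx : (R / ‖x‖) • x = R • (ω : Eucl n) := by
    rw [hnx, hxdef, smul_smul]; congr 1; field_simp
  have hfd : HasFDerivWithinAt f (fderivWithin ℝ f (closedBall 0 R) (R • (ω : Eucl n)))
      (closedBall 0 R) ((R / ‖x‖) • x) := by
    rw [hgx]
    exact (hf.differentiableOn one_ne_zero _
      (smul_mem_closedBall hR.le le_rfl ω)).hasFDerivWithinAt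
  have hmaps : ∀ᶠ y in 𝓝 x, (R / ‖y‖) • y ∈ closedBall (0 : Eucl n) R := by
    filter_upwards [isOpen_compl_singleton.mem_nhds hx] with y hy
    simp [norm_smul, abs_of_pos hR, norm_ne_zero_iff.2 hy]
  have hcomp := HasFDerivWithinAt.comp_hasFDerivAt (f := fun y : Eucl n => (R / ‖y‖) • y) x
    hfd hg hmaps
  have : HasFDerivAt (homogExt R f) _ x := hcomp
  rw [this.fderiv, ContinuousLinearMap.comp_apply, ← smul_eq_mul, ← map_smul]
  simp only [add_apply, smul_apply,
    ContinuousLinearMap.id_apply, ContinuousLinearMap.smulRight_apply, innerSL_apply_apply,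
    tanProj_apply, hnx, inner_smul_left, smul_smul, smul_eq_mul, sub_eq_add_neg, ← neg_smul]
  rw [hxdef]
  simp only [map_add, map_smul, map_neg, conj_trivial, smul_eq_mul]
  field_simp

theorem integral_Ioi_eq_of_bump {k : ℝ → ℝ} (hk : ∀ r ≤ 0, k r = 0) :
    ∫ r in Set.Ioi (0 : ℝ), k r = ∫ r, k r :=
  setIntegral_eq_integral_of_forall_compl_eq_zero fun r hr => hk r (not_lt.1 hr)

/-- The tangential divergence theorem on the sphere, for the field `f a` with constant `a`. -/
theorem integral_sphere_tangential {n : ℕ} (hn : 2 ≤ n) {R : ℝ} (hR : 0 < R) {f : Eucl n → ℝ}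
    (hf : ContDiffOn ℝ 1 f (closedBall 0 R)) (a : Eucl n) :
    R * ∫ ω : sphere (0 : Eucl n) 1, fderivWithin ℝ f (closedBall 0 R) (R • (ω : Eucl n))
        (tanProj R (R • (ω : Eucl n)) a) ∂(volume : Measure (Eucl n)).toSphere =
      ((n : ℝ) - 1) * ∫ ω : sphere (0 : Eucl n) 1, f (R • (ω : Eucl n)) * ⟪a, (ω : Eucl n)⟫_ℝ
        ∂(volume : Measure (Eucl n)).toSphere := by
  -- A radial cutoff supported in 1 ≤ ‖x‖ ≤ 3, away from the origin, where the 0-homogeneous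
  -- extension is singular. The identity results from ∫ ∂ₐF = 0 for F = φ(‖x‖) · (extension of f).
  let φ : ContDiffBump (2 : ℝ) := ⟨1 / 2, 1, by norm_num, by norm_num⟩
  have hφ : ContDiff ℝ 1 φ := φ.contDiff
  have hφ0 : ∀ r, r ≤ 1 → φ r = 0 := fun r hr => φ.zero_of_le_dist (by
    show (1 : ℝ) ≤ dist r 2
    rw [Real.dist_eq, abs_of_nonpos (by linarith)]; linarith)
  have hφ0' : ∀ r, r < 1 → deriv φ r = 0 := fun r hr => by
    have : (φ : ℝ → ℝ) =ᶠ[𝓝 r] fun _ => 0 := by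
      filter_upwards [Iio_mem_nhds hr] with s hs using hφ0 s (le_of_lt hs)
    rw [this.deriv_eq]; simp
  have hφd : Continuous (deriv φ) := hφ.continuous_deriv (by simp)
  have hφc : HasCompactSupport φ := φ.hasCompactSupport
  let F : Eucl n → ℝ := fun x => φ ‖x‖ * homogExt R f x
  have hF0 : ∀ x : Eucl n, x = 0 → F =ᶠ[𝓝 x] fun _ => 0 := by
    rintro x rfl
    filter_upwards [ball_mem_nhds (0 : Eucl n) one_pos] with y hy
    simp [F, hφ0 ‖y‖ (by simpa using (le_of_lt (by simpa using hy)))]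
  have hφn : ∀ x : Eucl n, x ≠ 0 → ContDiffAt ℝ 1 (fun x : Eucl n => φ ‖x‖) x := fun x hx =>
    hφ.contDiffAt.comp x (contDiffAt_norm ℝ hx)
  have hFc : ContDiff ℝ 1 F := contDiff_iff_contDiffAt.2 fun x => by
    by_cases hx : x = 0
    · exact contDiffAt_const.congr_of_eventuallyEq (hF0 x hx)
    · exact (hφn x hx).mul (contDiffAt_homogExt hR hf hx)
  have hFs : HasCompactSupport F := by
    refine HasCompactSupport.of_support_subset_isCompact (isCompact_closedBall (0 : Eucl n) 3) ?_
    intro x hx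
    by_contra h
    refine hx ?_
    have : (φ : ℝ → ℝ) ‖x‖ = 0 := φ.zero_of_le_dist (by
      show (1 : ℝ) ≤ dist ‖x‖ 2
      have : 3 < ‖x‖ := by simpa using h
      rw [Real.dist_eq, abs_of_nonneg (by linarith)]; linarith)
    simp [F, this]
  have hzero := integral_fderiv_eq_zero_of_hasCompactSupport hFc hFs a
  rw [integral_polar (by omega)] at hzero
  -- In polar coordinates ∂ₐF splits into two products of a function of ω and a function of r: the
  -- radial derivative falls on φ alone, the tangential one on the extension alone.
  have hpt : ∀ p : sphere (0 : Eucl n) 1 × Set.Ioi (0 : ℝ),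
      fderiv ℝ F (p.2.1 • (p.1 : Eucl n)) a =
        (f (R • (p.1 : Eucl n)) * ⟪a, (p.1 : Eucl n)⟫_ℝ) * deriv φ p.2.1 +
        (R * fderivWithin ℝ f (closedBall 0 R) (R • (p.1 : Eucl n))
          (tanProj R (R • (p.1 : Eucl n)) a)) * (φ p.2.1 / p.2.1) := by
    rintro ⟨ω, r, hr⟩
    have hr : 0 < r := hr
    have hω : ‖(ω : Eucl n)‖ = 1 := by simp
    have hnx : ‖r • (ω : Eucl n)‖ = r := by
      rw [norm_smul, hω, Real.norm_of_nonneg hr.le, mul_one]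
    have hx : r • (ω : Eucl n) ≠ 0 := by rw [← norm_ne_zero_iff, hnx]; exact hr.ne'
    have hnorm := hasFDerivAt_norm_smul ω hr
    have hd : HasDerivAt φ (deriv φ r) ‖r • (ω : Eucl n)‖ := by
      rw [hnx]; exact (hφ.differentiable (by simp) r).hasDerivAt
    have h1 : HasFDerivAt (fun x : Eucl n => φ ‖x‖) _ (r • (ω : Eucl n)) :=
      hd.comp_hasFDerivAt _ hnorm
    have h2 := ((contDiffAt_homogExt hR hf hx).differentiableAt one_ne_zero).hasFDerivAt
    have h3 : HasFDerivAt F _ (r • (ω : Eucl n)) := h1.mul h2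
    rw [h3.fderiv]
    have hgx : homogExt R f (r • (ω : Eucl n)) = f (R • (ω : Eucl n)) := by
      rw [homogExt, hnx, smul_smul]; congr 2; field_simp
    simp only [add_apply, smul_apply, innerSL_apply_apply, hnx, hgx,
      smul_eq_mul, fderiv_homogExt hR hf ω hr, real_inner_comm a]
    ring
  have hfc := hf.continuousOn
  have hdc : ContinuousOn (fderivWithin ℝ f (closedBall 0 R)) (closedBall 0 R) :=
    hf.continuousOn_fderivWithin (uniqueDiffOn_closedBall hR) le_rfl
  have hsub : sphere (0 : Eucl n) R ⊆ closedBall 0 R := sphere_subset_closedBall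
  have hi1 : Integrable (fun ω : sphere (0 : Eucl n) 1 =>
      f (R • (ω : Eucl n)) * ⟪a, (ω : Eucl n)⟫_ℝ) (volume : Measure (Eucl n)).toSphere := by
    refine integrable_of_continuous_sphere ?_
    have := continuous_comp_smul_sphere hR (hfc.mono hsub)
    exact this.mul (by fun_prop)
  have hi2 : Integrable (fun ω : sphere (0 : Eucl n) 1 =>
      R * fderivWithin ℝ f (closedBall 0 R) (R • (ω : Eucl n))
        (tanProj R (R • (ω : Eucl n)) a)) (volume : Measure (Eucl n)).toSphere := by
    refine integrable_of_continuous_sphere ?_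
    have := continuous_comp_smul_sphere hR (hdc.mono hsub)
    simp_rw [tanProj_apply]
    fun_prop
  obtain ⟨m, rfl⟩ : ∃ m, n = m + 2 := ⟨n - 2, by omega⟩
  have hz1 : ∀ r : ℝ, r ≤ 0 → r ^ (m + 2 - 1) * deriv φ r = 0 := fun r hr => by
    rw [hφ0' r (by linarith), mul_zero]
  have hz2 : ∀ r : ℝ, r ≤ 0 → r ^ m * φ r = 0 := fun r hr => by
    rw [hφ0 r (by linarith), mul_zero]
  have hpow : ∀ r : ℝ, r ^ (m + 2 - 1) * (φ r / r) = r ^ m * φ r := fun r => by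
    rcases eq_or_ne r 0 with rfl | hr
    · rw [hφ0 0 (by norm_num)]; simp
    · simp only [Nat.add_succ_sub_one, pow_succ]; field_simp
  have hI2 : Integrable (fun r : ℝ => r ^ m * φ r) :=
    (by have := φ.continuous; fun_prop : Continuous fun r : ℝ => r ^ m * φ r)
      |>.integrable_of_hasCompactSupport hφc.mul_left
  have hI1 : Integrable (fun r : ℝ => r ^ (m + 2 - 1) * deriv φ r) :=
    (by fun_prop : Continuous fun r : ℝ => r ^ (m + 2 - 1) * deriv φ r)
      |>.integrable_of_hasCompactSupport hφc.deriv.mul_left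
  have hI3 : Integrable (fun r : ℝ => r ^ (m + 1) * φ r) :=
    (by have := φ.continuous; fun_prop : Continuous fun r : ℝ => r ^ (m + 1) * φ r)
      |>.integrable_of_hasCompactSupport hφc.mul_left
  have hj1 : Integrable (fun r : Set.Ioi (0 : ℝ) => deriv φ r.1)
      (Measure.volumeIoiPow (m + 2 - 1)) :=
    (integrable_volumeIoiPow _).2 hI1.integrableOn
  have hj2 : Integrable (fun r : Set.Ioi (0 : ℝ) => φ r.1 / r.1)
      (Measure.volumeIoiPow (m + 2 - 1)) :=
    (integrable_volumeIoiPow _ (h := fun r => φ r / r)).2 (by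
      simp_rw [hpow]; exact hI2.integrableOn)
  simp_rw [hpt] at hzero
  rw [integral_add (hi1.mul_prod hj1) (hi2.mul_prod hj2),
    integral_prod_mul (fun ω : sphere (0 : Eucl (m + 2)) 1 =>
      f (R • (ω : Eucl (m + 2))) * ⟪a, (ω : Eucl (m + 2))⟫_ℝ)
      (fun r : Set.Ioi (0 : ℝ) => deriv φ r.1),
    integral_prod_mul (fun ω : sphere (0 : Eucl (m + 2)) 1 =>
      R * fderivWithin ℝ f (closedBall 0 R) (R • (ω : Eucl (m + 2)))
        (tanProj R (R • (ω : Eucl (m + 2))) a)) (fun r : Set.Ioi (0 : ℝ) => φ r.1 / r.1),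
    integral_volumeIoiPow _ (deriv φ), integral_volumeIoiPow _ (fun r => φ r / r),
    integral_Ioi_eq_of_bump hz1] at hzero
  simp_rw [hpow] at hzero
  rw [integral_Ioi_eq_of_bump hz2] at hzero
  -- The factor n - 1 is born here: ∫ r^(n-1) φ' = -(n-1) ∫ r^(n-2) φ. The last integral is positive
  -- and cancels at the end.
  have hparts : ∫ r : ℝ, r ^ (m + 2 - 1) * deriv φ r =
      -(((m + 1 : ℕ) : ℝ) * ∫ r : ℝ, r ^ m * φ r) := by
    have := integral_mul_deriv_eq_deriv_mul_of_integrable (u := fun r : ℝ => r ^ (m + 1)) (v := φ)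
      (u' := fun r => ((m + 1 : ℕ) : ℝ) * r ^ m) (v' := deriv φ)
      (fun x _ => by simpa using hasDerivAt_pow (m + 1) x)
      (fun x _ => (hφ.differentiable (by simp) x).hasDerivAt) hI1
      (by simpa [mul_assoc, Pi.mul_def] using hI2.const_mul ((m + 1 : ℕ) : ℝ)) hI3
    rw [show m + 2 - 1 = m + 1 from rfl, this, ← integral_const_mul]
    simp_rw [mul_assoc]
  have hpos : 0 < ∫ r : ℝ, r ^ m * φ r := by
    refine Continuous.integral_pos_of_hasCompactSupport_nonneg_nonzero (x := 2)
      (by have := φ.continuous; fun_prop) hφc.mul_left ?_ ?_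
    · intro r
      rcases le_total r 0 with hr | hr
      · simp [hz2 r hr]
      · exact mul_nonneg (pow_nonneg hr _) φ.nonneg
    · rw [φ.one_of_mem_closedBall (by simp [φ])]; simp
  rw [hparts, integral_const_mul] at hzero
  push_cast at hzero ⊢
  refine mul_right_cancel₀ hpos.ne' ?_
  linear_combination hzero

theorem normal_smul {n : ℕ} {R : ℝ} (hR : 0 < R) (x : Eucl n) : normal R (R • x) = x := by
  rw [normal, smul_smul, inv_mul_cancel₀ hR.ne', one_smul]

theorem tanProj_smul {n : ℕ} {R : ℝ} (hR : 0 < R) (x a : Eucl n) :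
    tanProj R (R • x) a = a - ⟪x, a⟫_ℝ • x := by
  rw [tanProj_apply, real_inner_smul_left, smul_smul]
  congr 2
  field_simp

/-- The tangential divergence theorem on `∂B_R`, for the field `f a` with constant `a`. -/
theorem integral_surface_tangential {n : ℕ} (hn : 2 ≤ n) {R : ℝ} (hR : 0 < R) {f : Eucl n → ℝ}
    (hf : ContDiffOn ℝ 1 f (closedBall 0 R)) (a : Eucl n) :
    ∫ x, fderivWithin ℝ f (closedBall 0 R) x (tanProj R x a) ∂(surfaceMeasure n R) =
      ((n : ℝ) - 1) / R * ∫ x, f x * ⟪a, normal R x⟫_ℝ ∂(surfaceMeasure n R) := by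
  have h := integral_sphere_tangential hn hR hf a
  rw [integral_surfaceMeasure hR, integral_surfaceMeasure hR]
  simp_rw [normal_smul hR]
  have h2 : ∀ x y : ℝ, R * x = ((n : ℝ) - 1) * y → R ^ (n - 1) * x =
      ((n : ℝ) - 1) / R * (R ^ (n - 1) * y) := fun x y hxy => by
    field_simp
    linear_combination hxy
  exact h2 _ _ h

/-! ### The divergence theorem on the ball, by slicing into spheres -/

theorem integrable_polar {n : ℕ} (hn : n ≠ 0) {F : Eucl n → ℝ} (hF : Integrable F) :
    Integrable (fun p : sphere (0 : Eucl n) 1 × Set.Ioi (0 : ℝ) => F (p.2.1 • p.1.1))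
      ((volume : Measure (Eucl n)).toSphere.prod (Measure.volumeIoiPow (n - 1))) := by
  have : Nontrivial (Eucl n) := by
    have : Nonempty (Fin n) := ⟨⟨0, Nat.pos_of_ne_zero hn⟩⟩
    infer_instance
  have h := (volume : Measure (Eucl n)).measurePreserving_homeomorphUnitSphereProd
  rw [finrank_euclideanSpace_fin] at h
  rw [← h.integrable_comp_emb (Homeomorph.measurableEmbedding _)]
  have h2 : ((fun p : sphere (0 : Eucl n) 1 × Set.Ioi (0 : ℝ) => F (p.2.1 • p.1.1)) ∘
      homeomorphUnitSphereProd (Eucl n)) = fun x => F x.1 := funext fun x => by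
    simp only [Function.comp]
    rw [← homeomorphUnitSphereProd_symm_apply_coe, Homeomorph.symm_apply_apply]
  rw [h2]
  exact (integrableOn_iff_comap_subtypeVal (measurableSet_singleton _).compl).1 hF.integrableOn

theorem setIntegral_ball_polar {n : ℕ} (hn : n ≠ 0) {R : ℝ} (hR : 0 < R) {F : Eucl n → ℝ}
    (hF : IntegrableOn F (ball 0 R)) :
    ∫ x in ball (0 : Eucl n) R, F x =
      ∫ ω : sphere (0 : Eucl n) 1, (∫ r in (0 : ℝ)..R, r ^ (n - 1) * F (r • (ω : Eucl n)))
        ∂(volume : Measure (Eucl n)).toSphere := by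
  have hi := (integrable_indicator_iff measurableSet_ball).2 hF
  rw [← integral_indicator measurableSet_ball, integral_polar hn,
    integral_prod _ (integrable_polar hn hi)]
  refine integral_congr_ae (.of_forall fun ω => ?_)
  simp only
  rw [integral_volumeIoiPow (n - 1) (fun r => (ball (0 : Eucl n) R).indicator F (r • (ω : Eucl n))),
    intervalIntegral.integral_of_le hR.le, integral_Ioc_eq_integral_Ioo, ← Set.Ioi_inter_Iio,
    ← setIntegral_indicator measurableSet_Iio]
  refine setIntegral_congr_fun measurableSet_Ioi fun r (hr : 0 < r) => ?_
  by_cases h : r < R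
  · simp [h, norm_smul, abs_of_pos hr]
  · simp [h, norm_smul, abs_of_pos hr]

theorem integrable_sphere_prod {n : ℕ} {R : ℝ} {k : sphere (0 : Eucl n) 1 × ℝ → ℝ}
    (hk : ContinuousOn k (Set.univ ×ˢ Set.Icc 0 R)) :
    Integrable k ((volume : Measure (Eucl n)).toSphere.prod (volume.restrict (Set.Ioc 0 R))) := by
  have h : IntegrableOn k (Set.univ ×ˢ Set.Icc 0 R)
      ((volume : Measure (Eucl n)).toSphere.prod volume) :=
    hk.integrableOn_compact (isCompact_univ.prod isCompact_Icc)
  have h2 := h.mono_set (t := Set.univ ×ˢ Set.Icc 0 R) (s := Set.univ ×ˢ Set.Ioc 0 R)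
    (Set.prod_mono subset_rfl Set.Ioc_subset_Icc_self)
  rwa [IntegrableOn, ← Measure.prod_restrict, Measure.restrict_univ] at h2

theorem integral_sphere_swap {n : ℕ} {R : ℝ} (hR : 0 < R) {k : sphere (0 : Eucl n) 1 × ℝ → ℝ}
    (hk : ContinuousOn k (Set.univ ×ˢ Set.Icc 0 R)) :
    ∫ ω, (∫ r in (0 : ℝ)..R, k (ω, r)) ∂(volume : Measure (Eucl n)).toSphere =
      ∫ r in (0 : ℝ)..R, (∫ ω, k (ω, r) ∂(volume : Measure (Eucl n)).toSphere) := by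
  simp_rw [intervalIntegral.integral_of_le hR.le]
  exact integral_integral_swap (f := fun ω r => k (ω, r)) (integrable_sphere_prod hk)

theorem integrable_intervalIntegral {n : ℕ} {R : ℝ} (hR : 0 < R)
    {k : sphere (0 : Eucl n) 1 × ℝ → ℝ} (hk : ContinuousOn k (Set.univ ×ˢ Set.Icc 0 R)) :
    Integrable (fun ω => ∫ r in (0 : ℝ)..R, k (ω, r)) (volume : Measure (Eucl n)).toSphere := by
  simp_rw [intervalIntegral.integral_of_le hR.le]
  exact (integrable_sphere_prod hk).integral_prod_left

theorem intervalIntegrable_slice {n : ℕ} {R : ℝ} (hR : 0 < R)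
    {k : sphere (0 : Eucl n) 1 × ℝ → ℝ} (hk : ContinuousOn k (Set.univ ×ˢ Set.Icc 0 R))
    (ω : sphere (0 : Eucl n) 1) : IntervalIntegrable (fun r => k (ω, r)) volume 0 R := by
  refine ContinuousOn.intervalIntegrable ?_
  rw [Set.uIcc_of_le hR.le]
  exact hk.comp (by fun_prop) fun r hr => ⟨Set.mem_univ _, hr⟩

theorem continuousOn_smul_sphere {n : ℕ} {R : ℝ} {Y : Type*} [TopologicalSpace Y]
    {g : Eucl n → Y} (hg : ContinuousOn g (closedBall 0 R)) :
    ContinuousOn (fun p : sphere (0 : Eucl n) 1 × ℝ => g (p.2 • (p.1 : Eucl n)))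
      (Set.univ ×ˢ Set.Icc 0 R) :=
  hg.comp (by fun_prop) fun p hp => smul_mem_closedBall hp.2.1 hp.2.2 p.1

/-- The divergence theorem on the ball, for the field `f a` with constant `a`. -/
theorem integral_ball_fderiv {n : ℕ} (hn : 2 ≤ n) {R : ℝ} (hR : 0 < R) {f : Eucl n → ℝ}
    (hf : ContDiffOn ℝ 1 f (closedBall 0 R)) (a : Eucl n) :
    ∫ x in ball (0 : Eucl n) R, fderivWithin ℝ f (closedBall 0 R) x a =
      ∫ x, f x * ⟪a, normal R x⟫_ℝ ∂(surfaceMeasure n R) := by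
  have hdc : ContinuousOn (fderivWithin ℝ f (closedBall 0 R)) (closedBall 0 R) :=
    hf.continuousOn_fderivWithin (uniqueDiffOn_closedBall hR) le_rfl
  have hint : IntegrableOn (fun x => fderivWithin ℝ f (closedBall 0 R) x a) (ball 0 R) :=
    ((hdc.clm_apply continuousOn_const).integrableOn_compact
      (isCompact_closedBall 0 R)).mono_set ball_subset_closedBall
  rw [setIntegral_ball_polar (by omega) hR hint, integral_surfaceMeasure hR]
  obtain ⟨m, rfl⟩ : ∃ m, n = m + 2 := ⟨n - 2, by omega⟩
  simp_rw [normal_smul hR]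
  set σ := (volume : Measure (Eucl (m + 2))).toSphere
  set D := fderivWithin ℝ f (closedBall 0 R) with hD
  have hDk := continuousOn_smul_sphere hdc
  have hfk := continuousOn_smul_sphere hf.continuousOn
  -- the tangential and the radial part of the integrand
  let k : sphere (0 : Eucl (m + 2)) 1 × ℝ → ℝ := fun p => p.2 ^ (m + 1) *
    D (p.2 • (p.1 : Eucl (m + 2))) (a - ⟪(p.1 : Eucl (m + 2)), a⟫_ℝ • (p.1 : Eucl (m + 2)))
  let k' : sphere (0 : Eucl (m + 2)) 1 × ℝ → ℝ := fun p => ⟪a, (p.1 : Eucl (m + 2))⟫_ℝ *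
    (p.2 ^ (m + 1) * D (p.2 • (p.1 : Eucl (m + 2))) (p.1 : Eucl (m + 2)))
  let l : sphere (0 : Eucl (m + 2)) 1 × ℝ → ℝ := fun p => ⟪a, (p.1 : Eucl (m + 2))⟫_ℝ *
    (((m + 1 : ℕ) : ℝ) * p.2 ^ m * f (p.2 • (p.1 : Eucl (m + 2))))
  have hk : ContinuousOn k (Set.univ ×ˢ Set.Icc 0 R) :=
    ContinuousOn.mul (by fun_prop) (hDk.clm_apply (by fun_prop))
  have hk' : ContinuousOn k' (Set.univ ×ˢ Set.Icc 0 R) :=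
    ContinuousOn.mul (by fun_prop) (ContinuousOn.mul (by fun_prop) (hDk.clm_apply (by fun_prop)))
  have hl : ContinuousOn l (Set.univ ×ˢ Set.Icc 0 R) :=
    ContinuousOn.mul (by fun_prop) (ContinuousOn.mul (by fun_prop) hfk)
  -- On each sphere of radius r < R the tangential divergence theorem trades the tangential part of
  -- ∂ₐf for (n-1)/r · f ⟪a, ω⟫; Fubini is used to work at fixed r.
  have hkl : ∫ ω, (∫ r in (0 : ℝ)..R, k (ω, r)) ∂σ = ∫ ω, (∫ r in (0 : ℝ)..R, l (ω, r)) ∂σ := by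
    rw [integral_sphere_swap hR hk, integral_sphere_swap hR hl]
    rw [intervalIntegral.integral_of_le hR.le, intervalIntegral.integral_of_le hR.le,
      integral_Ioc_eq_integral_Ioo, integral_Ioc_eq_integral_Ioo]
    refine setIntegral_congr_fun measurableSet_Ioo fun r hr => ?_
    have h := integral_sphere_tangential (by omega) hr.1
      (hf.mono (closedBall_subset_closedBall hr.2.le)) a
    -- The tangential theorem on the smaller ball speaks of the derivative within that ball, which
    -- agrees with the derivative within the large one.
    have hDr : ∀ ω : sphere (0 : Eucl (m + 2)) 1,
        fderivWithin ℝ f (closedBall 0 r) (r • (ω : Eucl (m + 2))) =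
          D (r • (ω : Eucl (m + 2))) := by
      intro ω
      have hmem : r • (ω : Eucl (m + 2)) ∈ closedBall (0 : Eucl (m + 2)) r :=
        smul_mem_closedBall hr.1.le le_rfl ω
      exact fderivWithin_subset (closedBall_subset_closedBall hr.2.le)
        (uniqueDiffOn_closedBall hr.1 _ hmem)
        (hf.differentiableOn one_ne_zero _ (closedBall_subset_closedBall hr.2.le hmem))
    simp_rw [hDr, tanProj_smul hr.1] at h
    simp only [k, l]
    rw [integral_const_mul, pow_succ, mul_assoc, h, ← integral_const_mul, ← integral_const_mul]
    refine integral_congr_ae (.of_forall fun ω => ?_)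
    push_cast
    ring
  have hsplit : ∀ ω : sphere (0 : Eucl (m + 2)) 1,
      ∫ r in (0 : ℝ)..R, r ^ (m + 2 - 1) * D (r • (ω : Eucl (m + 2))) a =
        (∫ r in (0 : ℝ)..R, k (ω, r)) + ∫ r in (0 : ℝ)..R, k' (ω, r) := by
    intro ω
    rw [← intervalIntegral.integral_add (intervalIntegrable_slice hR hk ω)
      (intervalIntegrable_slice hR hk' ω)]
    refine intervalIntegral.integral_congr fun r _ => ?_
    simp only [k, k', map_sub, map_smul, smul_eq_mul, real_inner_comm a, Nat.add_succ_sub_one]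
    ring
  -- The traded term and the radial part together are the r-derivative of ⟪a, ω⟫ r^(n-1) f(rω),
  -- which vanishes at r = 0 because n - 1 > 0.
  have hftc : ∀ ω : sphere (0 : Eucl (m + 2)) 1,
      (∫ r in (0 : ℝ)..R, l (ω, r)) + (∫ r in (0 : ℝ)..R, k' (ω, r)) =
        R ^ (m + 1) * (f (R • (ω : Eucl (m + 2))) * ⟪a, (ω : Eucl (m + 2))⟫_ℝ) := by
    intro ω
    rw [← intervalIntegral.integral_add (intervalIntegrable_slice hR hl ω)
      (intervalIntegrable_slice hR hk' ω)]
    have h := intervalIntegral.integral_eq_sub_of_hasDerivAt_of_le hR.le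
      (f := fun r : ℝ => ⟪a, (ω : Eucl (m + 2))⟫_ℝ * (r ^ (m + 1) * f (r • (ω : Eucl (m + 2)))))
      (f' := fun r => l (ω, r) + k' (ω, r)) ?_ ?_
      ((intervalIntegrable_slice hR hl ω).add (intervalIntegrable_slice hR hk' ω))
    · rw [h]; simp; ring
    · refine ContinuousOn.mul (by fun_prop) (ContinuousOn.mul (by fun_prop) ?_)
      exact hf.continuousOn.comp (by fun_prop) fun r hr => smul_mem_closedBall hr.1 hr.2 ω
    · intro r hr
      have hmem : closedBall (0 : Eucl (m + 2)) R ∈ 𝓝 (r • (ω : Eucl (m + 2))) := by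
        refine closedBall_mem_nhds_of_mem ?_
        simpa [norm_smul, abs_of_pos hr.1] using hr.2
      have h1 : HasFDerivAt f (D (r • (ω : Eucl (m + 2)))) (r • (ω : Eucl (m + 2))) :=
        (hf.differentiableOn one_ne_zero _
          (mem_of_mem_nhds hmem)).hasFDerivWithinAt.hasFDerivAt hmem
      have h2 : HasDerivAt (fun r : ℝ => r • (ω : Eucl (m + 2))) (ω : Eucl (m + 2)) r := by
        simpa using (hasDerivAt_id r).smul_const (ω : Eucl (m + 2))
      have h3 := ((hasDerivAt_pow (m + 1) r).mul (h1.comp_hasDerivAt r h2)).const_mul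
        ⟪a, (ω : Eucl (m + 2))⟫_ℝ
      refine h3.congr_deriv ?_
      simp only [l, k', Function.comp, Nat.add_succ_sub_one, add_zero]
      ring
  simp_rw [hsplit]
  rw [integral_add (integrable_intervalIntegral hR hk) (integrable_intervalIntegral hR hk'), hkl,
    ← integral_add (integrable_intervalIntegral hR hl) (integrable_intervalIntegral hR hk')]
  simp_rw [hftc]
  rw [integral_const_mul]
  rfl

/-! ### Traces, and the divergence theorems for vector fields -/

/-- The trace of a continuous endomorphism of `ℝⁿ`. -/
noncomputable def tr {n : ℕ} (T : Eucl n →L[ℝ] Eucl n) : ℝ :=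
  LinearMap.trace ℝ (Eucl n) (T : Eucl n →ₗ[ℝ] Eucl n)

theorem tr_eq_sum {n : ℕ} (T : Eucl n →L[ℝ] Eucl n) :
    tr T = ∑ i, ⟪EuclideanSpace.basisFun (Fin n) ℝ i, T (EuclideanSpace.basisFun (Fin n) ℝ i)⟫_ℝ :=
  LinearMap.trace_eq_sum_inner _ (EuclideanSpace.basisFun (Fin n) ℝ)

theorem fderivWithin_inner_const {n : ℕ} {s : Set (Eucl n)} {X : Eucl n → Eucl n} {x : Eucl n}
    (hs : UniqueDiffWithinAt ℝ s x) (hX : DifferentiableWithinAt ℝ X s x) (b h : Eucl n) :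
    fderivWithin ℝ (fun y => ⟪b, X y⟫_ℝ) s x h = ⟪b, fderivWithin ℝ X s x h⟫_ℝ := by
  have := ((innerSL ℝ b).hasFDerivAt (x := X x)).comp_hasFDerivWithinAt x hX.hasFDerivWithinAt
  rw [HasFDerivWithinAt.fderivWithin (f := fun y => ⟪b, X y⟫_ℝ) this hs]
  simp

/-- The tangential divergence theorem on `∂B_R`. -/
theorem integral_surface_div {n : ℕ} (hn : 2 ≤ n) {R : ℝ} (hR : 0 < R) {X : Eucl n → Eucl n}
    (hX : ContDiffOn ℝ 1 X (closedBall 0 R)) :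
    ∫ x, tr (fderivWithin ℝ X (closedBall 0 R) x * tanProj R x) ∂(surfaceMeasure n R) =
      ((n : ℝ) - 1) / R * ∫ x, ⟪X x, normal R x⟫_ℝ ∂(surfaceMeasure n R) := by
  have hd : ∀ x ∈ closedBall (0 : Eucl n) R, ∀ b h : Eucl n,
      fderivWithin ℝ (fun y => ⟪b, X y⟫_ℝ) (closedBall 0 R) x h =
        ⟪b, fderivWithin ℝ X (closedBall 0 R) x h⟫_ℝ := fun x hx =>
    fderivWithin_inner_const (uniqueDiffOn_closedBall hR x hx)
      (hX.differentiableOn one_ne_zero x hx)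
  have hc : ∀ b : Eucl n, ContDiffOn ℝ 1 (fun y => ⟪b, X y⟫_ℝ) (closedBall 0 R) :=
    fun b => contDiffOn_const.inner ℝ hX
  have hDc : ContinuousOn (fderivWithin ℝ X (closedBall 0 R)) (closedBall 0 R) :=
    hX.continuousOn_fderivWithin (uniqueDiffOn_closedBall hR) le_rfl
  have hsum : ∀ x : Eucl n, ⟪X x, normal R x⟫_ℝ =
      ∑ i, ⟪EuclideanSpace.basisFun (Fin n) ℝ i, X x⟫_ℝ *
        ⟪EuclideanSpace.basisFun (Fin n) ℝ i, normal R x⟫_ℝ := fun x => by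
    rw [← (EuclideanSpace.basisFun (Fin n) ℝ).sum_inner_mul_inner (X x) (normal R x)]
    simp_rw [real_inner_comm (X x)]
  have hint : ∀ i, Integrable (fun x => ⟪EuclideanSpace.basisFun (Fin n) ℝ i, X x⟫_ℝ *
      ⟪EuclideanSpace.basisFun (Fin n) ℝ i, normal R x⟫_ℝ) (surfaceMeasure n R) := fun i => by
    refine integrable_surface hR (ContinuousOn.mul
      ((hc _).continuousOn.mono sphere_subset_closedBall) ?_)
    unfold normal
    fun_prop
  simp_rw [hsum]
  rw [integral_finsetSum _ fun i _ => hint i]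
  rw [Finset.mul_sum]
  simp_rw [← integral_surface_tangential hn hR (hc _)]
  rw [← integral_finsetSum]
  · refine integral_surface_congr hR fun x hx => ?_
    rw [tr_eq_sum]
    exact Finset.sum_congr rfl fun i _ => (hd x (sphere_subset_closedBall hx) _ _).symm
  · intro i _
    refine (integrable_surface hR (f := fun x => ⟪EuclideanSpace.basisFun (Fin n) ℝ i,
      fderivWithin ℝ X (closedBall 0 R) x (tanProj R x
        (EuclideanSpace.basisFun (Fin n) ℝ i))⟫_ℝ) ?_).congr ?_
    · refine continuousOn_const.inner (𝕜 := ℝ) ((hDc.mono sphere_subset_closedBall).clm_apply ?_)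
      simp_rw [tanProj_apply]
      fun_prop
    · exact (ae_mem_sphere hR).mono fun x hx => (hd x (sphere_subset_closedBall hx) _ _).symm

/-- The divergence theorem on the ball. -/
theorem integral_ball_div {n : ℕ} (hn : 2 ≤ n) {R : ℝ} (hR : 0 < R) {X : Eucl n → Eucl n}
    (hX : ContDiffOn ℝ 1 X (closedBall 0 R)) :
    ∫ x in ball (0 : Eucl n) R, tr (fderivWithin ℝ X (closedBall 0 R) x) =
      ∫ x, ⟪X x, normal R x⟫_ℝ ∂(surfaceMeasure n R) := by
  have hd : ∀ x ∈ closedBall (0 : Eucl n) R, ∀ b h : Eucl n,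
      fderivWithin ℝ (fun y => ⟪b, X y⟫_ℝ) (closedBall 0 R) x h =
        ⟪b, fderivWithin ℝ X (closedBall 0 R) x h⟫_ℝ := fun x hx =>
    fderivWithin_inner_const (uniqueDiffOn_closedBall hR x hx)
      (hX.differentiableOn one_ne_zero x hx)
  have hc : ∀ b : Eucl n, ContDiffOn ℝ 1 (fun y => ⟪b, X y⟫_ℝ) (closedBall 0 R) :=
    fun b => contDiffOn_const.inner ℝ hX
  have hDc : ContinuousOn (fderivWithin ℝ X (closedBall 0 R)) (closedBall 0 R) :=
    hX.continuousOn_fderivWithin (uniqueDiffOn_closedBall hR) le_rfl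
  have hsum : ∀ x : Eucl n, ⟪X x, normal R x⟫_ℝ =
      ∑ i, ⟪EuclideanSpace.basisFun (Fin n) ℝ i, X x⟫_ℝ *
        ⟪EuclideanSpace.basisFun (Fin n) ℝ i, normal R x⟫_ℝ := fun x => by
    rw [← (EuclideanSpace.basisFun (Fin n) ℝ).sum_inner_mul_inner (X x) (normal R x)]
    simp_rw [real_inner_comm (X x)]
  have hint : ∀ i, Integrable (fun x => ⟪EuclideanSpace.basisFun (Fin n) ℝ i, X x⟫_ℝ *
      ⟪EuclideanSpace.basisFun (Fin n) ℝ i, normal R x⟫_ℝ) (surfaceMeasure n R) := fun i => by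
    refine integrable_surface hR (ContinuousOn.mul
      ((hc _).continuousOn.mono sphere_subset_closedBall) ?_)
    unfold normal
    fun_prop
  simp_rw [hsum]
  rw [integral_finsetSum _ fun i _ => hint i]
  simp_rw [← integral_ball_fderiv hn hR (hc _)]
  rw [← integral_finsetSum]
  · refine setIntegral_congr_fun measurableSet_ball fun x hx => ?_
    rw [tr_eq_sum]
    exact Finset.sum_congr rfl fun i _ => (hd x (ball_subset_closedBall hx) _ _).symm
  · intro i _
    exact ((((hc _).continuousOn_fderivWithin (uniqueDiffOn_closedBall hR) le_rfl).clm_apply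
      continuousOn_const).integrableOn_compact
      (isCompact_closedBall 0 R)).mono_set ball_subset_closedBall

/-! ### The determinant of an endomorphism of `ℝⁿ` as a smooth function -/

theorem tr_add {n : ℕ} (S T : Eucl n →L[ℝ] Eucl n) : tr (S + T) = tr S + tr T := by
  simp [tr]

theorem tr_sub {n : ℕ} (S T : Eucl n →L[ℝ] Eucl n) : tr (S - T) = tr S - tr T := by
  simp [tr]

theorem tr_neg {n : ℕ} (T : Eucl n →L[ℝ] Eucl n) : tr (-T) = -tr T := by
  simp [tr]

theorem tr_smul {n : ℕ} (c : ℝ) (T : Eucl n →L[ℝ] Eucl n) : tr (c • T) = c * tr T := by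
  simp [tr]

theorem tr_mul_comm {n : ℕ} (S T : Eucl n →L[ℝ] Eucl n) : tr (S * T) = tr (T * S) :=
  LinearMap.trace_mul_comm ℝ (S : Eucl n →ₗ[ℝ] Eucl n) T

theorem tr_adjoint {n : ℕ} (T : Eucl n →L[ℝ] Eucl n) :
    tr (ContinuousLinearMap.adjoint T) = tr T := by
  simp_rw [tr_eq_sum, ContinuousLinearMap.adjoint_inner_right, real_inner_comm]

/-- The trace as a continuous linear functional. -/
noncomputable def trL (n : ℕ) : (Eucl n →L[ℝ] Eucl n) →L[ℝ] ℝ :=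
  LinearMap.toContinuousLinearMap
    { toFun := tr
      map_add' := tr_add
      map_smul' := tr_smul }

theorem trL_apply {n : ℕ} (T : Eucl n →L[ℝ] Eucl n) : trL n T = tr T := rfl

theorem continuous_tr {n : ℕ} : Continuous (tr : (Eucl n →L[ℝ] Eucl n) → ℝ) :=
  (trL n).continuous

theorem det_eq_matrix_det {n : ℕ} (T : Eucl n →L[ℝ] Eucl n) :
    T.det = (LinearMap.toMatrix (EuclideanSpace.basisFun (Fin n) ℝ).toBasis
      (EuclideanSpace.basisFun (Fin n) ℝ).toBasis (T : Eucl n →ₗ[ℝ] Eucl n)).det :=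
  (LinearMap.det_toMatrix _ _).symm

theorem contDiff_det {n : ℕ} {k : WithTop ℕ∞} :
    ContDiff ℝ k (fun T : Eucl n →L[ℝ] Eucl n => T.det) := by
  have h : (fun T : Eucl n →L[ℝ] Eucl n => T.det) = fun T => ∑ σ : Equiv.Perm (Fin n),
      ((Equiv.Perm.sign σ : ℤ) : ℝ) * ∏ i, (T (EuclideanSpace.basisFun (Fin n) ℝ i)) (σ i) := by
    funext T
    rw [det_eq_matrix_det, Matrix.det_apply']
    simp [LinearMap.toMatrix_apply]
  rw [h]
  refine ContDiff.sum fun σ _ => contDiff_const.mul (contDiff_prod fun i _ => ?_)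
  exact ((EuclideanSpace.proj (𝕜 := ℝ) (σ i)).comp
    (ContinuousLinearMap.apply ℝ (Eucl n) (EuclideanSpace.basisFun (Fin n) ℝ i))).contDiff

theorem det_mul' {n : ℕ} (S T : Eucl n →L[ℝ] Eucl n) : (S * T).det = S.det * T.det :=
  LinearMap.det_comp (S : Eucl n →ₗ[ℝ] Eucl n) T

theorem det_one' {n : ℕ} : (1 : Eucl n →L[ℝ] Eucl n).det = 1 :=
  LinearMap.det_id

/-- The determinant is smooth, so its derivative at 1 is read off along lines: det(1 + sK) = 1 + s
tr K + O(s²), with a polynomial remainder. -/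
theorem hasFDerivAt_det_one {n : ℕ} :
    HasFDerivAt (fun T : Eucl n →L[ℝ] Eucl n => T.det) (trL n) 1 := by
  have hd := ((contDiff_det (n := n) (k := 1)).differentiable one_ne_zero 1).hasFDerivAt
  refine hd.congr_fderiv (ContinuousLinearMap.ext fun K => ?_)
  have hl : HasDerivAt (fun s : ℝ => (1 : Eucl n →L[ℝ] Eucl n) + s • K) K 0 := by
    simpa using ((hasDerivAt_id (0 : ℝ)).smul_const K).const_add 1
  have h1 : HasDerivAt (fun s : ℝ => (1 + s • K).det)
      (fderiv ℝ (fun T : Eucl n →L[ℝ] Eucl n => T.det) 1 K) 0 :=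
    HasFDerivAt.comp_hasDerivAt_of_eq (0 : ℝ) hd hl
      (((congrArg (1 + ·) (zero_smul ℝ K)).trans (add_zero _)).symm)
  set Kmat := LinearMap.toMatrix (EuclideanSpace.basisFun (Fin n) ℝ).toBasis
      (EuclideanSpace.basisFun (Fin n) ℝ).toBasis (K : Eucl n →ₗ[ℝ] Eucl n) with hK
  have h2 : ∀ s : ℝ, (1 + s • K).det = 1 + Kmat.trace * s +
      (Matrix.det (1 + (Polynomial.X : Polynomial ℝ) •
        Kmat.map Polynomial.C)).divX.divX.eval s * s ^ 2 := fun s => by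
    rw [det_eq_matrix_det, ← Matrix.det_one_add_smul]
    congr 1
    simp [hK, LinearMap.toMatrix_one]
  have h3 : HasDerivAt (fun s : ℝ => (1 + s • K).det) (Kmat.trace) 0 := by
    simp_rw [h2]
    have := (((hasDerivAt_id (0 : ℝ)).const_mul Kmat.trace).const_add 1).add
      (((Matrix.det (1 + (Polynomial.X : Polynomial ℝ) •
        Kmat.map Polynomial.C)).divX.divX.hasDerivAt 0).mul (hasDerivAt_pow 2 (0 : ℝ)))
    exact this.congr_deriv (by simp)
  rw [h1.unique h3, trL_apply, tr, LinearMap.trace_eq_matrix_trace ℝ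
    (EuclideanSpace.basisFun (Fin n) ℝ).toBasis]

/-- Jacobi's formula, reduced to the derivative at the identity by factoring H(s) = H(t) · (H(t)⁻¹
H(s)). -/
theorem hasDerivAt_det {n : ℕ} {H : ℝ → Eucl n →L[ℝ] Eucl n} {H' : Eucl n →L[ℝ] Eucl n} {t : ℝ}
    (hH : HasDerivAt H H' t) (hu : IsUnit (H t)) :
    HasDerivAt (fun s => (H s).det) ((H t).det * tr (Ring.inverse (H t) * H')) t := by
  have h1 : HasDerivAt (fun s => Ring.inverse (H t) * H s) (Ring.inverse (H t) * H') t :=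
    hH.const_mul _
  have h2 := HasFDerivAt.comp_hasDerivAt_of_eq t hasFDerivAt_det_one h1
    (Ring.inverse_mul_cancel _ hu).symm
  refine (h2.const_mul (H t).det).congr_of_eventuallyEq (.of_forall fun s => ?_)
  simp only [Function.comp]
  rw [← det_mul', ← mul_assoc, Ring.mul_inverse_cancel _ hu, one_mul]

/-- The first two derivatives of `√(det H)` along a curve `H` starting at the identity. -/
theorem hasDerivAt_deriv_sqrt_det {n : ℕ} {H H1 : ℝ → Eucl n →L[ℝ] Eucl n}
    {H2 : Eucl n →L[ℝ] Eucl n} (h0 : H 0 = 1) (hH : ∀ᶠ t in 𝓝 0, HasDerivAt H (H1 t) t)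
    (hH1 : HasDerivAt H1 H2 0) :
    HasDerivAt (deriv fun t => √((H t).det))
      ((tr (H1 0) ^ 2 - tr (H1 0 * H1 0) + tr H2) / 2 - tr (H1 0) ^ 2 / 4) 0 := by
  have hc : ContinuousAt H 0 := hH.self_of_nhds.continuousAt
  have hu : ∀ᶠ t in 𝓝 0, IsUnit (H t) := by
    have : IsOpen {T : Eucl n →L[ℝ] Eucl n | IsUnit T} := Units.isOpen
    exact hc.eventually (this.mem_nhds (by simp [h0]))
  have hdet : ContinuousAt (fun t => (H t).det) 0 :=
    (contDiff_det (n := n) (k := 1)).continuous.continuousAt.comp hc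
  have hp : ∀ᶠ t in 𝓝 0, 0 < (H t).det :=
    hdet.eventually (lt_mem_nhds (by simp only [h0, det_one']; exact one_pos))
  -- With g = det H one has (√g)' = g tr(H⁻¹H') / (2√g). Differentiating once more at g(0) = 1 gives
  -- g''/2 - g'²/4, where (H⁻¹)' = -H' contributes the term -tr(H'H').
  have hd1 : deriv (fun t => √((H t).det)) =ᶠ[𝓝 0] fun t =>
      (H t).det * tr (Ring.inverse (H t) * H1 t) / (2 * √((H t).det)) := by
    filter_upwards [hH, hu, hp] with t ht hut hpt
    exact ((hasDerivAt_det ht hut).sqrt hpt.ne').deriv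
  have hg : HasDerivAt (fun t => (H t).det) (tr (H1 0)) 0 := by
    have := hasDerivAt_det hH.self_of_nhds hu.self_of_nhds
    simpa [h0, det_one'] using this
  have hinv : HasDerivAt (fun t => Ring.inverse (H t)) (-H1 0) 0 := by
    have h := HasFDerivAt.comp_hasDerivAt_of_eq (0 : ℝ)
      (hasFDerivAt_ringInverse (𝕜 := ℝ) (1 : (Eucl n →L[ℝ] Eucl n)ˣ)) hH.self_of_nhds
      (by simp [h0])
    exact h.congr_deriv (by simp)
  have htr : HasDerivAt (fun t => tr (Ring.inverse (H t) * H1 t)) 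
      (tr H2 - tr (H1 0 * H1 0)) 0 := by
    have h := (trL n).hasFDerivAt.comp_hasDerivAt (0 : ℝ) (hinv.mul hH1)
    refine h.congr_deriv ?_
    have e : -H1 0 * H1 0 = -(H1 0 * H1 0) :=
      ContinuousLinearMap.ext fun a => rfl
    rw [h0, Ring.inverse_one, one_mul, trL_apply, tr_add, e, tr_neg]
    ring
  have hs := hg.sqrt (by rw [h0, det_one']; exact one_ne_zero)
  have hfin := (hg.mul htr).div (hs.const_mul 2) (by simp [h0, det_one'])
  refine (hfin.congr_deriv ?_).congr_of_eventuallyEq hd1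
  simp [h0, det_one']
  ring

/-! ### The surface factor as the square root of a determinant -/

/-- Sylvester's identity. It moves a determinant on the tangent space, which varies with x, to one
on the fixed space ℝⁿ. -/
theorem det_one_add_comp_comm {U V : Type*} [AddCommGroup U] [Module ℝ U] [FiniteDimensional ℝ U]
    [AddCommGroup V] [Module ℝ V] [FiniteDimensional ℝ V] (f : U →ₗ[ℝ] V) (g : V →ₗ[ℝ] U) :
    LinearMap.det (1 + g ∘ₗ f) = LinearMap.det (1 + f ∘ₗ g) := by
  let b := Module.finBasis ℝ U
  let c := Module.finBasis ℝ V
  rw [← LinearMap.det_toMatrix b, ← LinearMap.det_toMatrix c, map_add, map_add,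
    LinearMap.toMatrix_comp b c b, LinearMap.toMatrix_comp c b c, LinearMap.toMatrix_one,
    LinearMap.toMatrix_one, Matrix.det_one_add_mul_comm]

/-- The endomorphism of `ℝⁿ` whose determinant is the Gram determinant of the restriction of `M`
to the range of the orthogonal projection `P`; `M'` stands for the adjoint of `M`. -/
noncomputable def gramOp {n : ℕ} (M' M P : Eucl n →L[ℝ] Eucl n) : Eucl n →L[ℝ] Eucl n :=
  1 + (M' * M - 1) * P

/-- `tanProj` carries the constant R⁻² in place of ‖x‖⁻², which makes it polynomial in x and
differentiable everywhere. The price is that it is known to be a projection on the sphere only. -/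
theorem tanProj_eq_starProjection {n : ℕ} {R : ℝ} {x : Eucl n}
    (hx : x ∈ sphere (0 : Eucl n) R) : tanProj R x = ((ℝ ∙ x)ᗮ).starProjection := by
  have hx' : ‖x‖ = R := by simpa using hx
  ext1 a
  rw [Submodule.starProjection_orthogonal', tanProj_apply]
  simp [Submodule.starProjection_singleton, hx', div_eq_inv_mul]

theorem surfaceFactor_eq {n : ℕ} {R : ℝ} {y : Eucl n → Eucl n} {x : Eucl n}
    (hx : x ∈ sphere (0 : Eucl n) R) :
    surfaceFactor R y x = √((gramOp
      (ContinuousLinearMap.adjoint (fderivWithin ℝ y (closedBall 0 R) x))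
      (fderivWithin ℝ y (closedBall 0 R) x) (tanProj R x)).det) := by
  set M := fderivWithin ℝ y (closedBall 0 R) x
  set U : Submodule ℝ (Eucl n) := (ℝ ∙ x)ᗮ
  have h1 := (M ∘L U.subtypeL).normDet_sq
  have h2 : ((M ∘L U.subtypeL : U →L[ℝ] Eucl n) : U →ₗ[ℝ] Eucl n).normDet =
      surfaceFactor R y x := rfl
  -- With ι the inclusion of the tangent space, ι*ι = 1 and ιι* = P. Hence (Mι)*(Mι) = 1 + ι*(M*M -
  -- 1)ι, while the operator on ℝⁿ is 1 + (M*M - 1)ιι*.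
  have h3 : (ContinuousLinearMap.adjoint (M ∘L U.subtypeL) ∘L (M ∘L U.subtypeL)).det =
      (gramOp (ContinuousLinearMap.adjoint M) M (tanProj R x)).det := by
    have e1 : ((ContinuousLinearMap.adjoint (M ∘L U.subtypeL) ∘L (M ∘L U.subtypeL) :
        U →L[ℝ] U) : U →ₗ[ℝ] U) = 1 + (U.orthogonalProjectionOnto : Eucl n →ₗ[ℝ] U) ∘ₗ
          (((ContinuousLinearMap.adjoint M * M - 1) ∘L U.subtypeL : U →L[ℝ] Eucl n) :
            U →ₗ[ℝ] Eucl n) := by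
      ext1 u
      rw [ContinuousLinearMap.adjoint_comp, Submodule.adjoint_subtypeL]
      simp
      rfl
    have e2 : ((gramOp (ContinuousLinearMap.adjoint M) M (tanProj R x) :
        Eucl n →L[ℝ] Eucl n) : Eucl n →ₗ[ℝ] Eucl n) = 1 +
          (((ContinuousLinearMap.adjoint M * M - 1) ∘L U.subtypeL : U →L[ℝ] Eucl n) :
            U →ₗ[ℝ] Eucl n) ∘ₗ (U.orthogonalProjectionOnto : Eucl n →ₗ[ℝ] U) := by
      rw [gramOp, tanProj_eq_starProjection hx]
      rfl
    rw [ContinuousLinearMap.det, ContinuousLinearMap.det, e1, e2, det_one_add_comp_comm]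
  rw [h2, h3] at h1
  rw [← h1]
  exact (Real.sqrt_sq (LinearMap.normDet_nonneg _)).symm

/-! ### Integrals depending smoothly on a parameter -/

/-- By compactness one time interval serves all points of `Ω` at once. -/
theorem exists_tube {Ω : Type*} [TopologicalSpace Ω] [CompactSpace Ω]
    {Z : Type*} [TopologicalSpace Z] {U : Set (ℝ × Z)} {z : Ω → Z} (hU : IsOpen U)
    (hz : Continuous z) {t₀ : ℝ} (h₀ : ∀ ω, (t₀, z ω) ∈ U) :
    ∃ δ > 0, closedBall t₀ δ ×ˢ Set.range z ⊆ U := by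
  obtain ⟨u, v, hu, -, htu, hzv, huv⟩ := generalized_tube_lemma (isCompact_singleton (x := t₀))
    (isCompact_range hz) hU (by
      rintro ⟨t, y⟩ ⟨ht, ω, hω⟩
      obtain rfl : t = t₀ := ht
      obtain rfl : z ω = y := hω
      exact h₀ ω)
  obtain ⟨δ, hδ, hδu⟩ := Metric.nhds_basis_closedBall.mem_iff.1
    (hu.mem_nhds (htu (Set.mem_singleton t₀)))
  exact ⟨δ, hδ, (Set.prod_mono hδu hzv).trans huv⟩

section Parametric

variable {Ω : Type*} [TopologicalSpace Ω] [CompactSpace Ω] [MeasurableSpace Ω]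
  [OpensMeasurableSpace Ω] {μ : Measure Ω} [IsFiniteMeasure μ]
  {Z : Type*} [NormedAddCommGroup Z] [NormedSpace ℝ Z] {U : Set (ℝ × Z)} {Φ : ℝ × Z → ℝ}
  {z : Ω → Z}

theorem hasDerivAt_slice (hU : IsOpen U) (hΦ : ContDiffOn ℝ 1 Φ U) {t : ℝ} {y : Z}
    (h : (t, y) ∈ U) : HasDerivAt (fun s => Φ (s, y)) (fderiv ℝ Φ (t, y) (1, 0)) t := by
  have h1 := ((hΦ.contDiffAt (hU.mem_nhds h)).differentiableAt one_ne_zero).hasFDerivAt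
  have h2 : HasDerivAt (fun s : ℝ => (s, y)) (1, (0 : Z)) t :=
    (hasDerivAt_id t).prodMk (hasDerivAt_const t y)
  exact h1.comp_hasDerivAt t h2

/-- The time derivative of `Φ` is bounded on the compact product of a time interval and the range of
`z`. On a finite measure space this constant bound is integrable and dominates. -/
theorem hasDerivAt_parametric (hU : IsOpen U) (hΦ : ContDiffOn ℝ 1 Φ U) (hz : Continuous z)
    {t₀ : ℝ} (h₀ : ∀ ω, (t₀, z ω) ∈ U) :
    HasDerivAt (fun t => ∫ ω, Φ (t, z ω) ∂μ) (∫ ω, fderiv ℝ Φ (t₀, z ω) (1, 0) ∂μ) t₀ := by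
  obtain ⟨δ, hδ, hδU⟩ := exists_tube hU hz h₀
  have hmem : ∀ t ∈ closedBall t₀ δ, ∀ ω, (t, z ω) ∈ U := fun t ht ω =>
    hδU ⟨ht, ω, rfl⟩
  have hdc : ContinuousOn (fun p => fderiv ℝ Φ p (1, 0)) U :=
    (hΦ.continuousOn_fderiv_of_isOpen hU le_rfl).clm_apply continuousOn_const
  obtain ⟨C, hC⟩ := ((isCompact_closedBall t₀ δ).prod
    (isCompact_range hz)).exists_bound_of_continuousOn
    (hdc.mono hδU)
  have hcont : ∀ t ∈ closedBall t₀ δ, Continuous fun ω => Φ (t, z ω) := fun t ht =>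
    hΦ.continuousOn.comp_continuous (by fun_prop) (hmem t ht)
  have ht₀ : t₀ ∈ closedBall t₀ δ := mem_closedBall_self hδ.le
  refine (hasDerivAt_integral_of_dominated_loc_of_deriv_le (bound := fun _ => C)
    (F := fun t ω => Φ (t, z ω)) (F' := fun t ω => fderiv ℝ Φ (t, z ω) (1, 0))
    (closedBall_mem_nhds t₀ hδ) ?_ ?_ ?_ ?_ (integrable_const C) ?_).2
  · filter_upwards [closedBall_mem_nhds t₀ hδ] with t ht
    exact (hcont t ht).aestronglyMeasurable
  · exact (hcont t₀ ht₀).integrable_of_hasCompactSupport (HasCompactSupport.of_compactSpace _)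
  · exact (hdc.comp_continuous (by fun_prop) (hmem t₀ ht₀)).aestronglyMeasurable
  · exact .of_forall fun ω t ht => hC _ ⟨ht, ω, rfl⟩
  · exact .of_forall fun ω t ht => hasDerivAt_slice hU hΦ (hmem t ht ω)

/-- If `Φ` is `C³`, the integral is `C²` in the parameter and may be differentiated twice under
the integral sign. -/
theorem parametric_contDiffAt (hU : IsOpen U) (hΦ : ContDiffOn ℝ 3 Φ U) (hz : Continuous z)
    {t₀ : ℝ} (h₀ : ∀ ω, (t₀, z ω) ∈ U) :
    ContDiffAt ℝ 2 (fun t => ∫ ω, Φ (t, z ω) ∂μ) t₀ ∧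
      iteratedDeriv 2 (fun t => ∫ ω, Φ (t, z ω) ∂μ) t₀ =
        ∫ ω, deriv (deriv fun t => Φ (t, z ω)) t₀ ∂μ := by
  obtain ⟨δ, hδ, hδU⟩ := exists_tube hU hz h₀
  have hmem : ∀ t ∈ ball t₀ δ, ∀ ω, (t, z ω) ∈ U := fun t ht ω =>
    hδU ⟨ball_subset_closedBall ht, ω, rfl⟩
  set Φ₁ : ℝ × Z → ℝ := fun p => fderiv ℝ Φ p (1, 0) with hΦ₁
  set Φ₂ : ℝ × Z → ℝ := fun p => fderiv ℝ Φ₁ p (1, 0) with hΦ₂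
  have hc₁ : ContDiffOn ℝ 2 Φ₁ U :=
    (hΦ.fderiv_of_isOpen hU (m := 2) (by norm_num)).clm_apply contDiffOn_const
  have hc₂ : ContDiffOn ℝ 1 Φ₂ U :=
    (hc₁.fderiv_of_isOpen hU (m := 1) (by norm_num)).clm_apply contDiffOn_const
  have hd₀ : ∀ t ∈ ball t₀ δ, HasDerivAt (fun t => ∫ ω, Φ (t, z ω) ∂μ)
      (∫ ω, Φ₁ (t, z ω) ∂μ) t := fun t ht =>
    hasDerivAt_parametric hU (hΦ.of_le (by norm_num)) hz (hmem t ht)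
  have hd₁ : ∀ t ∈ ball t₀ δ, HasDerivAt (fun t => ∫ ω, Φ₁ (t, z ω) ∂μ)
      (∫ ω, Φ₂ (t, z ω) ∂μ) t := fun t ht =>
    hasDerivAt_parametric hU (hc₁.of_le (by norm_num)) hz (hmem t ht)
  -- The third derivative serves only to make the second derivative of the integral continuous.
  have hd₂ : ∀ t ∈ ball t₀ δ, DifferentiableAt ℝ (fun t => ∫ ω, Φ₂ (t, z ω) ∂μ) t :=
    fun t ht => (hasDerivAt_parametric hU hc₂ hz (hmem t ht)).differentiableAt
  have ho : IsOpen (ball t₀ δ) := isOpen_ball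
  have ht₀ : t₀ ∈ ball t₀ δ := mem_ball_self hδ
  have hC0 : ContDiffOn ℝ 0 (fun t => ∫ ω, Φ₂ (t, z ω) ∂μ) (ball t₀ δ) :=
    contDiffOn_zero.2 fun t ht => (hd₂ t ht).continuousAt.continuousWithinAt
  have hC1 : ContDiffOn ℝ (0 + 1) (fun t => ∫ ω, Φ₁ (t, z ω) ∂μ) (ball t₀ δ) :=
    (contDiffOn_succ_iff_deriv_of_isOpen ho).2
      ⟨fun t ht => (hd₁ t ht).differentiableAt.differentiableWithinAt, by simp,
        hC0.congr fun t ht => (hd₁ t ht).deriv⟩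
  have hC2 : ContDiffOn ℝ (1 + 1) (fun t => ∫ ω, Φ (t, z ω) ∂μ) (ball t₀ δ) :=
    (contDiffOn_succ_iff_deriv_of_isOpen ho).2
      ⟨fun t ht => (hd₀ t ht).differentiableAt.differentiableWithinAt, by simp,
        (by simpa using hC1.congr fun t ht => (hd₀ t ht).deriv)⟩
  refine ⟨?_, ?_⟩
  · have := hC2.contDiffAt (ho.mem_nhds ht₀)
    rwa [one_add_one_eq_two] at this
  · rw [iteratedDeriv_succ, iteratedDeriv_one]
    have he : deriv (fun t => ∫ ω, Φ (t, z ω) ∂μ) =ᶠ[𝓝 t₀] fun t => ∫ ω, Φ₁ (t, z ω) ∂μ := by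
      filter_upwards [ho.mem_nhds ht₀] with t ht using (hd₀ t ht).deriv
    rw [he.deriv_eq, (hd₁ t₀ ht₀).deriv]
    congr 1
    funext ω
    have he' : deriv (fun t => Φ (t, z ω)) =ᶠ[𝓝 t₀] fun t => Φ₁ (t, z ω) := by
      filter_upwards [ho.mem_nhds ht₀] with t ht
      exact (hasDerivAt_slice hU (hΦ.of_le (by norm_num)) (hmem t ht ω)).deriv
    rw [he'.deriv_eq, (hasDerivAt_slice hU (hc₁.of_le (by norm_num)) (h₀ ω)).deriv]

end Parametric

/-! ### The surface factor along the perturbation without remainder -/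

/-- `(1 + t A' + t²/2 B') (1 + t A + t²/2 B)` restricted by `P`. -/
noncomputable def gramCurve {n : ℕ} (A' A B' B P : Eucl n →L[ℝ] Eucl n) (t : ℝ) :
    Eucl n →L[ℝ] Eucl n :=
  gramOp (1 + t • A' + (t ^ 2 / 2) • B') (1 + t • A + (t ^ 2 / 2) • B) P

theorem zero_smul_clm {n : ℕ} (A : Eucl n →L[ℝ] Eucl n) : (0 : ℝ) • A = 0 :=
  ContinuousLinearMap.ext fun a => zero_smul ℝ (A a)

theorem gramCurve_zero {n : ℕ} (A' A B' B P : Eucl n →L[ℝ] Eucl n) :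
    gramCurve A' A B' B P 0 = 1 := by
  simp [gramCurve, gramOp, zero_smul_clm]

theorem hasDerivAt_deriv_sqrt_gramCurve {n : ℕ} (A' A B' B P : Eucl n →L[ℝ] Eucl n) :
    HasDerivAt (deriv fun t => √((gramCurve A' A B' B P t).det))
      ((tr ((A' + A) * P) ^ 2 - tr ((A' + A) * P * ((A' + A) * P)) +
        tr ((B' + (2 : ℝ) • (A' * A) + B) * P)) / 2 - tr ((A' + A) * P) ^ 2 / 4) 0 := by
  have hM : ∀ (A B : Eucl n →L[ℝ] Eucl n) (t : ℝ),
      HasDerivAt (fun t : ℝ => 1 + t • A + (t ^ 2 / 2) • B) (A + t • B) t := fun A B t => by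
    have h1 : HasDerivAt (fun t : ℝ => t • A) A t := by
      simpa using (hasDerivAt_id t).smul_const A
    have h2 : HasDerivAt (fun t : ℝ => (t ^ 2 / 2) • B) (t • B) t := by
      have := ((hasDerivAt_pow 2 t).div_const 2).smul_const B
      refine this.congr_deriv ?_
      norm_num
    exact (h1.const_add 1).add h2
  have hM1 : ∀ (A B : Eucl n →L[ℝ] Eucl n) (t : ℝ),
      HasDerivAt (fun t : ℝ => A + t • B) B t := fun A B t => by
    simpa using ((hasDerivAt_id t).smul_const B).const_add A
  have hH : ∀ t, HasDerivAt (gramCurve A' A B' B P)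
      (((A' + t • B') * (1 + t • A + (t ^ 2 / 2) • B) +
        (1 + t • A' + (t ^ 2 / 2) • B') * (A + t • B)) * P) t := fun t =>
    ((((hM A' B' t).mul (hM A B t)).sub_const 1).mul_const P).const_add 1
  have hH1 := (((hM1 A' B' 0).mul (hM A B 0)).add ((hM A' B' 0).mul (hM1 A B 0))).mul_const P
  have h := hasDerivAt_deriv_sqrt_det (gramCurve_zero A' A B' B P) (.of_forall hH)
    (H2 := (B' + (2 : ℝ) • (A' * A) + B) * P) (hH1.congr_deriv ?_)
  · simpa [zero_smul_clm] using h
  · congr 1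
    simp only [zero_smul_clm, ne_eq, OfNat.ofNat_ne_zero, not_false_eq_true, zero_pow, zero_div,
      add_zero, mul_one, one_mul]
    have e : (2 : ℝ) • (A' * A) = A' * A + A' * A :=
      ContinuousLinearMap.ext fun a => two_smul ℝ _
    rw [e]
    abel

theorem fderivWithin_perturbation {n : ℕ} {R : ℝ} (hR : 0 < R) {v w : Eucl n → Eucl n}
    {r : ℝ → Eucl n → Eucl n} (hv : ContDiffOn ℝ 2 v (closedBall 0 R))
    (hw : ContDiffOn ℝ 2 w (closedBall 0 R)) {t : ℝ} (hr : ContDiffOn ℝ 1 (r t) (closedBall 0 R))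
    {x : Eucl n} (hx : x ∈ closedBall (0 : Eucl n) R) :
    fderivWithin ℝ (perturbation v w r t) (closedBall 0 R) x =
      1 + t • fderivWithin ℝ v (closedBall 0 R) x +
        (t ^ 2 / 2) • fderivWithin ℝ w (closedBall 0 R) x +
        fderivWithin ℝ (r t) (closedBall 0 R) x := by
  have h1 := (hv.differentiableOn two_ne_zero x hx).hasFDerivWithinAt
  have h2 := (hw.differentiableOn two_ne_zero x hx).hasFDerivWithinAt
  have h3 := (hr.differentiableOn one_ne_zero x hx).hasFDerivWithinAt
  exact ((((hasFDerivWithinAt_id x _).add (h1.const_smul t)).add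
    (h2.const_smul (t ^ 2 / 2))).add h3).fderivWithin (uniqueDiffOn_closedBall hR x hx)

theorem fderivWithin_perturbation_zero {n : ℕ} {R : ℝ} (hR : 0 < R) {v w : Eucl n → Eucl n}
    (hv : ContDiffOn ℝ 2 v (closedBall 0 R)) (hw : ContDiffOn ℝ 2 w (closedBall 0 R)) (t : ℝ)
    {x : Eucl n} (hx : x ∈ closedBall (0 : Eucl n) R) :
    fderivWithin ℝ (perturbation v w 0 t) (closedBall 0 R) x =
      1 + t • fderivWithin ℝ v (closedBall 0 R) x +
        (t ^ 2 / 2) • fderivWithin ℝ w (closedBall 0 R) x := by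
  rw [fderivWithin_perturbation hR hv hw (r := 0) contDiffOn_const hx]
  simp

theorem adjoint_perturbed {n : ℕ} (t : ℝ) (A B : Eucl n →L[ℝ] Eucl n) :
    ContinuousLinearMap.adjoint (1 + t • A + (t ^ 2 / 2) • B) =
      1 + t • ContinuousLinearMap.adjoint A + (t ^ 2 / 2) • ContinuousLinearMap.adjoint B := by
  have h1 : ContinuousLinearMap.adjoint (1 : Eucl n →L[ℝ] Eucl n) = 1 :=
    ContinuousLinearMap.adjoint_id
  rw [map_add, map_add, h1, LinearIsometryEquiv.map_smulₛₗ, LinearIsometryEquiv.map_smulₛₗ]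
  rfl

theorem surfaceFactor_perturbation_zero {n : ℕ} {R : ℝ} (hR : 0 < R) {v w : Eucl n → Eucl n}
    (hv : ContDiffOn ℝ 2 v (closedBall 0 R)) (hw : ContDiffOn ℝ 2 w (closedBall 0 R)) (t : ℝ)
    {x : Eucl n} (hx : x ∈ sphere (0 : Eucl n) R) :
    surfaceFactor R (perturbation v w 0 t) x = √((gramCurve
      (ContinuousLinearMap.adjoint (fderivWithin ℝ v (closedBall 0 R) x))
      (fderivWithin ℝ v (closedBall 0 R) x)
      (ContinuousLinearMap.adjoint (fderivWithin ℝ w (closedBall 0 R) x))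
      (fderivWithin ℝ w (closedBall 0 R) x) (tanProj R x) t).det) := by
  rw [surfaceFactor_eq hx,
    fderivWithin_perturbation_zero hR hv hw t (sphere_subset_closedBall hx), adjoint_perturbed]
  rfl

theorem continuous_tanProj {n : ℕ} (R : ℝ) : Continuous (tanProj (n := n) R) := by
  unfold tanProj
  simp_rw [InnerProductSpace.rankOne_def]
  fun_prop

/-- The second derivative of the surface factor at `t = 0`. -/
noncomputable def accel {n : ℕ} (R : ℝ) (v w : Eucl n → Eucl n) (x : Eucl n) : ℝ :=
  deriv (deriv fun t => surfaceFactor R (perturbation v w 0 t) x) 0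

theorem surfaceArea_contDiffAt {n : ℕ} {R : ℝ} (hR : 0 < R) {v w : Eucl n → Eucl n}
    (hv : ContDiffOn ℝ 2 v (closedBall 0 R)) (hw : ContDiffOn ℝ 2 w (closedBall 0 R)) :
    ContDiffAt ℝ 2 (surfaceArea R (perturbation v w 0)) 0 ∧
      iteratedDeriv 2 (surfaceArea R (perturbation v w 0)) 0 =
        ∫ x, accel R v w x ∂(surfaceMeasure n R) := by
  let E := Eucl n →L[ℝ] Eucl n
  -- Time and the five operators, adjoints included, are treated as independent variables, in which
  -- `G` is polynomial. The point x enters through the continuous map `ζ` alone, so no smoothness in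
  -- x is needed.
  let G : ℝ × (E × E × E × E × E) → E := fun p =>
    gramCurve p.2.1 p.2.2.1 p.2.2.2.1 p.2.2.2.2.1 p.2.2.2.2.2 p.1
  have hG : ContDiff ℝ 3 G := by
    simp only [G, gramCurve, gramOp]
    fun_prop
  let U : Set (ℝ × (E × E × E × E × E)) := {p | 0 < (G p).det}
  have hdG : ContDiff ℝ 3 fun p => (G p).det := contDiff_det.comp hG
  have hU : IsOpen U := isOpen_lt continuous_const hdG.continuous
  have hΦ : ContDiffOn ℝ 3 (fun p => √((G p).det)) U := fun p hp =>
    (hdG.contDiffAt.sqrt (ne_of_gt hp)).contDiffWithinAt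
  let ζ : Eucl n → E × E × E × E × E := fun x =>
    (ContinuousLinearMap.adjoint (fderivWithin ℝ v (closedBall 0 R) x),
      fderivWithin ℝ v (closedBall 0 R) x,
      ContinuousLinearMap.adjoint (fderivWithin ℝ w (closedBall 0 R) x),
      fderivWithin ℝ w (closedBall 0 R) x, tanProj R x)
  have hA : ContinuousOn (fderivWithin ℝ v (closedBall 0 R)) (closedBall 0 R) :=
    hv.continuousOn_fderivWithin (uniqueDiffOn_closedBall hR) one_le_two
  have hB : ContinuousOn (fderivWithin ℝ w (closedBall 0 R)) (closedBall 0 R) :=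
    hw.continuousOn_fderivWithin (uniqueDiffOn_closedBall hR) one_le_two
  have hadj : Continuous (ContinuousLinearMap.adjoint : E → E) :=
    (ContinuousLinearMap.adjoint (𝕜 := ℝ) (E := Eucl n) (F := Eucl n)).continuous
  have hζ : ContinuousOn ζ (sphere 0 R) := by
    refine ContinuousOn.mono ?_ sphere_subset_closedBall
    exact (hadj.comp_continuousOn hA).prodMk (hA.prodMk ((hadj.comp_continuousOn hB).prodMk
      (hB.prodMk (continuous_tanProj R).continuousOn)))
  have hz := continuous_comp_smul_sphere hR hζ
  have h0 : ∀ ω : sphere (0 : Eucl n) 1, ((0 : ℝ), ζ (R • (ω : Eucl n))) ∈ U := fun ω => by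
    show 0 < (gramCurve _ _ _ _ _ 0).det
    rw [gramCurve_zero, det_one']
    exact one_pos
  have hsf : ∀ (ω : sphere (0 : Eucl n) 1) (t : ℝ),
      surfaceFactor R (perturbation v w 0 t) (R • (ω : Eucl n)) =
        √((G (t, ζ (R • (ω : Eucl n)))).det) := fun ω t =>
    surfaceFactor_perturbation_zero hR hv hw t (smul_mem_sphere hR ω)
  have key := parametric_contDiffAt (μ := (volume : Measure (Eucl n)).toSphere) hU hΦ hz h0
  have hS : surfaceArea R (perturbation v w 0) = fun t => R ^ (n - 1) *
      ∫ ω : sphere (0 : Eucl n) 1, √((G (t, ζ (R • (ω : Eucl n)))).det)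
        ∂(volume : Measure (Eucl n)).toSphere := by
    funext t
    rw [surfaceArea, integral_surfaceMeasure hR]
    simp_rw [hsf]
  rw [hS]
  refine ⟨contDiffAt_const.mul key.1, ?_⟩
  refine (iteratedDeriv_const_mul_field _ _).trans ?_
  rw [key.2, integral_surfaceMeasure hR]
  simp_rw [accel, hsf]

/-! ### The second derivative of the surface factor at t = 0 -/

theorem adjoint_tanProj {n : ℕ} (R : ℝ) (x : Eucl n) :
    ContinuousLinearMap.adjoint (tanProj R x) = tanProj R x := by
  rw [eq_comm, ContinuousLinearMap.eq_adjoint_iff]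
  intro a b
  simp only [tanProj_apply, inner_sub_left, inner_sub_right, real_inner_smul_left,
    real_inner_smul_right, real_inner_comm x a]
  ring

theorem one_sub_tanProj {n : ℕ} (R : ℝ) (x : Eucl n) :
    1 - tanProj R x = InnerProductSpace.rankOne ℝ (normal R x) (normal R x) := by
  ext1 a
  simp [tanProj_apply, normal, smul_smul]
  congr 1
  ring

theorem tanProj_mul_self {n : ℕ} {R : ℝ} {x : Eucl n} (hx : x ∈ sphere (0 : Eucl n) R) :
    tanProj R x * tanProj R x = tanProj R x := by
  rw [tanProj_eq_starProjection hx]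
  exact ((ℝ ∙ x)ᗮ).isIdempotentElem_starProjection

/-- The general formula for √det is applied with first derivative (A* + A)P. Traces of adjoints
coincide with those of A and B, leaving tr(A*AP) - tr(A*PAP), which is the squared length of PA*ν.
-/
theorem accel_eq {n : ℕ} {R : ℝ} (hR : 0 < R) {v w : Eucl n → Eucl n}
    (hv : ContDiffOn ℝ 2 v (closedBall 0 R)) (hw : ContDiffOn ℝ 2 w (closedBall 0 R))
    {x : Eucl n} (hx : x ∈ sphere (0 : Eucl n) R) :
    accel R v w x =
      tr (fderivWithin ℝ v (closedBall 0 R) x * tanProj R x) ^ 2 -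
      tr (fderivWithin ℝ v (closedBall 0 R) x * tanProj R x *
        (fderivWithin ℝ v (closedBall 0 R) x * tanProj R x)) +
      tr (fderivWithin ℝ w (closedBall 0 R) x * tanProj R x) +
      ‖tanProj R x (ContinuousLinearMap.adjoint (fderivWithin ℝ v (closedBall 0 R) x)
        (normal R x))‖ ^ 2 := by
  rw [accel]
  simp_rw [surfaceFactor_perturbation_zero hR hv hw _ hx]
  rw [(hasDerivAt_deriv_sqrt_gramCurve _ _ _ _ _).deriv]
  set A := fderivWithin ℝ v (closedBall 0 R) x
  set B := fderivWithin ℝ w (closedBall 0 R) x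
  set A' := ContinuousLinearMap.adjoint A with hA'
  set B' := ContinuousLinearMap.adjoint B with hB'
  set P := tanProj R x with hP
  have hmul : ∀ S T : Eucl n →L[ℝ] Eucl n, ContinuousLinearMap.adjoint (S * T) =
      ContinuousLinearMap.adjoint T * ContinuousLinearMap.adjoint S :=
    fun S T => ContinuousLinearMap.adjoint_comp S T
  have hPa : ContinuousLinearMap.adjoint P = P := adjoint_tanProj R x
  have e1 : tr (A' * P) = tr (A * P) := by
    rw [← tr_adjoint (A * P), hmul, hPa, tr_mul_comm]
  have e2 : tr (B' * P) = tr (B * P) := by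
    rw [← tr_adjoint (B * P), hmul, hPa, tr_mul_comm]
  have e3 : tr (A' * P * (A' * P)) = tr (A * P * (A * P)) := by
    have h1 : tr (P * A' * (P * A')) = tr (A' * P * (A' * P)) := by
      rw [mul_assoc P, tr_mul_comm P]
      simp only [mul_assoc]
    rw [← tr_adjoint (A * P * (A * P)), hmul, hmul, hPa, ← hA', h1]
  have e4 : tr (A * P * (A' * P)) = tr (A' * P * (A * P)) := tr_mul_comm _ _
  have e5 : tr (A' * A * P) - tr (A' * P * (A * P)) = ‖P (A' (normal R x))‖ ^ 2 := by
    -- Since 1 - P = ν ⊗ ν, this difference has rank one, and its trace is ⟪PA*ν, A*ν⟫ = |PA*ν|².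
    have h1 : A' * A * P - A' * P * (A * P) = A' * (1 - P) * (A * P) := by noncomm_ring
    have h2 : A' * (1 - P) * (A * P) =
        InnerProductSpace.rankOne ℝ (A' (normal R x)) (P (A' (normal R x))) := by
      rw [hP, one_sub_tanProj, ← hP]
      ext1 a
      simp only [mul_apply_eq_comp, InnerProductSpace.rankOne_apply, map_smul]
      congr 1
      rw [← hPa, ContinuousLinearMap.adjoint_inner_left, hPa, hA',
        ContinuousLinearMap.adjoint_inner_left]
    rw [← tr_sub, h1, h2, tr, InnerProductSpace.trace_rankOne, ← real_inner_self_eq_norm_sq]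
    set u := A' (normal R x)
    have h3 : P (P u) = P u := congrArg (fun T => T u) (tanProj_mul_self hx)
    calc ⟪P u, u⟫_ℝ = ⟪ContinuousLinearMap.adjoint P (P u), u⟫_ℝ := by rw [hPa, h3]
      _ = ⟪P u, P u⟫_ℝ := ContinuousLinearMap.adjoint_inner_left _ _ _
  have e6 : tr ((2 : ℝ) • (A' * A) * P) = 2 * tr (A' * A * P) := tr_smul 2 (A' * A * P)
  simp only [add_mul, mul_add, tr_add, e1, e2, e3, e4, e6]
  linear_combination e5

/-! ### The effect of the remainder -/

theorem continuous_adjoint {n : ℕ} : Continuous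
    (ContinuousLinearMap.adjoint : (Eucl n →L[ℝ] Eucl n) → (Eucl n →L[ℝ] Eucl n)) :=
  (ContinuousLinearMap.adjoint (𝕜 := ℝ) (E := Eucl n) (F := Eucl n)).continuous

theorem continuousOn_surfaceFactor {n : ℕ} {R : ℝ} (hR : 0 < R) {y : Eucl n → Eucl n}
    (hy : ContDiffOn ℝ 1 y (closedBall 0 R)) :
    ContinuousOn (surfaceFactor R y) (sphere 0 R) := by
  have hD : ContinuousOn (fderivWithin ℝ y (closedBall 0 R)) (sphere 0 R) :=
    (hy.continuousOn_fderivWithin (uniqueDiffOn_closedBall hR) le_rfl).mono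
      sphere_subset_closedBall
  refine ContinuousOn.congr (f := fun x => √((gramOp
      (ContinuousLinearMap.adjoint (fderivWithin ℝ y (closedBall 0 R) x))
      (fderivWithin ℝ y (closedBall 0 R) x) (tanProj R x)).det)) ?_
    fun x hx => surfaceFactor_eq hx
  refine Real.continuous_sqrt.comp_continuousOn
    ((contDiff_det (k := 1)).continuous.comp_continuousOn ?_)
  unfold gramOp
  exact continuousOn_const.add ((((continuous_adjoint.comp_continuousOn hD).mul hD).sub
    continuousOn_const).mul (continuous_tanProj R).continuousOn)

theorem norm_gramOp_sub_le {n : ℕ} {M M' P : Eucl n →L[ℝ] Eucl n} (hM : ‖M‖ ≤ 2) (hM' : ‖M'‖ ≤ 2)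
    (hP : ‖P‖ ≤ 2) : ‖gramOp (ContinuousLinearMap.adjoint M) M P -
      gramOp (ContinuousLinearMap.adjoint M') M' P‖ ≤ 8 * ‖M - M'‖ := by
  have h1 : gramOp (ContinuousLinearMap.adjoint M) M P -
      gramOp (ContinuousLinearMap.adjoint M') M' P =
      (ContinuousLinearMap.adjoint M * (M - M') +
        ContinuousLinearMap.adjoint (M - M') * M') * P := by
    rw [gramOp, gramOp, map_sub]
    noncomm_ring
  have hn : ∀ T : Eucl n →L[ℝ] Eucl n, ‖ContinuousLinearMap.adjoint T‖ = ‖T‖ :=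
    fun T => LinearIsometryEquiv.norm_map _ T
  rw [h1]
  calc _ ≤ (‖ContinuousLinearMap.adjoint M‖ * ‖M - M'‖ +
        ‖ContinuousLinearMap.adjoint (M - M')‖ * ‖M'‖) * ‖P‖ :=
        (norm_mul_le _ _).trans (mul_le_mul_of_nonneg_right
          ((norm_add_le _ _).trans (add_le_add (norm_mul_le _ _) (norm_mul_le _ _)))
          (norm_nonneg _))
    _ ≤ (2 * ‖M - M'‖ + ‖M - M'‖ * 2) * 2 := by
        rw [hn, hn]
        gcongr
    _ = 8 * ‖M - M'‖ := by ring

/-- From a, b ≥ 1/4 it follows that √a + √b ≥ 1. -/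
theorem abs_sqrt_sub_sqrt_le {a b : ℝ} (ha : 1 / 4 ≤ a) (hb : 1 / 4 ≤ b) :
    |√a - √b| ≤ |a - b| := by
  have ha' : 1 / 2 ≤ √a := Real.le_sqrt_of_sq_le (by norm_num; linarith)
  have hb' : 1 / 2 ≤ √b := Real.le_sqrt_of_sq_le (by norm_num; linarith)
  have h : a - b = (√a + √b) * (√a - √b) := by
    nlinarith [Real.sq_sqrt (by linarith : 0 ≤ a), Real.sq_sqrt (by linarith : 0 ≤ b)]
  rw [h, abs_mul, abs_of_nonneg (by linarith : 0 ≤ √a + √b)]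
  exact le_mul_of_one_le_left (abs_nonneg _) (by linarith)

/-- Near the identity, the square root of the Gram determinant is Lipschitz, uniformly in `P`. -/
theorem exists_lipschitz_sqrt_gramOp (n : ℕ) : ∃ C > 0, ∃ δ > 0,
    ∀ M M' P : Eucl n →L[ℝ] Eucl n, ‖M - 1‖ ≤ δ → ‖M' - 1‖ ≤ δ → ‖P‖ ≤ 2 →
      |√((gramOp (ContinuousLinearMap.adjoint M) M P).det) -
        √((gramOp (ContinuousLinearMap.adjoint M') M' P).det)| ≤ C * ‖M - M'‖ := by
  obtain ⟨L, hL⟩ := LocallyLipschitzOn.exists_lipschitzOnWith_of_compact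
    (isCompact_closedBall (0 : Eucl n →L[ℝ] Eucl n) 9)
    ((contDiff_det (n := n) (k := 1)).locallyLipschitz.locallyLipschitzOn)
  have hone : ‖(1 : Eucl n →L[ℝ] Eucl n)‖ ≤ 1 := ContinuousLinearMap.norm_id_le
  have hg1 : ∀ P : Eucl n →L[ℝ] Eucl n, gramOp (ContinuousLinearMap.adjoint 1) 1 P = 1 :=
    fun P => by
      rw [show ContinuousLinearMap.adjoint (1 : Eucl n →L[ℝ] Eucl n) = 1 from
        ContinuousLinearMap.adjoint_id, gramOp, mul_one, sub_self,
        zero_mul, add_zero]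
  -- Gram operators lie within 8δ of the identity. The bound δ ≤ 1 keeps them in the ball of radius
  -- 9 on which det is L-Lipschitz, and 8Lδ ≤ 1/2 keeps their determinants above 1/4.
  set δ : ℝ := min 1 (1 / (16 * (L + 1))) with hδ
  have hL0 : (0 : ℝ) ≤ L := L.2
  have hδ0 : 0 < δ := by positivity
  have hδ1 : δ ≤ 1 := min_le_left _ _
  have hδ2 : L * (8 * δ) ≤ 1 / 2 := by
    have : δ ≤ 1 / (16 * (L + 1)) := min_le_right _ _
    rw [le_div_iff₀ (by positivity)] at this
    nlinarith
  have hnorm : ∀ M : Eucl n →L[ℝ] Eucl n, ‖M - 1‖ ≤ δ → ‖M‖ ≤ 2 := fun M hM => by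
    have := norm_le_norm_sub_add M 1
    linarith
  have hdist : ∀ M P : Eucl n →L[ℝ] Eucl n, ‖M - 1‖ ≤ δ → ‖P‖ ≤ 2 →
      ‖gramOp (ContinuousLinearMap.adjoint M) M P - 1‖ ≤ 8 * δ := fun M P hM hP => by
    have := norm_gramOp_sub_le (hnorm M hM) (by linarith : ‖(1 : Eucl n →L[ℝ] Eucl n)‖ ≤ 2) hP
    rw [hg1] at this
    linarith
  have hball : ∀ M P : Eucl n →L[ℝ] Eucl n, ‖M - 1‖ ≤ δ → ‖P‖ ≤ 2 →
      gramOp (ContinuousLinearMap.adjoint M) M P ∈ closedBall (0 : Eucl n →L[ℝ] Eucl n) 9 :=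
    fun M P hM hP => by
      rw [mem_closedBall_zero_iff]
      have := norm_le_norm_sub_add (gramOp (ContinuousLinearMap.adjoint M) M P) 1
      have := hdist M P hM hP
      linarith
  have hdet : ∀ M P : Eucl n →L[ℝ] Eucl n, ‖M - 1‖ ≤ δ → ‖P‖ ≤ 2 →
      1 / 4 ≤ (gramOp (ContinuousLinearMap.adjoint M) M P).det := fun M P hM hP => by
    have h1 := hL.norm_sub_le (hball M P hM hP)
      (by rw [mem_closedBall_zero_iff]; linarith : (1 : Eucl n →L[ℝ] Eucl n) ∈ closedBall 0 9)
    rw [det_one', Real.norm_eq_abs] at h1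
    have h2 := mul_le_mul_of_nonneg_left (hdist M P hM hP) hL0
    have h3 := (abs_le.1 (h1.trans (h2.trans hδ2))).1
    linarith
  -- The summand 1 only makes the constant positive when L = 0.
  refine ⟨8 * L + 1, by positivity, δ, hδ0, fun M M' P hM hM' hP => ?_⟩
  refine (abs_sqrt_sub_sqrt_le (hdet M P hM hP) (hdet M' P hM' hP)).trans ?_
  have h1 := hL.norm_sub_le (hball M P hM hP) (hball M' P hM' hP)
  rw [Real.norm_eq_abs] at h1
  have h2 := mul_le_mul_of_nonneg_left (norm_gramOp_sub_le (hnorm M hM) (hnorm M' hM') hP) hL0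
  nlinarith [norm_nonneg (M - M')]

theorem norm_tanProj_le {n : ℕ} {R : ℝ} (hR : 0 < R) {x : Eucl n}
    (hx : x ∈ sphere (0 : Eucl n) R) : ‖tanProj R x‖ ≤ 2 := by
  have hx' : ‖x‖ = R := by simpa using hx
  have h1 : ‖(R ^ 2)⁻¹ • InnerProductSpace.rankOne ℝ x x‖ = 1 := by
    rw [norm_smul, InnerProductSpace.norm_rankOne, hx', Real.norm_of_nonneg (by positivity)]
    field_simp
  have h2 : ‖(1 : Eucl n →L[ℝ] Eucl n)‖ ≤ 1 := ContinuousLinearMap.norm_id_le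
  have := norm_sub_le (1 : Eucl n →L[ℝ] Eucl n) ((R ^ 2)⁻¹ • InnerProductSpace.rankOne ℝ x x)
  rw [tanProj]
  linarith

theorem contDiffOn_perturbation {n : ℕ} {s : Set (Eucl n)} {v w : Eucl n → Eucl n}
    {r : ℝ → Eucl n → Eucl n} (hv : ContDiffOn ℝ 2 v s) (hw : ContDiffOn ℝ 2 w s) {t : ℝ}
    (hr : ContDiffOn ℝ 1 (r t) s) : ContDiffOn ℝ 1 (perturbation v w r t) s := by
  have h1 : ContDiffOn ℝ 1 v s := hv.of_le one_le_two
  have h2 : ContDiffOn ℝ 1 w s := hw.of_le one_le_two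
  have h3 : ContDiffOn ℝ 1 (fun x => r t x) s := hr
  show ContDiffOn ℝ 1 (fun x => x + t • v x + (t ^ 2 / 2) • w x + r t x) s
  fun_prop

/-- The remainder changes the surface area only by `o(t²)`. -/
theorem surfaceArea_sub_isLittleO {n : ℕ} {R : ℝ} (hR : 0 < R) {v w : Eucl n → Eucl n}
    {r : ℝ → Eucl n → Eucl n} (hv : ContDiffOn ℝ 2 v (closedBall 0 R))
    (hw : ContDiffOn ℝ 2 w (closedBall 0 R)) (hr : IsRemainder R r) :
    (fun t => surfaceArea R (perturbation v w r) t - surfaceArea R (perturbation v w 0) t)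
      =o[𝓝 0] fun t => t ^ 2 := by
  obtain ⟨C, hC, δ, hδ, hlip⟩ := exists_lipschitz_sqrt_gramOp n
  have hA : ContinuousOn (fderivWithin ℝ v (closedBall 0 R)) (closedBall 0 R) :=
    hv.continuousOn_fderivWithin (uniqueDiffOn_closedBall hR) one_le_two
  have hB : ContinuousOn (fderivWithin ℝ w (closedBall 0 R)) (closedBall 0 R) :=
    hw.continuousOn_fderivWithin (uniqueDiffOn_closedBall hR) one_le_two
  obtain ⟨a, ha⟩ := (isCompact_closedBall (0 : Eucl n) R).exists_bound_of_continuousOn hA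
  obtain ⟨b, hb⟩ := (isCompact_closedBall (0 : Eucl n) R).exists_bound_of_continuousOn hB
  have hlim : ∀ᶠ t in 𝓝 (0 : ℝ), |t| * a + t ^ 2 / 2 * b + t ^ 2 < δ ∧
      |t| * a + t ^ 2 / 2 * b < δ := by
    have h1 : Filter.Tendsto (fun t : ℝ => |t| * a + t ^ 2 / 2 * b + t ^ 2) (𝓝 0) (𝓝 0) := by
      have : Continuous fun t : ℝ => |t| * a + t ^ 2 / 2 * b + t ^ 2 := by fun_prop
      simpa using this.tendsto 0
    have h2 : Filter.Tendsto (fun t : ℝ => |t| * a + t ^ 2 / 2 * b) (𝓝 0) (𝓝 0) := by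
      have : Continuous fun t : ℝ => |t| * a + t ^ 2 / 2 * b := by fun_prop
      simpa using this.tendsto 0
    exact (h1.eventually_lt_const hδ).and (h2.eventually_lt_const hδ)
  rw [isLittleO_iff]
  intro c hc
  set K := (surfaceMeasure n R).real Set.univ with hK
  have hK0 : 0 ≤ K := measureReal_nonneg
  -- Chosen so that the pointwise bound Cεt² integrates over total mass K to at most ct²; K + 1
  -- avoids dividing by zero.
  set ε := c / (C * (K + 1)) with hε
  have hε0 : 0 < ε := by positivity
  -- Smallness is used twice: with `ε` for the estimate itself, and with constant 1 to keep the
  -- perturbed differential within `δ` of the identity.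
  filter_upwards [hr.contDiffOn, hr.small ε hε0, hr.small 1 one_pos, hlim] with t hrt hsm hsm1 hl
  have hrt0 := contDiffOn_perturbation hv hw hrt
  have hrt1 : ContDiffOn ℝ 1 (perturbation v w 0 t) (closedBall 0 R) :=
    contDiffOn_perturbation hv hw (r := 0) contDiffOn_const
  rw [surfaceArea, surfaceArea, ← integral_sub
    (integrable_surface hR (continuousOn_surfaceFactor hR hrt0))
    (integrable_surface hR (continuousOn_surfaceFactor hR hrt1))]
  have hbound : ∀ᵐ x ∂(surfaceMeasure n R), ‖surfaceFactor R (perturbation v w r t) x -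
      surfaceFactor R (perturbation v w 0 t) x‖ ≤ C * (ε * t ^ 2) := by
    filter_upwards [ae_mem_sphere hR] with x hx
    have hx' := sphere_subset_closedBall hx
    set A := fderivWithin ℝ v (closedBall 0 R) x
    set B := fderivWithin ℝ w (closedBall 0 R) x
    set D := fderivWithin ℝ (r t) (closedBall 0 R) x
    have h1 : ‖t • A + (t ^ 2 / 2) • B‖ ≤ |t| * a + t ^ 2 / 2 * b := by
      refine (norm_add_le _ _).trans ?_
      rw [norm_smul, norm_smul, Real.norm_eq_abs, Real.norm_of_nonneg (by positivity)]
      gcongr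
      · exact ha x hx'
      · exact hb x hx'
    rw [surfaceFactor_eq hx, surfaceFactor_eq hx, fderivWithin_perturbation hR hv hw hrt hx',
      fderivWithin_perturbation_zero hR hv hw t hx', Real.norm_eq_abs]
    refine (hlip _ _ _ ?_ ?_ (norm_tanProj_le hR hx)).trans ?_
    · have : 1 + t • A + (t ^ 2 / 2) • B + D - 1 = (t • A + (t ^ 2 / 2) • B) + D := by abel
      rw [this]
      have := (hsm1 x hx').2
      refine (norm_add_le _ _).trans ?_
      linarith [hl.1]
    · have : 1 + t • A + (t ^ 2 / 2) • B - 1 = t • A + (t ^ 2 / 2) • B := by abel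
      rw [this]
      linarith [hl.2]
    · rw [add_sub_cancel_left]
      exact mul_le_mul_of_nonneg_left (hsm x hx').2 hC.le
  refine (norm_integral_le_of_norm_le_const hbound).trans ?_
  rw [Real.norm_of_nonneg (sq_nonneg t)]
  calc C * (ε * t ^ 2) * K ≤ C * (ε * t ^ 2) * (K + 1) := by gcongr; linarith
    _ = c * t ^ 2 := by rw [hε]; field_simp

/-! ### Existence of the second variation -/

theorem taylor_two_isLittleO {S : ℝ → ℝ} (hS : ContDiffAt ℝ 2 S 0) :
    (fun t => S t - S 0 - t * deriv S 0 - t ^ 2 / 2 * iteratedDeriv 2 S 0)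
      =o[𝓝 0] fun t => t ^ 2 := by
  obtain ⟨u, hu, hSu⟩ := hS.contDiffOn le_rfl (by simp)
  obtain ⟨δ, hδ, hδu⟩ := Metric.mem_nhds_iff.1 (by simpa using hu : u ∈ 𝓝 (0 : ℝ))
  have h0 : (0 : ℝ) ∈ ball (0 : ℝ) δ := mem_ball_self hδ
  have h := taylor_isLittleO (n := 2) (convex_ball (0 : ℝ) δ) h0 (hSu.mono hδu)
  rw [isOpen_ball.nhdsWithin_eq h0] at h
  refine h.congr (fun t => ?_) (fun t => by rw [sub_zero])
  have h1 : iteratedDerivWithin 1 S (ball 0 δ) 0 = deriv S 0 := by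
    rw [iteratedDerivWithin_of_isOpen isOpen_ball h0, iteratedDeriv_one]
  have h2 := iteratedDerivWithin_of_isOpen (n := 2) (f := S) isOpen_ball h0
  rw [taylor_within_apply]
  simp only [Finset.sum_range_succ, Finset.sum_range_zero, h1, h2, iteratedDerivWithin_zero,
    sub_zero, smul_eq_mul]
  simp
  ring

theorem hasSecondVariation_perturbation {n : ℕ} {R : ℝ} (hR : 0 < R) {v w : Eucl n → Eucl n}
    {r : ℝ → Eucl n → Eucl n} (hv : ContDiffOn ℝ 2 v (closedBall 0 R))
    (hw : ContDiffOn ℝ 2 w (closedBall 0 R)) (hr : IsRemainder R r) :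
    HasSecondVariation (surfaceArea R (perturbation v w r))
      (iteratedDeriv 2 (surfaceArea R (perturbation v w 0)) 0) := by
  set S := surfaceArea R (perturbation v w r)
  set S₀ := surfaceArea R (perturbation v w 0)
  have hS₀ : ContDiffAt ℝ 2 S₀ 0 := (surfaceArea_contDiffAt hR hv hw).1
  have hd : (fun t => S t - S₀ t) =o[𝓝 0] fun t => t ^ 2 :=
    surfaceArea_sub_isLittleO hR hv hw hr
  -- A bound by t² near 0 also holds at t = 0, where it forces equality.
  have h0 : S 0 = S₀ 0 := by
    have := (isLittleO_iff.1 hd one_pos).self_of_nhds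
    simpa [sub_eq_zero] using this
  have hder : HasDerivAt S (deriv S₀ 0) 0 := by
    have h1 : HasDerivAt S₀ (deriv S₀ 0) 0 := (hS₀.differentiableAt two_ne_zero).hasDerivAt
    have h2 : HasDerivAt (fun t => S t - S₀ t) 0 0 := by
      rw [hasDerivAt_iff_isLittleO]
      have h3 : (fun t : ℝ => t ^ 2) =O[𝓝 0] fun t : ℝ => t := by
        simpa using (isLittleO_pow_pow (𝕜 := ℝ) one_lt_two).isBigO
      simpa [h0] using hd.trans_isBigO h3
    have h3 := h1.add h2
    rw [add_zero] at h3
    exact h3.congr_of_eventuallyEq (.of_forall fun t => (add_sub_cancel (S₀ t) (S t)).symm)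
  refine ⟨hder.differentiableAt, ?_⟩
  rw [hder.deriv, h0]
  refine ((taylor_two_isLittleO hS₀).add hd).congr_left fun t => ?_
  ring

/-! ### The vector fields behind the second variation -/

theorem sum_apply_basis {n : ℕ} (L : Eucl n →L[ℝ] ℝ) (u : Eucl n) :
    ∑ i, L (EuclideanSpace.basisFun (Fin n) ℝ i) * ⟪EuclideanSpace.basisFun (Fin n) ℝ i, u⟫_ℝ =
      L u := by
  conv_rhs => rw [← (EuclideanSpace.basisFun (Fin n) ℝ).sum_repr' u, map_sum]
  exact Finset.sum_congr rfl fun i _ => by rw [map_smul, smul_eq_mul, mul_comm]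

/-- The field `tr (Dv Q) v - Dv Q v` attached to a vector field `v` and a field `Q` of
endomorphisms. -/
noncomputable def traceField {n : ℕ} (R : ℝ) (v : Eucl n → Eucl n)
    (Q : Eucl n → Eucl n →L[ℝ] Eucl n) (x : Eucl n) : Eucl n :=
  tr (fderivWithin ℝ v (closedBall 0 R) x * Q x) • v x -
    fderivWithin ℝ v (closedBall 0 R) x (Q x (v x))

theorem contDiffOn_traceField {n : ℕ} {R : ℝ} (hR : 0 < R) {v : Eucl n → Eucl n}
    (hv : ContDiffOn ℝ 2 v (closedBall 0 R)) {Q : Eucl n → Eucl n →L[ℝ] Eucl n}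
    (hQ : ContDiff ℝ 1 Q) : ContDiffOn ℝ 1 (traceField R v Q) (closedBall 0 R) := by
  have hA : ContDiffOn ℝ 1 (fderivWithin ℝ v (closedBall 0 R)) (closedBall 0 R) :=
    hv.fderivWithin (uniqueDiffOn_closedBall hR) (by norm_num)
  have hv1 : ContDiffOn ℝ 1 v (closedBall 0 R) := hv.of_le one_le_two
  have hAQ : ContDiffOn ℝ 1 (fun x => fderivWithin ℝ v (closedBall 0 R) x * Q x)
    (closedBall 0 R) := hA.mul hQ.contDiffOn
  have htr : ContDiffOn ℝ 1 (fun x => trL n (fderivWithin ℝ v (closedBall 0 R) x * Q x))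
    (closedBall 0 R) := (trL n).contDiff.comp_contDiffOn hAQ
  exact (htr.smul hv1).sub (hA.clm_apply (hQ.contDiffOn.clm_apply hv1))

/-- The second derivatives of `v` occur twice, as tr(D²v(Qv, Q ·)) with opposite signs, and cancel
by symmetry; derivatives of `Q` survive. For `Q` = 1 this yields the volume integrand, for `Q` = P
the surface integrand. -/
theorem tr_fderivWithin_traceField {n : ℕ} {R : ℝ} (hR : 0 < R) {v : Eucl n → Eucl n}
    (hv : ContDiffOn ℝ 2 v (closedBall 0 R)) {Q : Eucl n → Eucl n →L[ℝ] Eucl n}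
    {x : Eucl n} (hx : x ∈ closedBall (0 : Eucl n) R)
    {Q' : Eucl n →L[ℝ] Eucl n →L[ℝ] Eucl n} (hQ : HasFDerivAt Q Q' x) :
    tr (fderivWithin ℝ (traceField R v Q) (closedBall 0 R) x * Q x) =
      tr (fderivWithin ℝ v (closedBall 0 R) x * Q x) ^ 2 -
      tr (fderivWithin ℝ v (closedBall 0 R) x * Q x *
        (fderivWithin ℝ v (closedBall 0 R) x * Q x)) +
      tr (fderivWithin ℝ v (closedBall 0 R) x * Q' (Q x (v x))) -
      ∑ i, ⟪EuclideanSpace.basisFun (Fin n) ℝ i, fderivWithin ℝ v (closedBall 0 R) x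
        (Q' (Q x (EuclideanSpace.basisFun (Fin n) ℝ i)) (v x))⟫_ℝ := by
  have hu := uniqueDiffOn_closedBall (n := n) hR
  have hA1 : ContDiffOn ℝ 1 (fderivWithin ℝ v (closedBall 0 R)) (closedBall 0 R) :=
    hv.fderivWithin hu (by norm_num)
  have hA := (hA1.differentiableOn one_ne_zero x hx).hasFDerivWithinAt
  have hvd := (hv.differentiableOn two_ne_zero x hx).hasFDerivWithinAt
  -- Symmetry holds at boundary points too, because the closed ball is the closure of its interior.
  have hsym : IsSymmSndFDerivWithinAt ℝ v (closedBall 0 R) x := by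
    refine (hv x hx).isSymmSndFDerivWithinAt (by simp) hu ?_ hx
    rwa [interior_closedBall _ hR.ne', closure_ball _ hR.ne']
  set A := fderivWithin ℝ v (closedBall 0 R) x with hAdef
  set A2 := fderivWithin ℝ (fderivWithin ℝ v (closedBall 0 R)) (closedBall 0 R) x with hA2
  have hQw := hQ.hasFDerivWithinAt (s := closedBall 0 R)
  have hprod := hA.mul' hQw
  have htr := (trL n).hasFDerivAt.comp_hasFDerivWithinAt x hprod
  have hfield : HasFDerivWithinAt (traceField R v Q) _ (closedBall 0 R) x :=
    (htr.smul hvd).sub (hA.clm_apply (hQw.clm_apply hvd))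
  have hD : ∀ h, fderivWithin ℝ (traceField R v Q) (closedBall 0 R) x h =
      tr (A * Q x) • A h + (tr (A * Q' h) + tr (A2 h * Q x)) • v x -
        (A (Q x (A h)) + A (Q' h (v x)) + A2 h (Q x (v x))) := fun h => by
    rw [hfield.fderivWithin (hu x hx)]
    simp [trL_apply]
    rfl
  have hsw : ∀ h k, A2 h k = A2 k h := fun h k => hsym h k
  rw [tr_eq_sum]
  simp only [mul_apply_eq_comp, hD, inner_sub_right, inner_add_right, inner_smul_right]
  rw [Finset.sum_sub_distrib, Finset.sum_add_distrib, Finset.sum_add_distrib,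
    Finset.sum_add_distrib, ← Finset.mul_sum]
  have e1 : ∑ i, ⟪EuclideanSpace.basisFun (Fin n) ℝ i,
      A (Q x (EuclideanSpace.basisFun (Fin n) ℝ i))⟫_ℝ = tr (A * Q x) := by
    rw [tr_eq_sum]; rfl
  have e2 : ∑ i, ⟪EuclideanSpace.basisFun (Fin n) ℝ i,
      A (Q x (A (Q x (EuclideanSpace.basisFun (Fin n) ℝ i))))⟫_ℝ =
        tr (A * Q x * (A * Q x)) := by
    rw [tr_eq_sum]; rfl
  have e3 : ∑ i, ⟪EuclideanSpace.basisFun (Fin n) ℝ i,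
      A2 (Q x (EuclideanSpace.basisFun (Fin n) ℝ i)) (Q x (v x))⟫_ℝ =
        tr (A2 (Q x (v x)) * Q x) := by
    rw [tr_eq_sum]
    exact Finset.sum_congr rfl fun i _ => by rw [hsw]; rfl
  -- The sum Σ L(eᵢ)⟪eᵢ, v⟫ collapses to L(v), whose second summand cancels against `e3`.
  let L : Eucl n →L[ℝ] ℝ := LinearMap.toContinuousLinearMap
    { toFun := fun h => tr (A * Q' (Q x h)) + tr (A2 (Q x h) * Q x)
      map_add' := fun h k => by simp only [map_add, mul_add, add_mul, tr_add]; ring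
      map_smul' := fun c h => by
        have f1 : A * Q' (Q x (c • h)) = c • (A * Q' (Q x h)) := by
          rw [map_smul, map_smul]; exact ContinuousLinearMap.ext fun b => map_smul A c _
        have f2 : A2 (Q x (c • h)) * Q x = c • (A2 (Q x h) * Q x) := by
          rw [map_smul, map_smul]; rfl
        rw [f1, f2, tr_smul, tr_smul, ← mul_add]; rfl }
  have e4 := sum_apply_basis L (v x)
  have hL : ∀ h, L h = tr (A * Q' (Q x h)) + tr (A2 (Q x h) * Q x) := fun h => rfl
  simp only [hL] at e4
  rw [e1, e2, e3, e4]
  ring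

theorem contDiff_normal {n : ℕ} {k : WithTop ℕ∞} (R : ℝ) : ContDiff ℝ k (normal (n := n) R) :=
  contDiff_id.const_smul R⁻¹

theorem contDiffOn_normalComponent {n : ℕ} {R : ℝ} {k : WithTop ℕ∞} {s : Set (Eucl n)}
    {v : Eucl n → Eucl n} (hv : ContDiffOn ℝ k v s) :
    ContDiffOn ℝ k (normalComponent R v) s :=
  hv.inner ℝ (contDiff_normal R).contDiffOn

theorem fderivWithin_normalComponent {n : ℕ} {R : ℝ} (hR : 0 < R) {v : Eucl n → Eucl n}
    {x : Eucl n} (hx : x ∈ closedBall (0 : Eucl n) R)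
    (hv : DifferentiableWithinAt ℝ v (closedBall 0 R) x) (h : Eucl n) :
    fderivWithin ℝ (normalComponent R v) (closedBall 0 R) x h =
      ⟪fderivWithin ℝ v (closedBall 0 R) x h, normal R x⟫_ℝ + R⁻¹ * ⟪v x, h⟫_ℝ := by
  have h2 : HasFDerivWithinAt (normal (n := n) R) (R⁻¹ • ContinuousLinearMap.id ℝ (Eucl n))
      (closedBall 0 R) x := ((hasFDerivAt_id x).const_smul R⁻¹).hasFDerivWithinAt
  have h3 : HasFDerivWithinAt (normalComponent R v) _ (closedBall 0 R) x :=
    hv.hasFDerivWithinAt.inner ℝ h2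
  rw [h3.fderivWithin (uniqueDiffOn_closedBall hR x hx)]
  simp [real_inner_smul_right]
  ring

theorem tangentialGradient_eq {n : ℕ} (R : ℝ) (f : Eucl n → ℝ) (x : Eucl n) :
    tangentialGradient R f x = tanProj R x (gradientWithin f (closedBall 0 R) x) := by
  rw [tangentialGradient, tanProj_apply, normal, real_inner_smul_right, smul_smul,
    real_inner_comm x]
  congr 2
  ring

theorem inner_gradientWithin {n : ℕ} {s : Set (Eucl n)} (f : Eucl n → ℝ) (x h : Eucl n) :
    ⟪gradientWithin f s x, h⟫_ℝ = fderivWithin ℝ f s x h :=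
  inner_gradientWithin_left

theorem inner_tanProj_left {n : ℕ} (R : ℝ) (x a b : Eucl n) :
    ⟪tanProj R x a, b⟫_ℝ = ⟪a, tanProj R x b⟫_ℝ := by
  conv_rhs => rw [← ContinuousLinearMap.adjoint_inner_left, adjoint_tanProj]

/-- The term v/R comes from the derivative 1/R of the normal field. -/
theorem gradientWithin_normalComponent {n : ℕ} {R : ℝ} (hR : 0 < R) {v : Eucl n → Eucl n}
    {x : Eucl n} (hx : x ∈ closedBall (0 : Eucl n) R)
    (hv : DifferentiableWithinAt ℝ v (closedBall 0 R) x) :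
    gradientWithin (normalComponent R v) (closedBall 0 R) x =
      ContinuousLinearMap.adjoint (fderivWithin ℝ v (closedBall 0 R) x) (normal R x) +
        R⁻¹ • v x := by
  refine ext_inner_right ℝ fun h => ?_
  rw [inner_gradientWithin, fderivWithin_normalComponent hR hx hv, inner_add_left,
    ContinuousLinearMap.adjoint_inner_left, real_inner_smul_left, real_inner_comm (normal R x)]

/-- The integrand `N div_τ v - ν · Dv P v`. -/
noncomputable def divTerm {n : ℕ} (R : ℝ) (v : Eucl n → Eucl n) (x : Eucl n) : ℝ :=
  normalComponent R v x * tr (fderivWithin ℝ v (closedBall 0 R) x * tanProj R x) -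
    ⟪fderivWithin ℝ v (closedBall 0 R) x (tanProj R x (v x)), normal R x⟫_ℝ

theorem contDiff_tanProj {n : ℕ} {k : WithTop ℕ∞} (R : ℝ) : ContDiff ℝ k (tanProj (n := n) R) := by
  unfold tanProj
  simp_rw [InnerProductSpace.rankOne_def]
  have : ContDiff ℝ k fun x : Eucl n => innerSL ℝ x := (innerSL ℝ).contDiff
  fun_prop

/-- The derivative of `x ↦ tanProj R x`. -/
noncomputable def tanProjDeriv {n : ℕ} (R : ℝ) (x : Eucl n) :
    Eucl n →L[ℝ] Eucl n →L[ℝ] Eucl n :=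
  fderiv ℝ (tanProj R) x

theorem tanProjDeriv_apply {n : ℕ} (R : ℝ) (x h y : Eucl n) :
    tanProjDeriv R x h y = -((R ^ 2)⁻¹ * ⟪x, y⟫_ℝ) • h - ((R ^ 2)⁻¹ * ⟪h, y⟫_ℝ) • x := by
  have h1 : HasFDerivAt (tanProj (n := n) R) (tanProjDeriv R x) x :=
    ((contDiff_tanProj (k := 1) R).differentiable one_ne_zero x).hasFDerivAt
  have h2 := h1.clm_apply (hasFDerivAt_const y x)
  have hin : HasFDerivAt (fun z : Eucl n => ⟪z, y⟫_ℝ) (innerSL ℝ y) x := by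
    have h0 : HasFDerivAt (innerSL ℝ y : Eucl n →L[ℝ] ℝ) (innerSL ℝ y) x :=
      ContinuousLinearMap.hasFDerivAt _
    exact h0.congr_of_eventuallyEq (.of_forall fun z => by simp [real_inner_comm])
  have h3 := ((hin.const_mul (R ^ 2)⁻¹).fun_smul (hasFDerivAt_id x)).const_sub y
  have h4 := h2.unique (h3.congr_of_eventuallyEq (.of_forall fun z => tanProj_apply R z y))
  have h5 := congrArg (fun L => L h) h4
  simp at h5
  rw [h5, real_inner_comm h]
  module

theorem trace_rankOne' {n : ℕ} (a b : Eucl n) :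
    tr (InnerProductSpace.rankOne ℝ a b) = ⟪b, a⟫_ℝ := by
  rw [tr, InnerProductSpace.trace_rankOne]

/-- The derivative of P contributes the curvature term R⁻¹ J; the parts containing ⟪Pv, Ax⟫ cancel
between its two occurrences. -/
theorem tr_traceField_tanProj {n : ℕ} {R : ℝ} (hR : 0 < R) {v : Eucl n → Eucl n}
    (hv : ContDiffOn ℝ 2 v (closedBall 0 R)) {x : Eucl n} (hx : x ∈ sphere (0 : Eucl n) R) :
    tr (fderivWithin ℝ (traceField R v (tanProj R)) (closedBall 0 R) x * tanProj R x) =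
      tr (fderivWithin ℝ v (closedBall 0 R) x * tanProj R x) ^ 2 -
      tr (fderivWithin ℝ v (closedBall 0 R) x * tanProj R x *
        (fderivWithin ℝ v (closedBall 0 R) x * tanProj R x)) + R⁻¹ * divTerm R v x := by
  rw [tr_fderivWithin_traceField hR hv (sphere_subset_closedBall hx)
    ((contDiff_tanProj (k := 1) R).differentiable one_ne_zero x).hasFDerivAt]
  rw [← tanProjDeriv]
  set A := fderivWithin ℝ v (closedBall 0 R) x with hA
  set P := tanProj R x with hP
  have e1 : tr (A * tanProjDeriv R x (P (v x))) =
      -(R ^ 2)⁻¹ * (⟪x, A (P (v x))⟫_ℝ + ⟪P (v x), A x⟫_ℝ) := by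
    have : A * tanProjDeriv R x (P (v x)) =
        (-(R ^ 2)⁻¹) • (InnerProductSpace.rankOne ℝ (A (P (v x))) x +
          InnerProductSpace.rankOne ℝ (A x) (P (v x))) := by
      ext1 y
      simp [tanProjDeriv_apply, smul_smul]
      module
    rw [this, tr_smul, tr_add, trace_rankOne', trace_rankOne']
  have e2 : ∑ i, ⟪EuclideanSpace.basisFun (Fin n) ℝ i,
      A (tanProjDeriv R x (P (EuclideanSpace.basisFun (Fin n) ℝ i)) (v x))⟫_ℝ =
      -(R ^ 2)⁻¹ * (⟪x, v x⟫_ℝ * tr (A * P) + ⟪P (v x), A x⟫_ℝ) := by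
    rw [← trace_rankOne' (A x) (P (v x)), ← tr_smul, ← tr_add, ← tr_smul, tr_eq_sum]
    refine Finset.sum_congr rfl fun i _ => ?_
    congr 1
    simp only [tanProjDeriv_apply, smul_apply, add_apply, mul_apply_eq_comp,
      InnerProductSpace.rankOne_apply, map_sub, map_smul, hP, inner_tanProj_left, smul_add,
      smul_smul, real_inner_comm (v x)]
    module
  rw [e1, e2, divTerm, ← hA, ← hP, normalComponent, normal, real_inner_smul_right,
    real_inner_smul_right, real_inner_comm x (v x), real_inner_comm x (A (P (v x)))]
  ring

theorem inner_traceField_tanProj {n : ℕ} {R : ℝ} (v : Eucl n → Eucl n) (x : Eucl n) :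
    ⟪traceField R v (tanProj R) x, normal R x⟫_ℝ = divTerm R v x := by
  rw [traceField, inner_sub_left, real_inner_smul_left, divTerm, normalComponent, mul_comm]

/-- Passing from P to the identity adds N ⟪ν, Aν⟫ to both terms of the field's normal component, so
it drops out. This common normal component links the volume condition in the ball to the area on the
sphere. -/
theorem inner_traceField_one {n : ℕ} {R : ℝ} (v : Eucl n → Eucl n) (x : Eucl n) :
    ⟪traceField R v (fun _ => 1) x, normal R x⟫_ℝ = divTerm R v x := by
  set A := fderivWithin ℝ v (closedBall 0 R) x with hA
  have h1 : tr A = tr (A * tanProj R x) + ⟪normal R x, A (normal R x)⟫_ℝ := by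
    rw [← trace_rankOne', ← tr_add]
    congr 1
    have : A = A * tanProj R x + A * (1 - tanProj R x) := by
      rw [mul_sub, mul_one]; abel
    conv_lhs => rw [this, one_sub_tanProj]
    congr 1
    ext1 y
    simp
  have h2 : A (v x) = A (tanProj R x (v x)) + normalComponent R v x • A (normal R x) := by
    have h3 : v x = tanProj R x (v x) + (1 - tanProj R x) (v x) := by simp
    conv_lhs => rw [h3, one_sub_tanProj]
    simp [normalComponent, real_inner_comm]
  rw [traceField, ← hA, mul_one, inner_sub_left, real_inner_smul_left, divTerm, ← hA,
    show (1 : Eucl n →L[ℝ] Eucl n) (v x) = v x from rfl, h1, h2, inner_add_left,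
    real_inner_smul_left, real_inner_comm (normal R x) (A (normal R x)), normalComponent]
  ring

/-! ### Integration over the sphere -/

theorem integrable_surface_of_closedBall {n : ℕ} {R : ℝ} (hR : 0 < R) {E : Type*}
    [NormedAddCommGroup E] {f : Eucl n → E} (hf : ContinuousOn f (closedBall 0 R)) :
    Integrable f (surfaceMeasure n R) :=
  integrable_surface hR (hf.mono sphere_subset_closedBall)

theorem integral_normalComponent_eq_zero {n : ℕ} (hn : 2 ≤ n) {R : ℝ} (hR : 0 < R)
    {v w : Eucl n → Eucl n} (hv : ContDiffOn ℝ 1 v (closedBall 0 R))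
    (hvol : VolumePreserving R v w) :
    ∫ x, normalComponent R v x ∂(surfaceMeasure n R) = 0 := by
  unfold normalComponent
  rw [← integral_ball_div hn hR hv, ← hvol.first]
  refine setIntegral_congr_fun measurableSet_ball fun x hx => ?_
  simp only [tr, divergence]
  rw [fderivWithin_of_mem_nhds (Filter.mem_of_superset (isOpen_ball.mem_nhds hx)
    ball_subset_closedBall)]

/-- The integrand of the second volume condition is the divergence of (div v)v - (Dv)v + w, so the
condition becomes a statement about fluxes. -/
theorem integral_divTerm_add {n : ℕ} (hn : 2 ≤ n) {R : ℝ} (hR : 0 < R)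
    {v w : Eucl n → Eucl n} (hv : ContDiffOn ℝ 2 v (closedBall 0 R))
    (hw : ContDiffOn ℝ 2 w (closedBall 0 R)) (hvol : VolumePreserving R v w) :
    (∫ x, divTerm R v x ∂(surfaceMeasure n R)) +
      ∫ x, ⟪w x, normal R x⟫_ℝ ∂(surfaceMeasure n R) = 0 := by
  have hX : ContDiffOn ℝ 1 (traceField R v fun _ => 1) (closedBall 0 R) :=
    contDiffOn_traceField hR hv contDiff_const
  have hw1 : ContDiffOn ℝ 1 w (closedBall 0 R) := hw.of_le one_le_two
  have hint : ∀ {Y : Eucl n → Eucl n}, ContDiffOn ℝ 1 Y (closedBall 0 R) →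
      IntegrableOn (fun x => tr (fderivWithin ℝ Y (closedBall 0 R) x)) (ball 0 R) := fun hY =>
    ((continuous_tr.comp_continuousOn (hY.continuousOn_fderivWithin (uniqueDiffOn_closedBall hR)
      le_rfl)).integrableOn_compact (isCompact_closedBall 0 R)).mono_set ball_subset_closedBall
  simp_rw [← inner_traceField_one]
  rw [← integral_ball_div hn hR hX, ← integral_ball_div hn hR hw1,
    ← integral_add (hint hX) (hint hw1), ← hvol.second]
  refine setIntegral_congr_fun measurableSet_ball fun x hx => ?_
  have hnh : closedBall (0 : Eucl n) R ∈ 𝓝 x :=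
    Filter.mem_of_superset (isOpen_ball.mem_nhds hx) ball_subset_closedBall
  have h := tr_fderivWithin_traceField hR hv (ball_subset_closedBall hx)
    (hasFDerivAt_const (1 : Eucl n →L[ℝ] Eucl n) x)
  have h0 : tr (fderivWithin ℝ v (closedBall 0 R) x * (0 : Eucl n →L[ℝ] Eucl n)) = 0 := by
    simp [tr]
  simp only [mul_one, zero_apply, h0, map_zero, inner_zero_right,
    Finset.sum_const_zero, add_zero, sub_zero] at h
  simp only [h, divergence, jacobianSq]
  rw [← fderivWithin_of_mem_nhds hnh, ← fderivWithin_of_mem_nhds hnh]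
  rfl

/-- The product rule for the field Nv. Its integral supplies ∮N² and absorbs all remaining terms in
ν · APv and |Pv|². -/
theorem tr_fderivWithin_normalComponent_smul {n : ℕ} {R : ℝ} (hR : 0 < R) {v : Eucl n → Eucl n}
    (hv : ContDiffOn ℝ 1 v (closedBall 0 R)) {x : Eucl n} (hx : x ∈ sphere (0 : Eucl n) R) :
    tr (fderivWithin ℝ (fun y => normalComponent R v y • v y) (closedBall 0 R) x * tanProj R x) =
      divTerm R v x +
        2 * ⟪fderivWithin ℝ v (closedBall 0 R) x (tanProj R x (v x)), normal R x⟫_ℝ +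
        R⁻¹ * ‖tanProj R x (v x)‖ ^ 2 := by
  have hxc := sphere_subset_closedBall hx
  have hvd := hv.differentiableOn one_ne_zero x hxc
  have hNd := (contDiffOn_normalComponent (R := R) hv).differentiableOn one_ne_zero x hxc
  have h := (hNd.hasFDerivWithinAt.fun_smul hvd.hasFDerivWithinAt).fderivWithin
    (uniqueDiffOn_closedBall hR x hxc)
  have hp : ⟪v x, tanProj R x (v x)⟫_ℝ = ‖tanProj R x (v x)‖ ^ 2 := by
    rw [← real_inner_self_eq_norm_sq, inner_tanProj_left, ← mul_apply_eq_comp,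
      tanProj_mul_self hx]
  have h2 : fderivWithin ℝ (fun y => normalComponent R v y • v y) (closedBall 0 R) x *
      tanProj R x = normalComponent R v x • (fderivWithin ℝ v (closedBall 0 R) x * tanProj R x) +
      InnerProductSpace.rankOne ℝ (v x)
        (tanProj R x (gradientWithin (normalComponent R v) (closedBall 0 R) x)) := by
    rw [h]
    ext1 y
    simp [inner_tanProj_left]
  rw [h2, tr_add, tr_smul, trace_rankOne', inner_tanProj_left, inner_gradientWithin,
    fderivWithin_normalComponent hR hxc hvd, hp, divTerm]
  ring

/-- Expands the square of PA*ν = ∇^τ N - Pv/R. -/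
theorem norm_tanProj_adjoint_sq {n : ℕ} {R : ℝ} (hR : 0 < R) {v : Eucl n → Eucl n}
    (hv : ContDiffOn ℝ 1 v (closedBall 0 R)) {x : Eucl n} (hx : x ∈ sphere (0 : Eucl n) R) :
    ‖tanProj R x (ContinuousLinearMap.adjoint (fderivWithin ℝ v (closedBall 0 R) x)
        (normal R x))‖ ^ 2 =
      ‖tangentialGradient R (normalComponent R v) x‖ ^ 2 - 2 * R⁻¹ *
        ⟪fderivWithin ℝ v (closedBall 0 R) x (tanProj R x (v x)), normal R x⟫_ℝ -
        R⁻¹ ^ 2 * ‖tanProj R x (v x)‖ ^ 2 := by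
  have hxc := sphere_subset_closedBall hx
  have hPP : ∀ y, tanProj R x (tanProj R x y) = tanProj R x y := fun y => by
    rw [← mul_apply_eq_comp, tanProj_mul_self hx]
  rw [tangentialGradient_eq, gradientWithin_normalComponent hR hxc
    (hv.differentiableOn one_ne_zero x hxc), map_add, map_smul, norm_add_sq_real,
    real_inner_smul_right, inner_tanProj_left, hPP,
    ContinuousLinearMap.adjoint_inner_left, norm_smul, Real.norm_of_nonneg (by positivity),
    real_inner_comm (normal R x)]
  ring

theorem continuousOn_gradientWithin {n : ℕ} {R : ℝ} (hR : 0 < R) {f : Eucl n → ℝ}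
    (hf : ContDiffOn ℝ 1 f (closedBall 0 R)) :
    ContinuousOn (gradientWithin f (closedBall 0 R)) (closedBall 0 R) :=
  (LinearIsometryEquiv.continuous _).comp_continuousOn
    (hf.continuousOn_fderivWithin (uniqueDiffOn_closedBall hR) le_rfl)

theorem continuousOn_tangentialGradient {n : ℕ} {R : ℝ} (hR : 0 < R) {f : Eucl n → ℝ}
    (hf : ContDiffOn ℝ 1 f (closedBall 0 R)) :
    ContinuousOn (tangentialGradient R f) (closedBall 0 R) := by
  refine ContinuousOn.congr ?_ fun x _ => tangentialGradient_eq R f x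
  exact (continuous_tanProj R).continuousOn.clm_apply (continuousOn_gradientWithin hR hf)

theorem integral_accel {n : ℕ} (hn : 2 ≤ n) {R : ℝ} (hR : 0 < R)
    {v w : Eucl n → Eucl n} (hv : ContDiffOn ℝ 2 v (closedBall 0 R))
    (hw : ContDiffOn ℝ 2 w (closedBall 0 R)) (hvol : VolumePreserving R v w) :
    ∫ x, accel R v w x ∂(surfaceMeasure n R) = quadraticForm R (normalComponent R v) := by
  have hv1 : ContDiffOn ℝ 1 v (closedBall 0 R) := hv.of_le one_le_two
  have hw1 : ContDiffOn ℝ 1 w (closedBall 0 R) := hw.of_le one_le_two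
  have hN1 : ContDiffOn ℝ 1 (normalComponent R v) (closedBall 0 R) :=
    contDiffOn_normalComponent hv1
  have cP := (continuous_tanProj (n := n) R).continuousOn (s := closedBall 0 R)
  have cA := hv1.continuousOn_fderivWithin (uniqueDiffOn_closedBall hR) le_rfl
  have cB := hw1.continuousOn_fderivWithin (uniqueDiffOn_closedBall hR) le_rfl
  have cAP := cA.mul cP
  have cν := (contDiff_normal (n := n) (k := 1) R).continuous.continuousOn (s := closedBall 0 R)
  have cPv := cP.clm_apply hv1.continuousOn
  have cs : ContinuousOn (fun x => ⟪fderivWithin ℝ v (closedBall 0 R) x (tanProj R x (v x)),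
      normal R x⟫_ℝ) (closedBall 0 R) := (cA.clm_apply cPv).inner cν
  have ctr := continuous_tr.comp_continuousOn cAP
  have iT : Integrable (fun x => tr (fderivWithin ℝ v (closedBall 0 R) x * tanProj R x) ^ 2 -
      tr (fderivWithin ℝ v (closedBall 0 R) x * tanProj R x *
        (fderivWithin ℝ v (closedBall 0 R) x * tanProj R x))) (surfaceMeasure n R) :=
    integrable_surface_of_closedBall hR
      ((ctr.pow 2).sub (continuous_tr.comp_continuousOn (cAP.mul cAP)))
  have iJ : Integrable (divTerm R v) (surfaceMeasure n R) :=
    integrable_surface_of_closedBall hR ((hN1.continuousOn.mul ctr).sub cs)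
  have ib : Integrable (fun x => tr (fderivWithin ℝ w (closedBall 0 R) x * tanProj R x))
      (surfaceMeasure n R) :=
    integrable_surface_of_closedBall hR (continuous_tr.comp_continuousOn (cB.mul cP))
  have is : Integrable (fun x => ⟪fderivWithin ℝ v (closedBall 0 R) x (tanProj R x (v x)),
      normal R x⟫_ℝ) (surfaceMeasure n R) := integrable_surface_of_closedBall hR cs
  have ip : Integrable (fun x => ‖tanProj R x (v x)‖ ^ 2) (surfaceMeasure n R) :=
    integrable_surface_of_closedBall hR (cPv.norm.pow 2)
  have ig : Integrable (fun x => ‖tangentialGradient R (normalComponent R v) x‖ ^ 2)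
      (surfaceMeasure n R) :=
    integrable_surface_of_closedBall hR ((continuousOn_tangentialGradient hR hN1).norm.pow 2)
  have iJs : Integrable (fun x => divTerm R v x +
      2 * ⟪fderivWithin ℝ v (closedBall 0 R) x (tanProj R x (v x)),
      normal R x⟫_ℝ)
      (surfaceMeasure n R) := iJ.add (is.const_mul 2)
  have iTb : Integrable (fun x => tr (fderivWithin ℝ v (closedBall 0 R) x * tanProj R x) ^ 2 -
      tr (fderivWithin ℝ v (closedBall 0 R) x * tanProj R x *
        (fderivWithin ℝ v (closedBall 0 R) x * tanProj R x)) +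
      tr (fderivWithin ℝ w (closedBall 0 R) x * tanProj R x)) (surfaceMeasure n R) := iT.add ib
  have igs : Integrable (fun x => ‖tangentialGradient R (normalComponent R v) x‖ ^ 2 -
      2 * R⁻¹ * ⟪fderivWithin ℝ v (closedBall 0 R) x (tanProj R x (v x)),
      normal R x⟫_ℝ) (surfaceMeasure n R) := ig.sub (is.const_mul _)
  have igp : Integrable (fun x => ‖tangentialGradient R (normalComponent R v) x‖ ^ 2 -
      2 * R⁻¹ * ⟪fderivWithin ℝ v (closedBall 0 R) x (tanProj R x (v x)),
      normal R x⟫_ℝ - R⁻¹ ^ 2 * ‖tanProj R x (v x)‖ ^ 2) (surfaceMeasure n R) :=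
    igs.sub (ip.const_mul _)
  have I1 := integral_surface_div hn hR hw1
  have I2 := integral_surface_div hn hR
    (contDiffOn_traceField hR hv (contDiff_tanProj (k := 1) R))
  rw [integral_surface_congr hR fun x hx => tr_traceField_tanProj hR hv hx,
    integral_add iT (iJ.const_mul _), integral_const_mul] at I2
  simp_rw [inner_traceField_tanProj] at I2
  have I3 := integral_divTerm_add hn hR hv hw hvol
  have I4 := integral_surface_div (X := fun y => normalComponent R v y • v y) hn hR (hN1.smul hv1)
  rw [integral_surface_congr hR fun x hx => tr_fderivWithin_normalComponent_smul hR hv1 hx,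
    integral_add iJs (ip.const_mul _),
    integral_add iJ (is.const_mul 2), integral_const_mul, integral_const_mul] at I4
  have hNN : ∀ x, ⟪normalComponent R v x • v x, normal R x⟫_ℝ = normalComponent R v x ^ 2 :=
    fun x => by rw [real_inner_smul_left, normalComponent, sq]
  simp only [hNN] at I4
  rw [integral_surface_congr hR fun x hx => (accel_eq hR hv hw hx).trans
    (congrArg _ (norm_tanProj_adjoint_sq hR hv1 hx)),
    integral_add iTb igp,
    integral_add iT ib, integral_sub igs (ip.const_mul _),
    integral_sub ig (is.const_mul _), integral_const_mul, integral_const_mul, quadraticForm]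
  have hRi : ((n : ℝ) - 1) / R = ((n : ℝ) - 1) * R⁻¹ := div_eq_mul_inv _ _
  have hRi2 : ((n : ℝ) - 1) / R ^ 2 = ((n : ℝ) - 1) * R⁻¹ * R⁻¹ := by field_simp
  rw [hRi] at I1 I2 I4
  rw [hRi2]
  -- `I1`, `I2`, `I4` are the divergence theorem for w, for tr(AP)v - APv and for Nv. `I3` is the
  -- volume condition; it cancels the fluxes of the first two.
  linear_combination I1 + I2 + ((n : ℝ) - 1) * R⁻¹ * I3 - R⁻¹ * I4

/-! ### An abstract spectral gap for triangular symmetric operators -/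

section SpectralGap

variable {H K : Type*} [NormedAddCommGroup H] [InnerProductSpace ℝ H] [NormedAddCommGroup K]
  [InnerProductSpace ℝ K]

/-- A triple is to be thought of as (f, ∇f, -Δf). The projection is taken in the first component
only and then lifted to a triple of `T`, so that its gradient and Laplacian are at hand. -/
theorem exists_sub_orthogonal {T : Submodule ℝ (H × K × H)}
    [FiniteDimensional ℝ (T.map (LinearMap.fst ℝ H (K × H)))] (F : H) :
    ∃ s ∈ T, (∀ t ∈ T, ⟪F - s.1, t.1⟫_ℝ = 0) ∧ ∀ t ∈ T, ‖F - s.1‖ ≤ ‖F - t.1‖ := by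
  set W := T.map (LinearMap.fst ℝ H (K × H)) with hW
  obtain ⟨s, hs, hs'⟩ := (W.starProjection_apply_mem F)
  replace hs' : s.1 = W.starProjection F := hs'
  have horth : ∀ t ∈ T, ⟪F - s.1, t.1⟫_ℝ = 0 := fun t ht => by
    rw [hs']
    exact W.starProjection_inner_eq_zero F t.1 ⟨t, ht, rfl⟩
  refine ⟨s, hs, horth, fun t ht => ?_⟩
  have h0 : ⟪F - s.1, s.1 - t.1⟫_ℝ = 0 := horth (s - t) (T.sub_mem hs ht)
  have h1 := norm_add_sq_real (F - s.1) (s.1 - t.1)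
  rw [sub_add_sub_cancel, h0] at h1
  exact le_of_sq_le_sq (by nlinarith [sq_nonneg ‖s.1 - t.1‖]) (norm_nonneg _)

/-- Induction on the degree. Split t into its projection s to the lower degree and t - s. The cross
terms vanish since -Δ preserves the lower degree and is symmetric, and on t - s the form is exactly
the top eigenvalue, the lower-order error being orthogonal to it. -/
theorem le_inner_of_orthogonal {T : ℕ → Submodule ℝ (H × K × H)} {lam : ℕ → ℝ}
    (hmono : Monotone T) (hlam : Monotone lam)
    (hfin : ∀ d, FiniteDimensional ℝ ((T d).map (LinearMap.fst ℝ H (K × H))))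
    (hsymm : ∀ d, ∀ t ∈ T d, ∀ s ∈ T d, ⟪t.2.1, s.2.1⟫_ℝ = ⟪t.1, s.2.2⟫_ℝ)
    (htri : ∀ d, ∀ t ∈ T (d + 1), ∃ s ∈ T d, t.2.2 = lam (d + 1) • t.1 + s.1)
    (d : ℕ) {t : H × K × H} (ht : t ∈ T (d + 1)) (h1 : ∀ s ∈ T 1, ⟪t.1, s.1⟫_ℝ = 0) :
    lam 2 * ‖t.1‖ ^ 2 ≤ ⟪t.1, t.2.2⟫_ℝ := by
  induction d generalizing t with
  | zero =>
    have : t.1 = 0 := inner_self_eq_zero.1 (h1 t ht)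
    simp [this]
  | succ d ih =>
    have := hfin (d + 1)
    obtain ⟨s, hs, horth, -⟩ := exists_sub_orthogonal (T := T (d + 1)) t.1
    have hs2 : s ∈ T (d + 1 + 1) := hmono (Nat.le_succ _) hs
    obtain ⟨z, hz, hz'⟩ := htri d s hs
    obtain ⟨y, hy, hy'⟩ := htri (d + 1) (t - s) (Submodule.sub_mem _ ht hs2)
    have e1 : ⟪t.1 - s.1, s.2.2⟫_ℝ = 0 := by
      rw [hz', inner_add_right, real_inner_smul_right, horth s hs,
        horth z (hmono (Nat.le_succ _) hz)]
      simp
    have e2 : ⟪s.1, t.2.2 - s.2.2⟫_ℝ = 0 := by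
      have h2 := hsymm _ s hs2 (t - s) (Submodule.sub_mem _ ht hs2)
      have h3 := hsymm _ (t - s) (Submodule.sub_mem _ ht hs2) s hs2
      rw [real_inner_comm] at h3
      exact h2.symm.trans (h3.trans e1)
    have e3 : ⟪t.1 - s.1, t.2.2 - s.2.2⟫_ℝ = lam (d + 1 + 1) * ‖t.1 - s.1‖ ^ 2 := by
      have : t.2.2 - s.2.2 = lam (d + 1 + 1) • (t.1 - s.1) + y.1 := hy'
      rw [this, inner_add_right, real_inner_smul_right, real_inner_self_eq_norm_sq, horth y hy,
        add_zero]
    have e4 := ih hs fun r hr => by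
      have h4 := horth r (hmono (by omega) hr)
      rw [inner_sub_left, h1 r hr, zero_sub, neg_eq_zero] at h4
      exact h4
    have e5 : ⟪t.1, t.2.2⟫_ℝ = ⟪s.1, s.2.2⟫_ℝ + lam (d + 1 + 1) * ‖t.1 - s.1‖ ^ 2 := by
      have a1 : t.1 = s.1 + (t.1 - s.1) := by abel
      have a2 : t.2.2 = s.2.2 + (t.2.2 - s.2.2) := by abel
      rw [a1, a2, inner_add_left, inner_add_right, inner_add_right]
      simp only [add_sub_cancel_left]
      rw [e1, e2, e3]
      ring
    have e6 : ‖t.1‖ ^ 2 = ‖s.1‖ ^ 2 + ‖t.1 - s.1‖ ^ 2 := by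
      have := norm_add_sq_real (t.1 - s.1) s.1
      rw [sub_add_cancel, horth s hs] at this
      linarith
    have e7 : lam 2 ≤ lam (d + 1 + 1) := hlam (by omega)
    rw [e5, e6]
    nlinarith [sq_nonneg ‖t.1 - s.1‖]

/-- Bessel's inequality for gradients: if s is the projection of F, then ⟪G, ∇s⟫ = ⟪F, -Δs⟫ = ⟪s,
-Δs⟫ = ‖∇s‖², so ‖G‖² ≥ ‖∇s‖² ≥ λ₂‖s‖², and ‖s‖ approaches ‖F‖ by density. -/
theorem spectral_gap_of_orthogonal {T : ℕ → Submodule ℝ (H × K × H)} {lam : ℕ → ℝ}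
    (hmono : Monotone T) (hlam : Monotone lam)
    (hfin : ∀ d, FiniteDimensional ℝ ((T d).map (LinearMap.fst ℝ H (K × H))))
    (hsymm : ∀ d, ∀ t ∈ T d, ∀ s ∈ T d, ⟪t.2.1, s.2.1⟫_ℝ = ⟪t.1, s.2.2⟫_ℝ)
    (htri : ∀ d, ∀ t ∈ T (d + 1), ∃ s ∈ T d, t.2.2 = lam (d + 1) • t.1 + s.1)
    {F : H} {G : K} (hFG : ∀ d, ∀ t ∈ T d, ⟪G, t.2.1⟫_ℝ = ⟪F, t.2.2⟫_ℝ)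
    (h1 : ∀ t ∈ T 1, ⟪F, t.1⟫_ℝ = 0)
    (hdense : ∀ ε > 0, ∃ d, ∃ t ∈ T d, ‖F - t.1‖ < ε) :
    lam 2 * ‖F‖ ^ 2 ≤ ‖G‖ ^ 2 := by
  have key : ∀ ε > 0, ∃ x : ℝ, |x - ‖F‖| < ε ∧ lam 2 * x ^ 2 ≤ ‖G‖ ^ 2 := fun ε hε => by
    obtain ⟨d, t, ht, htε⟩ := hdense ε hε
    have := hfin (d + 1)
    obtain ⟨s, hs, horth, hmin⟩ := exists_sub_orthogonal (T := T (d + 1)) F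
    refine ⟨‖s.1‖, ?_, ?_⟩
    · rw [abs_sub_comm]
      exact (abs_norm_sub_norm_le _ _).trans_lt
        ((hmin t (hmono (Nat.le_succ _) ht)).trans_lt htε)
    · obtain ⟨z, hz, hz'⟩ := htri d s hs
      have e1 : ⟪F - s.1, s.2.2⟫_ℝ = 0 := by
        rw [hz', inner_add_right, real_inner_smul_right, horth s hs,
          horth z (hmono (Nat.le_succ _) hz)]
        simp
      have e2 := le_inner_of_orthogonal hmono hlam hfin hsymm htri d hs fun r hr => by
        have h4 := horth r (hmono (by omega) hr)
        rw [inner_sub_left, h1 r hr, zero_sub, neg_eq_zero] at h4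
        exact h4
      have e3 := norm_sub_sq_real G s.2.1
      rw [hFG _ s hs, ← real_inner_self_eq_norm_sq s.2.1, hsymm _ s hs s hs] at e3
      rw [inner_sub_left] at e1
      nlinarith [sq_nonneg ‖G - s.2.1‖]
  choose! x hx hx' using key
  have hlim : Filter.Tendsto x (𝓝[>] 0) (𝓝 ‖F‖) := by
    rw [tendsto_iff_norm_sub_tendsto_zero]
    refine squeeze_zero' (.of_forall fun _ => norm_nonneg _)
      (eventually_mem_nhdsWithin.mono fun ε hε => (hx ε hε).le) ?_
    exact tendsto_nhdsWithin_of_tendsto_nhds Filter.tendsto_id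
  exact le_of_tendsto ((hlim.pow 2).const_mul (lam 2))
    (eventually_mem_nhdsWithin.mono fun ε hε => hx' ε hε)

/-- Split off the projection s of F onto degree 1. Orthogonality to degree 0 makes s contribute
exactly λ₁‖s‖². The remainder is nonzero and contributes at least λ₂ times its square, whence
strictness. -/
theorem spectral_gap {T : ℕ → Submodule ℝ (H × K × H)} {lam : ℕ → ℝ}
    (hmono : Monotone T) (hlam : Monotone lam) (hlam1 : lam 1 < lam 2)
    (hfin : ∀ d, FiniteDimensional ℝ ((T d).map (LinearMap.fst ℝ H (K × H))))
    (hsymm : ∀ d, ∀ t ∈ T d, ∀ s ∈ T d, ⟪t.2.1, s.2.1⟫_ℝ = ⟪t.1, s.2.2⟫_ℝ)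
    (htri : ∀ d, ∀ t ∈ T (d + 1), ∃ s ∈ T d, t.2.2 = lam (d + 1) • t.1 + s.1)
    {F : H} {G : K} (hFG : ∀ d, ∀ t ∈ T d, ⟪G, t.2.1⟫_ℝ = ⟪F, t.2.2⟫_ℝ)
    (h0 : ∀ t ∈ T 0, ⟪F, t.1⟫_ℝ = 0) (h1 : ∀ t ∈ T 1, F ≠ t.1)
    (hdense : ∀ ε > 0, ∃ d, ∃ t ∈ T d, ‖F - t.1‖ < ε) :
    lam 1 * ‖F‖ ^ 2 < ‖G‖ ^ 2 := by
  have := hfin 1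
  obtain ⟨s, hs, horth, -⟩ := exists_sub_orthogonal (T := T 1) F
  obtain ⟨z, hz, hz'⟩ := htri 0 s hs
  have hz1 : z ∈ T 1 := hmono zero_le_one hz
  have e1 : ⟪F - s.1, s.2.2⟫_ℝ = 0 := by
    rw [hz', inner_add_right, real_inner_smul_right, horth s hs, horth z hz1]
    simp
  have e2 : ⟪s.1, z.1⟫_ℝ = 0 := by
    have h4 := horth z hz1
    rw [inner_sub_left, h0 z hz, zero_sub, neg_eq_zero] at h4
    exact h4
  have gap : lam 2 * ‖F - s.1‖ ^ 2 ≤ ‖G - s.2.1‖ ^ 2 := by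
    refine spectral_gap_of_orthogonal hmono hlam hfin hsymm htri (fun d t ht => ?_) horth
      fun ε hε => ?_
    · rw [inner_sub_left, inner_sub_left, hFG d t ht,
        hsymm (max d 1) s (hmono (le_max_right _ _) hs) t (hmono (le_max_left _ _) ht)]
    · obtain ⟨d, t, ht, h⟩ := hdense ε hε
      refine ⟨max d 1, t - s, Submodule.sub_mem _ (hmono (le_max_left _ _) ht)
        (hmono (le_max_right _ _) hs), ?_⟩
      rwa [Prod.fst_sub, sub_sub_sub_cancel_right]
  have e3 : ‖s.2.1‖ ^ 2 = lam 1 * ‖s.1‖ ^ 2 := by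
    rw [← real_inner_self_eq_norm_sq, hsymm 1 s hs s hs, hz', inner_add_right, e2,
      real_inner_smul_right, real_inner_self_eq_norm_sq, add_zero]
  have e4 : ‖G‖ ^ 2 = ‖G - s.2.1‖ ^ 2 + ‖s.2.1‖ ^ 2 := by
    have h5 := norm_add_sq_real (G - s.2.1) s.2.1
    rw [sub_add_cancel, inner_sub_left, hFG 1 s hs, hsymm 1 s hs s hs, ← inner_sub_left, e1] at h5
    linarith
  have e5 : ‖F‖ ^ 2 = ‖F - s.1‖ ^ 2 + ‖s.1‖ ^ 2 := by
    have h5 := norm_add_sq_real (F - s.1) s.1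
    rw [sub_add_cancel, horth s hs] at h5
    linarith
  have e6 : 0 < ‖F - s.1‖ := norm_pos_iff.2 (sub_ne_zero.2 (h1 s hs))
  rw [e4, e5, e3]
  nlinarith [pow_pos e6 2]

end SpectralGap

theorem inner_continuousMap_toLp {X : Type*} [TopologicalSpace X] [CompactSpace X]
    [MeasurableSpace X] [BorelSpace X] (μ : Measure X) [IsFiniteMeasure μ] {E : Type*}
    [NormedAddCommGroup E] [InnerProductSpace ℝ E] [SecondCountableTopologyEither X E]
    (f g : C(X, E)) :
    ⟪ContinuousMap.toLp 2 μ ℝ f, ContinuousMap.toLp 2 μ ℝ g⟫_ℝ = ∫ x, ⟪f x, g x⟫_ℝ ∂μ := by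
  rw [L2.inner_def]
  refine integral_congr_ae ?_
  filter_upwards [ContinuousMap.coeFn_toLp (p := 2) (𝕜 := ℝ) μ f,
    ContinuousMap.coeFn_toLp (p := 2) (𝕜 := ℝ) μ g] with x h1 h2
  rw [h1, h2]

/-! ### Powers of linear functions on the sphere -/

/-- The linear function `x ↦ ⟪a, x⟫` on the sphere of radius `R`, pulled back to the unit
sphere. -/
noncomputable def linearOnSphere {n : ℕ} (R : ℝ) : Eucl n →ₗ[ℝ] C(sphere (0 : Eucl n) 1, ℝ) where
  toFun a := ⟨fun ω => ⟪a, R • (ω : Eucl n)⟫_ℝ, by fun_prop⟩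
  map_add' a b := by ext ω; simp [inner_add_left]
  map_smul' c a := by ext ω; simp [real_inner_smul_left]

theorem linearOnSphere_apply {n : ℕ} (R : ℝ) (a : Eucl n) (ω : sphere (0 : Eucl n) 1) :
    linearOnSphere R a ω = ⟪a, R • (ω : Eucl n)⟫_ℝ := rfl

/-- The span of the powers of degree at most `d` of linear functions on the sphere. -/
noncomputable def powerSpan (n : ℕ) (R : ℝ) (d : ℕ) : Submodule ℝ C(sphere (0 : Eucl n) 1, ℝ) :=
  Submodule.span ℝ {f | ∃ a : Eucl n, ∃ k ≤ d, f = linearOnSphere R a ^ k}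

theorem powerSpan_mono {n : ℕ} (R : ℝ) : Monotone (powerSpan n R) := fun _ _ hde =>
  Submodule.span_mono fun _ ⟨a, k, hk, h⟩ => ⟨a, k, hk.trans hde, h⟩

instance finiteDimensional_powerSpan {n : ℕ} (R : ℝ) (d : ℕ) :
    FiniteDimensional ℝ (powerSpan n R d) := by
  set V : Submodule ℝ C(sphere (0 : Eucl n) 1, ℝ) := 1 ⊔ LinearMap.range (linearOnSphere R) with hV
  have h1 : (1 : Submodule ℝ C(sphere (0 : Eucl n) 1, ℝ)).FG := by
    rw [Submodule.one_eq_span]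
    exact Submodule.fg_span_singleton _
  have hVfg : V.FG := h1.sup (Module.Finite.iff_fg.1 inferInstance)
  have : FiniteDimensional ℝ (V ^ d : Submodule ℝ C(sphere (0 : Eucl n) 1, ℝ)) :=
    Module.Finite.iff_fg.2 (hVfg.pow d)
  refine Submodule.finiteDimensional_of_le (S₂ := V ^ d) (Submodule.span_le.2 ?_)
  rintro _ ⟨a, k, hk, rfl⟩
  have h2 : linearOnSphere R a ∈ V := (le_sup_right : _ ≤ V) ⟨a, rfl⟩
  exact pow_le_pow_right₀ (le_sup_left : 1 ≤ V) hk (Submodule.pow_mem_pow _ h2 k)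

/-- The exponentials of linear functions are closed under products, so their span is already an
algebra, and it separates points. Each is the limit of its power series, hence lies in the closure
of the span of powers; no product of powers has to be rewritten as a sum of powers. -/
theorem iSup_powerSpan_dense {n : ℕ} {R : ℝ} (hR : 0 < R) :
    (⨆ d, powerSpan n R d).topologicalClosure = ⊤ := by
  set W := (⨆ d, powerSpan n R d).topologicalClosure with hW
  let S : Submonoid C(sphere (0 : Eucl n) 1, ℝ) :=
    { carrier := Set.range fun a => NormedSpace.exp (linearOnSphere R a)
      one_mem' := ⟨0, by simp⟩
      mul_mem' := by
        rintro _ _ ⟨a, rfl⟩ ⟨b, rfl⟩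
        exact ⟨a + b, by
          dsimp only
          rw [map_add, NormedSpace.exp_add]⟩ }
  have hS : ∀ a, NormedSpace.exp (linearOnSphere R a) ∈ W := fun a => by
    have h1 := NormedSpace.exp_series_hasSum_exp' (𝕂 := ℝ) (linearOnSphere R a)
    refine (Submodule.isClosed_topologicalClosure _).mem_of_tendsto h1 (.of_forall fun s => ?_)
    refine Submodule.sum_mem _ fun k _ => Submodule.smul_mem _ _ ?_
    exact Submodule.le_topologicalClosure _ (Submodule.mem_iSup_of_mem k
      (Submodule.subset_span ⟨a, k, le_rfl, rfl⟩))
  have hadj : (Algebra.adjoin ℝ (S : Set C(sphere (0 : Eucl n) 1, ℝ))).toSubmodule ≤ W := by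
    rw [Algebra.adjoin_eq_span, Submonoid.closure_eq, Submodule.span_le]
    rintro _ ⟨a, rfl⟩
    exact hS a
  have hsep : (Algebra.adjoin ℝ (S : Set C(sphere (0 : Eucl n) 1, ℝ))).SeparatesPoints := by
    intro x y hxy
    refine ⟨_, ⟨_, Algebra.subset_adjoin ⟨(x : Eucl n), rfl⟩, rfl⟩, fun h => hxy ?_⟩
    have he : ∀ z, NormedSpace.exp (linearOnSphere R (x : Eucl n)) z =
        Real.exp ⟪(x : Eucl n), R • (z : Eucl n)⟫_ℝ := fun z => by
      have := NormedSpace.map_exp (ContinuousMap.evalAlgHom ℝ ℝ z)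
        (ContinuousEvalConst.continuous_eval_const z) (linearOnSphere R (x : Eucl n))
      rw [Real.exp_eq_exp_ℝ]
      exact this
    dsimp only at h
    rw [he, he, Real.exp_eq_exp, real_inner_smul_right, real_inner_smul_right,
      mul_right_inj' hR.ne', real_inner_self_eq_norm_sq] at h
    refine Subtype.ext ((inner_eq_one_iff_of_norm_eq_one (𝕜 := ℝ) ?_ ?_).1 ?_)
    · simp
    · simp
    · rw [← h]; simp
  have htop := ContinuousMap.subalgebra_topologicalClosure_eq_top_of_separatesPoints _ hsep
  refine top_le_iff.1 fun f _ => ?_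
  have hf : f ∈ closure (Algebra.adjoin ℝ (S : Set C(sphere (0 : Eucl n) 1, ℝ)) : Set _) := by
    rw [← Subalgebra.topologicalClosure_coe, htop]
    trivial
  exact closure_minimal hadj (Submodule.isClosed_topologicalClosure _) hf

theorem contDiff_inner_pow {n : ℕ} {m : WithTop ℕ∞} (a : Eucl n) (k : ℕ) :
    ContDiff ℝ m fun x : Eucl n => ⟪a, x⟫_ℝ ^ k :=
  (contDiff_const.inner ℝ contDiff_id).pow k

theorem hasFDerivAt_inner_pow {n : ℕ} (a : Eucl n) (k : ℕ) (x : Eucl n) :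
    HasFDerivAt (fun x : Eucl n => ⟪a, x⟫_ℝ ^ k) ((k * ⟪a, x⟫_ℝ ^ (k - 1)) • innerSL ℝ a) x := by
  have h0 : HasFDerivAt (innerSL ℝ a : Eucl n →L[ℝ] ℝ) (innerSL ℝ a) x :=
    ContinuousLinearMap.hasFDerivAt _
  have h1 := h0.pow k
  simpa [smul_smul] using h1

theorem tangentialGradient_inner_pow {n : ℕ} {R : ℝ} (hR : 0 < R) (a : Eucl n) (k : ℕ)
    {x : Eucl n} (hx : x ∈ closedBall (0 : Eucl n) R) :
    tangentialGradient R (fun y => ⟪a, y⟫_ℝ ^ k) x =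
      (k * ⟪a, x⟫_ℝ ^ (k - 1)) • tanProj R x a := by
  rw [tangentialGradient_eq, ← map_smul]
  congr 1
  refine ext_inner_right ℝ fun h => ?_
  rw [inner_gradientWithin, (hasFDerivAt_inner_pow a k x).hasFDerivWithinAt.fderivWithin
    (uniqueDiffOn_closedBall hR x hx), real_inner_smul_left]
  simp

/-! ### Green's formula for powers of linear functions -/

/-- The eigenvalues of the Laplace operator on the sphere of radius `R`. -/
noncomputable def sphereEigenvalue (n : ℕ) (R : ℝ) (k : ℕ) : ℝ := k * (k + n - 2) / R ^ 2

/-- The negative Laplace operator of the sphere applied to `x ↦ ⟪a, x⟫ ^ k`. -/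
noncomputable def laplacePow {n : ℕ} (R : ℝ) (a : Eucl n) (k : ℕ) :
    C(sphere (0 : Eucl n) 1, ℝ) :=
  sphereEigenvalue n R k • linearOnSphere R a ^ k -
    (k * (k - 1) * ‖a‖ ^ 2) • linearOnSphere R a ^ (k - 2)

/-- The tangential divergence theorem for the field f k⟪a, x⟫^(k-1) a, that is f times the gradient
of ⟪a, x⟫^k. Only first derivatives of f occur. -/
theorem integral_inner_tangentialGradient_pow {n : ℕ} (hn : 2 ≤ n) {R : ℝ} (hR : 0 < R)
    {f : Eucl n → ℝ} (hf : ContDiffOn ℝ 1 f (closedBall 0 R)) (a : Eucl n) (k : ℕ) :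
    ∫ ω : sphere (0 : Eucl n) 1, ⟪tangentialGradient R f (R • (ω : Eucl n)),
        tangentialGradient R (fun y => ⟪a, y⟫_ℝ ^ k) (R • (ω : Eucl n))⟫_ℝ
        ∂(volume : Measure (Eucl n)).toSphere =
      ∫ ω : sphere (0 : Eucl n) 1, f (R • (ω : Eucl n)) * laplacePow R a k ω
        ∂(volume : Measure (Eucl n)).toSphere := by
  have hmem : ∀ ω : sphere (0 : Eucl n) 1, R • (ω : Eucl n) ∈ sphere (0 : Eucl n) R :=
    smul_mem_sphere hR
  have hφ : ContDiffOn ℝ 1 (fun x => f x * (k * ⟪a, x⟫_ℝ ^ (k - 1))) (closedBall 0 R) :=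
    hf.mul (contDiff_const.mul (contDiff_inner_pow a (k - 1))).contDiffOn
  have hker := integral_sphere_tangential hn hR hφ a
  have hpt : ∀ ω : sphere (0 : Eucl n) 1,
      fderivWithin ℝ (fun x => f x * (k * ⟪a, x⟫_ℝ ^ (k - 1))) (closedBall 0 R)
        (R • (ω : Eucl n)) (tanProj R (R • (ω : Eucl n)) a) =
      ⟪tangentialGradient R f (R • (ω : Eucl n)),
        tangentialGradient R (fun y => ⟪a, y⟫_ℝ ^ k) (R • (ω : Eucl n))⟫_ℝ +
      f (R • (ω : Eucl n)) * (k * ((k - 1 : ℕ) * ⟪a, R • (ω : Eucl n)⟫_ℝ ^ (k - 2)) *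
        (‖a‖ ^ 2 - ⟪a, ω⟫_ℝ ^ 2)) := fun ω => by
    have hx := hmem ω
    have hxc := sphere_subset_closedBall hx
    have h1 := (hf.differentiableOn one_ne_zero _ hxc).hasFDerivWithinAt.fun_mul
      (((hasFDerivAt_inner_pow a (k - 1) (R • (ω : Eucl n))).const_mul
        (k : ℝ)).hasFDerivWithinAt (s := closedBall 0 R))
    have h2 : ⟪a, tanProj R (R • (ω : Eucl n)) a⟫_ℝ = ‖a‖ ^ 2 - ⟪a, ω⟫_ℝ ^ 2 := by
      rw [tanProj_smul hR, inner_sub_right, real_inner_smul_right, real_inner_self_eq_norm_sq,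
        real_inner_comm a]
      ring
    have h3 : tanProj R (R • (ω : Eucl n)) (tanProj R (R • (ω : Eucl n)) a) =
        tanProj R (R • (ω : Eucl n)) a := by
      rw [← mul_apply_eq_comp, tanProj_mul_self hx]
    have h4 : ∀ c : ℝ, ⟪gradientWithin f (closedBall 0 R) (R • (ω : Eucl n)),
        c • tanProj R (R • (ω : Eucl n)) a⟫_ℝ = c * fderivWithin ℝ f (closedBall 0 R)
          (R • (ω : Eucl n)) (tanProj R (R • (ω : Eucl n)) a) := fun c => by
      rw [real_inner_smul_right, inner_gradientWithin]
    rw [h1.fderivWithin (uniqueDiffOn_closedBall hR _ hxc), tangentialGradient_inner_pow hR a k hxc,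
      tangentialGradient_eq, inner_tanProj_left, map_smul, h3, h4]
    simp only [add_apply, smul_apply, innerSL_apply_apply, h2, smul_eq_mul, Nat.sub_sub]
    ring
  have hcf : Continuous fun ω : sphere (0 : Eucl n) 1 => f (R • (ω : Eucl n)) :=
    continuous_comp_smul_sphere hR (hf.continuousOn.mono sphere_subset_closedBall)
  have i1 : Integrable (fun ω : sphere (0 : Eucl n) 1 =>
      ⟪tangentialGradient R f (R • (ω : Eucl n)),
        tangentialGradient R (fun y => ⟪a, y⟫_ℝ ^ k) (R • (ω : Eucl n))⟫_ℝ)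
      (volume : Measure (Eucl n)).toSphere :=
    integrable_of_continuous_sphere ((continuous_comp_smul_sphere hR
      ((continuousOn_tangentialGradient hR hf).mono sphere_subset_closedBall)).inner
      (continuous_comp_smul_sphere hR ((continuousOn_tangentialGradient hR
        (contDiff_inner_pow a k).contDiffOn).mono sphere_subset_closedBall)))
  have i2 : Integrable (fun ω : sphere (0 : Eucl n) 1 =>
      f (R • (ω : Eucl n)) * (k * ((k - 1 : ℕ) * ⟪a, R • (ω : Eucl n)⟫_ℝ ^ (k - 2)) *
        (‖a‖ ^ 2 - ⟪a, ω⟫_ℝ ^ 2))) (volume : Measure (Eucl n)).toSphere :=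
    integrable_of_continuous_sphere (hcf.mul (by fun_prop))
  simp_rw [hpt] at hker
  rw [integral_add i1 i2] at hker
  have hrhs : ∀ ω : sphere (0 : Eucl n) 1, f (R • (ω : Eucl n)) * laplacePow R a k ω =
      R⁻¹ * (((n : ℝ) - 1) * (f (R • (ω : Eucl n)) * (k * ⟪a, R • (ω : Eucl n)⟫_ℝ ^ (k - 1)) *
        ⟪a, ω⟫_ℝ)) - f (R • (ω : Eucl n)) * (k * ((k - 1 : ℕ) *
          ⟪a, R • (ω : Eucl n)⟫_ℝ ^ (k - 2)) * (‖a‖ ^ 2 - ⟪a, ω⟫_ℝ ^ 2)) := fun ω => by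
    simp only [laplacePow, sphereEigenvalue, ContinuousMap.sub_apply, ContinuousMap.smul_apply,
      ContinuousMap.pow_apply, linearOnSphere_apply, real_inner_smul_right, smul_eq_mul]
    -- For k = 0, 1 the exponent k - 2 is truncated, but its coefficient k(k - 1) vanishes.
    rcases k with _ | _ | k
    · simp
    · simp
      field_simp
      ring
    · simp only [Nat.add_sub_cancel, show k + 1 + 1 - 2 = k by omega]
      push_cast
      field_simp
      ring
  simp_rw [hrhs]
  rw [integral_sub _ i2, integral_const_mul, integral_const_mul, ← hker,
      inv_mul_cancel_left₀ hR.ne', add_sub_cancel_right]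
  · exact integrable_of_continuous_sphere (continuous_const.mul (continuous_const.mul
      ((hcf.mul (by fun_prop)).mul (by fun_prop))))

/-! ### Triples of function, gradient and Laplacian in L² -/

/-- A function on the closed ball, restricted to the boundary and pulled back to the unit sphere. -/
noncomputable def restrictSphere {n : ℕ} {R : ℝ} (hR : 0 < R) {E : Type*} [TopologicalSpace E]
    {f : Eucl n → E} (hf : ContinuousOn f (closedBall 0 R)) : C(sphere (0 : Eucl n) 1, E) :=
  ⟨fun ω => f (R • (ω : Eucl n)), continuous_comp_smul_sphere hR (hf.mono sphere_subset_closedBall)⟩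

/-- The function in `L²` of the unit sphere given by a continuous function. -/
noncomputable abbrev sphereLp {n : ℕ} {E : Type*} [NormedAddCommGroup E] [InnerProductSpace ℝ E]
    [SecondCountableTopologyEither (sphere (0 : Eucl n) 1) E] :
    C(sphere (0 : Eucl n) 1, E) →L[ℝ] Lp E 2 (volume : Measure (Eucl n)).toSphere :=
  ContinuousMap.toLp 2 (volume : Measure (Eucl n)).toSphere ℝ

/-- A power of a linear function on the sphere, together with its tangential gradient and the
negative of its Laplacian. -/
noncomputable def powerTriple {n : ℕ} {R : ℝ} (hR : 0 < R) (a : Eucl n) (k : ℕ) :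
    Lp ℝ 2 (volume : Measure (Eucl n)).toSphere ×
      Lp (Eucl n) 2 (volume : Measure (Eucl n)).toSphere ×
      Lp ℝ 2 (volume : Measure (Eucl n)).toSphere :=
  (sphereLp (linearOnSphere R a ^ k),
    sphereLp (restrictSphere hR (continuousOn_tangentialGradient hR
      (contDiff_inner_pow a k).contDiffOn)),
    sphereLp (laplacePow R a k))

/-- The span of the triples of degree at most `d`. -/
noncomputable def tripleSpan {n : ℕ} {R : ℝ} (hR : 0 < R) (d : ℕ) :
    Submodule ℝ (Lp ℝ 2 (volume : Measure (Eucl n)).toSphere ×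
      Lp (Eucl n) 2 (volume : Measure (Eucl n)).toSphere ×
      Lp ℝ 2 (volume : Measure (Eucl n)).toSphere) :=
  Submodule.span ℝ {t | ∃ a : Eucl n, ∃ k ≤ d, t = powerTriple hR a k}

theorem tripleSpan_mono {n : ℕ} {R : ℝ} (hR : 0 < R) : Monotone (tripleSpan (n := n) hR) :=
  fun _ _ hde => Submodule.span_mono fun _ ⟨a, k, hk, h⟩ => ⟨a, k, hk.trans hde, h⟩

theorem map_fst_tripleSpan {n : ℕ} {R : ℝ} (hR : 0 < R) (d : ℕ) :
    (tripleSpan (n := n) hR d).map (LinearMap.fst ℝ _ _) =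
      (powerSpan n R d).map (sphereLp : C(sphere (0 : Eucl n) 1, ℝ) →L[ℝ] _).toLinearMap := by
  rw [tripleSpan, powerSpan, Submodule.map_span, Submodule.map_span]
  congr 1
  ext u
  constructor
  · rintro ⟨_, ⟨a, k, hk, rfl⟩, rfl⟩
    exact ⟨_, ⟨a, k, hk, rfl⟩, rfl⟩
  · rintro ⟨_, ⟨a, k, hk, rfl⟩, rfl⟩
    exact ⟨_, ⟨a, k, hk, rfl⟩, rfl⟩

theorem exists_powerSpan_of_mem_tripleSpan {n : ℕ} {R : ℝ} (hR : 0 < R) {d : ℕ} {t}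
    (ht : t ∈ tripleSpan (n := n) hR d) : ∃ p ∈ powerSpan n R d, sphereLp p = t.1 := by
  have h : t.1 ∈ (tripleSpan (n := n) hR d).map (LinearMap.fst ℝ _ _) := ⟨t, ht, rfl⟩
  rw [map_fst_tripleSpan] at h
  exact h

theorem exists_tripleSpan_of_mem_powerSpan {n : ℕ} {R : ℝ} (hR : 0 < R) {d : ℕ} {p}
    (hp : p ∈ powerSpan n R d) : ∃ t ∈ tripleSpan (n := n) hR d, t.1 = sphereLp p := by
  have h : sphereLp p ∈
    (powerSpan n R d).map (sphereLp : C(sphere (0 : Eucl n) 1, ℝ) →L[ℝ] _).toLinearMap :=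
    ⟨p, hp, rfl⟩
  rw [← map_fst_tripleSpan hR] at h
  exact h

theorem inner_tangentialGradient_triple {n : ℕ} (hn : 2 ≤ n) {R : ℝ} (hR : 0 < R)
    {f : Eucl n → ℝ} (hf : ContDiffOn ℝ 1 f (closedBall 0 R)) (d : ℕ) {t}
    (ht : t ∈ tripleSpan (n := n) hR d) :
    ⟪sphereLp (restrictSphere hR (continuousOn_tangentialGradient hR hf)), t.2.1⟫_ℝ =
      ⟪sphereLp (restrictSphere hR hf.continuousOn), t.2.2⟫_ℝ := by
  induction ht using Submodule.span_induction with
  | mem t ht =>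
    obtain ⟨a, k, -, rfl⟩ := ht
    rw [powerTriple, inner_continuousMap_toLp, inner_continuousMap_toLp]
    refine (integral_inner_tangentialGradient_pow hn hR hf a k).trans ?_
    exact integral_congr_ae (.of_forall fun ω => mul_comm _ _)
  | zero => simp
  | add s t _ _ hs ht =>
    rw [Prod.snd_add, Prod.fst_add, Prod.snd_add, inner_add_right, inner_add_right, hs, ht]
  | smul c t _ ht =>
    rw [Prod.smul_snd, Prod.smul_fst, Prod.smul_snd, real_inner_smul_right,
      real_inner_smul_right, ht]

theorem inner_triple {n : ℕ} (hn : 2 ≤ n) {R : ℝ} (hR : 0 < R) (d : ℕ) {t s}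
    (ht : t ∈ tripleSpan (n := n) hR d) (hs : s ∈ tripleSpan (n := n) hR d) :
    ⟪t.2.1, s.2.1⟫_ℝ = ⟪t.1, s.2.2⟫_ℝ := by
  induction ht using Submodule.span_induction with
  | mem t ht =>
    obtain ⟨a, k, -, rfl⟩ := ht
    exact inner_tangentialGradient_triple hn hR (contDiff_inner_pow a k).contDiffOn d hs
  | zero => simp
  | add s t _ _ hs ht =>
    rw [Prod.snd_add, Prod.fst_add, Prod.fst_add, inner_add_left, inner_add_left, hs, ht]
  | smul c t _ ht =>
    rw [Prod.smul_snd, Prod.smul_fst, Prod.smul_fst, real_inner_smul_left,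
      real_inner_smul_left, ht]

/-- The term of degree k - 2 always has degree at most d. The leading term differs from the
prescribed multiple by a difference of eigenvalues, which is zero exactly when needed, at k = d + 1.
-/
theorem laplace_triple {n : ℕ} {R : ℝ} (hR : 0 < R) (d : ℕ) {t}
    (ht : t ∈ tripleSpan (n := n) hR (d + 1)) :
    ∃ s ∈ tripleSpan (n := n) hR d, t.2.2 = sphereEigenvalue n R (d + 1) • t.1 + s.1 := by
  suffices h : ∃ p ∈ powerSpan n R d,
      sphereLp p = t.2.2 - sphereEigenvalue n R (d + 1) • t.1 by
    obtain ⟨p, hp, hpt⟩ := h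
    obtain ⟨s, hs, hsp⟩ := exists_tripleSpan_of_mem_powerSpan hR hp
    exact ⟨s, hs, by rw [hsp, hpt]; abel⟩
  induction ht using Submodule.span_induction with
  | mem t ht =>
    obtain ⟨a, k, hk, rfl⟩ := ht
    refine ⟨laplacePow R a k - sphereEigenvalue n R (d + 1) • linearOnSphere R a ^ k, ?_, ?_⟩
    · have h : laplacePow R a k - sphereEigenvalue n R (d + 1) • linearOnSphere R a ^ k =
          (sphereEigenvalue n R k - sphereEigenvalue n R (d + 1)) • linearOnSphere R a ^ k -
            (k * (k - 1) * ‖a‖ ^ 2) • linearOnSphere R a ^ (k - 2) := by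
        rw [laplacePow]
        module
      rw [h]
      refine Submodule.sub_mem _ ?_ (Submodule.smul_mem _ _
        (Submodule.subset_span ⟨a, k - 2, by omega, rfl⟩))
      rcases hk.eq_or_lt with rfl | hk
      · simp
      · exact Submodule.smul_mem _ _ (Submodule.subset_span ⟨a, k, by omega, rfl⟩)
    · rw [map_sub, map_smul]
      rfl
  | zero => exact ⟨0, Submodule.zero_mem _, by simp⟩
  | add s t _ _ hs ht =>
    obtain ⟨p, hp, hps⟩ := hs
    obtain ⟨q, hq, hqt⟩ := ht
    refine ⟨p + q, Submodule.add_mem _ hp hq, ?_⟩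
    rw [map_add, hps, hqt, Prod.snd_add, Prod.snd_add, Prod.fst_add]
    module
  | smul c t _ ht =>
    obtain ⟨p, hp, hpt⟩ := ht
    refine ⟨c • p, Submodule.smul_mem _ c hp, ?_⟩
    rw [map_smul, hpt, Prod.smul_snd, Prod.smul_snd, Prod.smul_fst]
    module

/-! ### The sharp Poincaré inequality -/

theorem sphereEigenvalue_mono {n : ℕ} (hn : 2 ≤ n) (R : ℝ) : Monotone (sphereEigenvalue n R) := by
  have hn' : (2 : ℝ) ≤ n := by exact_mod_cast hn
  intro k l hkl
  have hkl' : (k : ℝ) ≤ l := by exact_mod_cast hkl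
  have hk : (0 : ℝ) ≤ k := k.cast_nonneg
  refine div_le_div_of_nonneg_right ?_ (sq_nonneg R)
  exact mul_le_mul hkl' (by linarith) (by linarith) (by linarith)

/-- The tangential divergence theorem with f = 1; n - 1 ≠ 0 may be cancelled. -/
theorem integral_linearOnSphere {n : ℕ} (hn : 2 ≤ n) {R : ℝ} (hR : 0 < R) (a : Eucl n) :
    ∫ ω, linearOnSphere R a ω ∂(volume : Measure (Eucl n)).toSphere = 0 := by
  have h := integral_sphere_tangential hn hR (f := fun _ => 1) contDiffOn_const a
  have hn' : (n : ℝ) - 1 ≠ 0 := by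
    have : (2 : ℝ) ≤ n := by exact_mod_cast hn
    linarith
  simp only [fderivWithin_fun_const, Pi.zero_apply, zero_apply, integral_zero, mul_zero,
    one_mul] at h
  simp_rw [linearOnSphere_apply, real_inner_smul_right]
  rw [integral_const_mul, (mul_eq_zero.1 h.symm).resolve_left hn', mul_zero]

theorem eq_linear_of_mem_powerSpan_one {n : ℕ} (hn : 2 ≤ n) {R : ℝ} (hR : 0 < R)
    {p : C(sphere (0 : Eucl n) 1, ℝ)} (hp : p ∈ powerSpan n R 1)
    (hmean : ∫ ω, p ω ∂(volume : Measure (Eucl n)).toSphere = 0) :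
    ∃ a, p = linearOnSphere R a := by
  have h1 : ∃ (c : ℝ) (a : Eucl n), p = c • 1 + linearOnSphere R a := by
    clear hmean
    induction hp using Submodule.span_induction with
    | mem p hp =>
      obtain ⟨a, k, hk, rfl⟩ := hp
      interval_cases k
      · exact ⟨1, 0, by simp⟩
      · exact ⟨0, a, by simp⟩
    | zero => exact ⟨0, 0, by simp⟩
    | add p q _ _ hp hq =>
      obtain ⟨c, a, rfl⟩ := hp
      obtain ⟨d, b, rfl⟩ := hq
      exact ⟨c + d, a + b, by rw [map_add]; module⟩
    | smul e p _ hp =>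
      obtain ⟨c, a, rfl⟩ := hp
      exact ⟨e * c, e • a, by rw [map_smul]; module⟩
  obtain ⟨c, a, rfl⟩ := h1
  refine ⟨a, ?_⟩
  have : Nontrivial (Eucl n) := by
    have : Nonempty (Fin n) := ⟨⟨0, by omega⟩⟩
    infer_instance
  have hne : (volume : Measure (Eucl n)).toSphere.real Set.univ ≠ 0 := by
    have : Nonempty (sphere (0 : Eucl n) 1) :=
      (NormedSpace.sphere_nonempty.2 zero_le_one).to_subtype
    exact (ENNReal.toReal_pos (isOpen_univ.measure_ne_zero _ Set.univ_nonempty)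
      (measure_ne_top _ _)).ne'
  have hc : c = 0 := by
    simp only [ContinuousMap.add_apply, ContinuousMap.smul_apply, ContinuousMap.one_apply] at hmean
    rw [integral_add (integrable_const _)
      (integrable_of_continuous_sphere (linearOnSphere R a).continuous),
      integral_linearOnSphere hn hR, integral_const, add_zero] at hmean
    simpa only [smul_eq_mul, mul_one, mul_eq_zero, hne, false_or] using hmean
  simp [hc]

/-- The sharp Poincaré inequality on the sphere: equality holds for linear functions only. -/
theorem quadraticForm_pos {n : ℕ} (hn : 2 ≤ n) {R : ℝ} (hR : 0 < R) {f : Eucl n → ℝ}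
    (hf : ContDiffOn ℝ 1 f (closedBall 0 R)) (hmean : ∫ x, f x ∂(surfaceMeasure n R) = 0)
    (hlin : ¬ ∃ a : Eucl n, ∀ x ∈ sphere (0 : Eucl n) R, f x = ⟪a, x⟫_ℝ) :
    0 < quadraticForm R f := by
  have hn' : (2 : ℝ) ≤ n := by exact_mod_cast hn
  have hRn : R ^ (n - 1) ≠ 0 := by positivity
  set g := restrictSphere hR hf.continuousOn with hg
  have hmean' : ∫ ω, g ω ∂(volume : Measure (Eucl n)).toSphere = 0 := by
    rw [integral_surfaceMeasure hR] at hmean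
    exact (mul_eq_zero.1 hmean).resolve_left hRn
  have hlam1 : sphereEigenvalue n R 1 < sphereEigenvalue n R 2 := by
    refine div_lt_div_of_pos_right ?_ (by positivity)
    push_cast
    linarith
  have key := spectral_gap (tripleSpan_mono hR) (sphereEigenvalue_mono hn R) hlam1
    (fun d => by rw [map_fst_tripleSpan]; infer_instance)
    (fun d t ht s hs => inner_triple hn hR d ht hs) (fun d t ht => laplace_triple hR d ht)
    (fun d t ht => inner_tangentialGradient_triple hn hR hf d ht)
    -- Degree 0 consists of the constants, to which a function of mean zero is orthogonal.
    (fun t ht => by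
      obtain ⟨p, hp, hpt⟩ := exists_powerSpan_of_mem_tripleSpan hR ht
      rw [← hpt]
      clear hpt
      induction hp using Submodule.span_induction with
      | mem p hp =>
        obtain ⟨a, k, hk, rfl⟩ := hp
        rw [Nat.le_zero.1 hk, inner_continuousMap_toLp, ← hmean']
        simp [hg]
      | zero => simp
      | add p q _ _ hp hq => rw [map_add, inner_add_right, hp, hq, add_zero]
      | smul c p _ hp => rw [map_smul, real_inner_smul_right, hp, mul_zero])
    -- Equality in L² of continuous functions is equality everywhere, so a function of degree 1 with
    -- mean zero would be linear on the sphere.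
    (fun t ht h => by
      obtain ⟨p, hp, hpt⟩ := exists_powerSpan_of_mem_tripleSpan hR ht
      have hgp : g = p := ContinuousMap.toLp_injective _ (h.trans hpt.symm)
      obtain ⟨a, ha⟩ := eq_linear_of_mem_powerSpan_one hn hR (hgp ▸ hp) hmean'
      refine hlin ⟨a, fun x hx => ?_⟩
      have hx1 : R⁻¹ • x ∈ sphere (0 : Eucl n) 1 := by
        rw [mem_sphere_zero_iff_norm] at hx ⊢
        rw [norm_smul, hx, Real.norm_of_nonneg (by positivity), inv_mul_cancel₀ hR.ne']
      have := congrArg (fun q : C(sphere (0 : Eucl n) 1, ℝ) => q ⟨R⁻¹ • x, hx1⟩) ha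
      simpa [hg, restrictSphere, linearOnSphere_apply, smul_smul, hR.ne'] using this)
    -- Uniform density passes to L² by continuity of the embedding.
    (fun ε hε => by
      have h1 : g ∈ closure ((⨆ d, powerSpan n R d : Submodule ℝ _) : Set _) := by
        rw [← Submodule.topologicalClosure_coe, iSup_powerSpan_dense hR]
        trivial
      obtain ⟨_, ⟨p, hp, rfl⟩, hpε⟩ := Metric.mem_closure_iff.1
        (image_closure_subset_closure_image (sphereLp (n := n) (E := ℝ)).continuous
          ⟨g, h1, rfl⟩) ε hε
      obtain ⟨d, hd⟩ := (Submodule.mem_iSup_of_directed _ (powerSpan_mono R).directed_le).1 hp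
      obtain ⟨t, ht, htp⟩ := exists_tripleSpan_of_mem_powerSpan hR hd
      exact ⟨d, t, ht, by rwa [htp, ← dist_eq_norm]⟩)
  rw [← real_inner_self_eq_norm_sq, ← real_inner_self_eq_norm_sq, inner_continuousMap_toLp,
    inner_continuousMap_toLp] at key
  have e1 : ∀ ω : sphere (0 : Eucl n) 1, ⟪g ω, g ω⟫_ℝ = f (R • (ω : Eucl n)) ^ 2 := fun ω => by
    rw [real_inner_self_eq_norm_sq, Real.norm_eq_abs, sq_abs]
    rfl
  simp_rw [← hg, e1, real_inner_self_eq_norm_sq] at key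
  rw [quadraticForm, integral_surfaceMeasure hR, integral_surfaceMeasure hR]
  have e2 : sphereEigenvalue n R 1 = ((n : ℝ) - 1) / R ^ 2 := by
    rw [sphereEigenvalue]
    push_cast
    ring
  rw [e2] at key
  have := mul_lt_mul_of_pos_left key (show 0 < R ^ (n - 1) by positivity)
  refine sub_pos.2 (lt_of_eq_of_lt ?_ this)
  ring

end BallVariation

theorem mainTheorem7 (n : ℕ) (hn : 2 ≤ n) (R : ℝ) (hR : 0 < R)
    (v w : Eucl n → Eucl n) (r : ℝ → Eucl n → Eucl n)
    (hv : ContDiffOn ℝ 2 v (closedBall 0 R)) (hw : ContDiffOn ℝ 2 w (closedBall 0 R))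
    (hr : IsRemainder R r) (hvol : VolumePreserving R v w) :
    -- the second variation of the surface area
    HasSecondVariation (surfaceArea R (perturbation v w r))
      (quadraticForm R (normalComponent R v)) ∧
    -- without remainder term it is a second derivative in the classical sense
    (ContDiffAt ℝ 2 (surfaceArea R (perturbation v w 0)) 0 ∧
      iteratedDeriv 2 (surfaceArea R (perturbation v w 0)) 0 =
        quadraticForm R (normalComponent R v)) ∧
    -- positivity for Hadamard perturbations
    (IsHadamard R v w →
      (¬ ∃ a : Eucl n, ∀ x ∈ sphere (0 : Eucl n) R, normalComponent R v x = ⟪a, x⟫_ℝ) →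
      ∃ s : ℝ, HasSecondVariation (surfaceArea R (perturbation v w r)) s ∧ 0 < s) ∧
    -- and, more generally, for all perturbations considered here
    ((¬ ∃ a : Eucl n, ∀ x ∈ sphere (0 : Eucl n) R, normalComponent R v x = ⟪a, x⟫_ℝ) →
      0 < quadraticForm R (normalComponent R v)) := by
  have hv1 : ContDiffOn ℝ 1 v (closedBall 0 R) := hv.of_le one_le_two
  have hsecond : iteratedDeriv 2 (surfaceArea R (perturbation v w 0)) 0 =
      quadraticForm R (normalComponent R v) :=
    (surfaceArea_contDiffAt hR hv hw).2.trans (integral_accel hn hR hv hw hvol)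
  have hvar : HasSecondVariation (surfaceArea R (perturbation v w r))
      (quadraticForm R (normalComponent R v)) :=
    hsecond ▸ hasSecondVariation_perturbation hR hv hw hr
  have hpos : (¬ ∃ a : Eucl n, ∀ x ∈ sphere (0 : Eucl n) R, normalComponent R v x = ⟪a, x⟫_ℝ) →
      0 < quadraticForm R (normalComponent R v) :=
    quadraticForm_pos hn hR (contDiffOn_normalComponent hv1)
      (integral_normalComponent_eq_zero hn hR hv1 hvol)
  exact ⟨hvar, ⟨(surfaceArea_contDiffAt hR hv hw).1, hsecond⟩,
    fun _ ha => ⟨_, hvar, hpos ha⟩, hpos⟩
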